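/- Let $0<a<b$, $\alpha>0$, $\sigma=b/a$ and $\Omega=\{x\in\mathbb R^2: a<|x|<b\}$. Let $X_1$ be the space of vector fields $u\in H^1(\Omega;\mathbb R^2)$ with $\nabla\cdot u=0$ in $\Omega$, $u\cdot n=0$ on $\partial\Omega$ and $\int_{|x|=r}u\cdot\tau\,ds=0$ for $a\le r\le b$ ($n$, $\tau$ the unit normal and tangent, $u_\tau=u\cdot\tau$ in the sense of traces). For $u\in X_1$ put $$E_1(u)=\int_\Omega|\nabla u|^2\,dx+\frac1b\int_{|x|=b}u_\tau^2\,ds,\qquad E_2(u)=\int_{|x|=a}u_\tau^2\,ds,\qquad E_3(u)=\int_\Omega|u|^2\,dx,$$ $$\gamma=\inf_{u\in X_1,\,E_2(u)\neq0}\frac{E_1(u)}{E_2(u)},\qquad \mu_c=\frac{a\alpha}{a\gamma+1},\qquad -\lambda_1(\mu)=\inf_{0\ne u\in X_1}\frac{\mu E_1(u)-(\alpha-\mu a^{-1})E_2(u)}{E_3(u)}\quad(\mu>0).$$ For an integer $n\ge1$ let $\Delta_n=\frac{d^2}{dr^2}+\frac1r\frac{d}{dr}-\frac{n^2}{r^2}$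 and $$\gamma_n=\inf\Big\{\frac{\int_a^b r(\Delta_n\Phi)^2\,dr}{\Phi'(a)^2}:\ \Phi\in H^2(a,b),\ \Phi(a)=\Phi(b)=0,\ \Phi'(a)\ne0\Big\}.$$ All these infima are over nonempty sets bounded below, and the following hold. 1. $\gamma_n<\gamma_{n+1}$ for all $n\ge1$; the infimum $\gamma$ is given by the mode $n=1$: $a\gamma=\gamma_1+1$, and hence $\mu_c=\dfrac{a\alpha}{\gamma_1+2}$. 2. The solutions of $\Delta_1^2\Psi=0$ in $(a,b)$ are exactly the functions $\Psi=c_1r+c_2r\ln r+\dfrac{c_3}{r}+c_4r^3$ with $c_1,\dots,c_4\in\mathbb R$. 3. For $\mu>0$ the problem $$\Delta_1^2\Psi=0\ \text{ in }(a,b),\qquad \Psi=\Psi''-\Big(\frac1r-\frac{\alpha}{\mu}\Big)\Psi'=0\ \text{ at } r=a,\qquad \Psi=\Psi''+\frac{\Psi'}{r}=0\ \text{ at } r=b$$ has a nontrivial solution if and only if $$\begin{vmatrix}a^2&a^2\ln a&1&a^4\\ b^2&b^2\ln b&1&b^4\\ b^2&b^2(2+\ln b)&1&9b^4\\ -a^2\mu+\alpha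 a^3&a^3\alpha-a^2\mu\ln a+a^3\alpha\ln a&3\mu-a\alpha&3a^5\alpha+3a^4\mu\end{vmatrix}=0,$$ and if and only if $\mu=\mu_c$. 4. The critical viscosity is $$\mu_c=\frac{a\alpha\left(1+3\sigma^4-4\sigma^2-4\sigma^4\ln\sigma\right)}{2\left(\sigma^4-1-4\sigma^4\ln\sigma\right)}>0.$$ 5. For $\mu>0$, $\lambda_1(\mu)=0$ if and only if $\mu=\mu_c$. At $\mu=\mu_c$, $\lambda_1(\mu_c)=0$ is the largest eigenvalue $\lambda$ of the (weakly formulated) problem $\mu_c\Delta v-\nabla q=\lambda v$, $\nabla\cdot v=0$ in $\Omega$, i.e. of: $0\ne u\in X_1$ and $$\mu_c\Big(\int_\Omega\nabla u:\nabla w\,dx+\frac1b\int_{|x|=b}u_\tau w_\tau\,ds\Big)-(\alpha-\mu_ca^{-1})\int_{|x|=a}u_\tau w_\tau\,ds=-\lambda\int_\Omega u\cdot w\,dx\qquad\text{for all }w\in X_1;$$ moreover $\lambda_1$ is differentiable at $\mu_c$ and $\dfrac{d\lambda_1}{d\mu}\Big|_{\mu=\mu_c}<0$. -/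

import Mathlib

open MeasureTheory Set Filter Topology
open scoped ContDiff

namespace AnnulusFlow

noncomputable section

/-- The open annulus `a < |x| < b` in the plane (used for `0 < a < b`). -/
def annulus (a b : ℝ) : Set (ℝ × ℝ) :=
  {x | a ^ 2 < x.1 ^ 2 + x.2 ^ 2 ∧ x.1 ^ 2 + x.2 ^ 2 < b ^ 2}

/-- The point with polar coordinates `(r, θ)`. -/
def circlePt (r θ : ℝ) : ℝ × ℝ := (r * Real.cos θ, r * Real.sin θ)

/-- Integral over the circle `|x| = r` with respect to arc length, of a function of the angle. -/
def arcInt (r : ℝ) (g : ℝ → ℝ) : ℝ := ∫ θ in (0 : ℝ)..(2 * Real.pi), g θ * r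

/-- The standard basis vectors of the plane. -/
def unitVec : Fin 2 → ℝ × ℝ := ![(1, 0), (0, 1)]

/-- The partial derivative in direction `i`. -/
def partialD (i : Fin 2) (φ : ℝ × ℝ → ℝ) (x : ℝ × ℝ) : ℝ := fderiv ℝ φ x (unitVec i)

/-- The components of the radial unit vector at angle `θ`. -/
def radialVec (θ : ℝ) : Fin 2 → ℝ := ![Real.cos θ, Real.sin θ]

/-- The components of the tangential unit vector at angle `θ`. -/
def tangentVec (θ : ℝ) : Fin 2 → ℝ := ![-Real.sin θ, Real.cos θ]

/-- The radial component of a vector field on the circle of radius `r`, as a function of `θ`. -/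
def radial (v : Fin 2 → ℝ × ℝ → ℝ) (r θ : ℝ) : ℝ :=
  ∑ i, v i (circlePt r θ) * radialVec θ i

/-- The tangential component of a vector field on the circle of radius `r`. -/
def tangential (v : Fin 2 → ℝ × ℝ → ℝ) (r θ : ℝ) : ℝ :=
  ∑ i, v i (circlePt r θ) * tangentVec θ i

/-- `g` is the weak gradient of `u` in the annulus. -/
def IsWeakGradient (a b : ℝ) (u : ℝ × ℝ → ℝ) (g : Fin 2 → ℝ × ℝ → ℝ) : Prop :=
  ∀ φ : ℝ × ℝ → ℝ, ContDiff ℝ ∞ φ → HasCompactSupport φ → tsupport φ ⊆ annulus a b →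
    ∀ i : Fin 2,
      ∫ x in annulus a b, u x * partialD i φ x = -∫ x in annulus a b, g i x * φ x

/-- `t` (only its values on the two boundary circles matter) is the boundary trace of the
function `u` with weak gradient `g`: the Gauss-Green formula holds against every function that is
smooth up to the boundary. The outward unit normal is the radial vector on `|x| = b` and its
opposite on `|x| = a`. -/
def IsTrace (a b : ℝ) (u : ℝ × ℝ → ℝ) (g : Fin 2 → ℝ × ℝ → ℝ) (t : ℝ × ℝ → ℝ) : Prop :=
  ∀ φ : ℝ × ℝ → ℝ, ContDiff ℝ ∞ φ → ∀ i : Fin 2,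
    ∫ x in annulus a b, (u x * partialD i φ x + g i x * φ x)
      = arcInt b (fun θ => t (circlePt b θ) * φ (circlePt b θ) * radialVec θ i)
        - arcInt a (fun θ => t (circlePt a θ) * φ (circlePt a θ) * radialVec θ i)

/-- The space `X₁` of divergence-free vector fields of class `H¹` in the annulus, tangent to the
boundary and with zero circulation along the circles `|x| = r`. An element is a field together
with its weak gradient (`grad i j` is the weak derivative of the `i`-th component in direction
`j`) and its boundary trace in `L²`; both are determined by the field up to null sets. -/
structure X1 (a b : ℝ) where
  vel : Fin 2 → ℝ × ℝ → ℝ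
  grad : Fin 2 → Fin 2 → ℝ × ℝ → ℝ
  trace : Fin 2 → ℝ × ℝ → ℝ
  vel_memLp : ∀ i, MemLp (vel i) 2 (volume.restrict (annulus a b))
  grad_memLp : ∀ i j, MemLp (grad i j) 2 (volume.restrict (annulus a b))
  trace_memLp : ∀ i, ∀ r ∈ ({a, b} : Set ℝ),
    MemLp (fun θ => trace i (circlePt r θ)) 2 (volume.restrict (Ioc 0 (2 * Real.pi)))
  isWeakGradient : ∀ i, IsWeakGradient a b (vel i) (grad i)
  isTrace : ∀ i, IsTrace a b (vel i) (grad i) (trace i)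
  div_eq_zero : ∀ᵐ x ∂(volume.restrict (annulus a b)), ∑ i, grad i i x = 0
  normal_eq_zero : ∀ r ∈ ({a, b} : Set ℝ),
    ∀ᵐ θ ∂(volume.restrict (Ioc 0 (2 * Real.pi))), radial trace r θ = 0
  average_eq_zero : ∀ᵐ r ∂(volume.restrict (Ioo a b)), arcInt r (tangential vel r) = 0

/-- The bilinear form whose quadratic form is
`E₁(u) = ∫_Ω |∇u|² + (1/b) ∫_{|x| = b} u_τ²`. -/
def E1 {a b : ℝ} (u w : X1 a b) : ℝ :=
  (∫ x in annulus a b, ∑ i, ∑ j, u.grad i j x * w.grad i j x)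
    + 1 / b * arcInt b (fun θ => tangential u.trace b θ * tangential w.trace b θ)

/-- The bilinear form whose quadratic form is `E₂(u) = ∫_{|x| = a} u_τ²`. -/
def E2 {a b : ℝ} (u w : X1 a b) : ℝ :=
  arcInt a (fun θ => tangential u.trace a θ * tangential w.trace a θ)

/-- The bilinear form whose quadratic form is `E₃(u) = ∫_Ω |u|²`. -/
def E3 {a b : ℝ} (u w : X1 a b) : ℝ :=
  ∫ x in annulus a b, ∑ i, u.vel i x * w.vel i x

/-- The quotients `(μ E₁(u) - (α - μ/a) E₂(u)) / E₃(u)`, for `u ≠ 0` in `X₁`. -/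
def energyQuotients (a b α μ : ℝ) : Set ℝ :=
  {q | ∃ u : X1 a b, E3 u u ≠ 0 ∧ q = (μ * E1 u u - (α - μ / a) * E2 u u) / E3 u u}

/-- The first eigenvalue: `-λ₁(μ) = inf (μ E₁(u) - (α - μ/a) E₂(u)) / E₃(u)`. -/
def lambda1 (a b α μ : ℝ) : ℝ := -sInf (energyQuotients a b α μ)

/-- `lam` is an eigenvalue of `μ Δv - ∇q = lam v`, `div v = 0` in the annulus, with `v · n = 0` on
the boundary, Navier slip condition with coefficient `α` on `|x| = a`, vanishing vorticity on
`|x| = b` and zero circulations, in the weak formulation. -/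
def IsStokesEigenvalue (a b α μ lam : ℝ) : Prop :=
  ∃ u : X1 a b, E3 u u ≠ 0 ∧
    ∀ w : X1 a b, μ * E1 u w - (α - μ / a) * E2 u w = -lam * E3 u w

/-- The quotients `E₁(u) / E₂(u)`, for `u` in `X₁` with `E₂(u) ≠ 0`. -/
def boundaryQuotients (a b : ℝ) : Set ℝ :=
  {q | ∃ u : X1 a b, E2 u u ≠ 0 ∧ q = E1 u u / E2 u u}

/-- The variational constant `γ = inf E₁(u) / E₂(u)`. -/
def gammaInf (a b : ℝ) : ℝ := sInf (boundaryQuotients a b)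

/-- The critical viscosity, defined through `γ`. -/
def muC (a b α : ℝ) : ℝ := a * α / (a * gammaInf a b + 1)

/-- The Sobolev space `H²(a, b)`: the `C¹` representative on `[a, b]`, its absolutely continuous
first derivative and its square integrable second derivative. -/
structure H2 (a b : ℝ) where
  val : ℝ → ℝ
  d1 : ℝ → ℝ
  d2 : ℝ → ℝ
  d2_memLp : MemLp d2 2 (volume.restrict (Ioo a b))
  d1_eq : ∀ r ∈ Icc a b, d1 r = d1 a + ∫ s in a..r, d2 s
  val_eq : ∀ r ∈ Icc a b, val r = val a + ∫ s in a..r, d1 s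

/-- The quotients `∫ r (Δₙ Φ)² dr / Φ'(a)²` for `Φ` in `H²(a, b)` vanishing at `a` and `b`,
with `Φ'(a) ≠ 0` and `Δₙ Φ = Φ'' + Φ' / r - n² Φ / r²`. -/
def modeQuotients (a b : ℝ) (n : ℕ) : Set ℝ :=
  {q | ∃ Φ : H2 a b, Φ.val a = 0 ∧ Φ.val b = 0 ∧ Φ.d1 a ≠ 0 ∧
    q = (∫ r in a..b, r * (Φ.d2 r + 1 / r * Φ.d1 r - (n : ℝ) ^ 2 / r ^ 2 * Φ.val r) ^ 2)
      / (Φ.d1 a) ^ 2}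

/-- The constant `γₙ` of the `n`-th Fourier mode. -/
def gammaMode (a b : ℝ) (n : ℕ) : ℝ := sInf (modeQuotients a b n)

/-- First derivative on `[a, b]` (one-sided at the end points). -/
def D1 (a b : ℝ) (f : ℝ → ℝ) : ℝ → ℝ := derivWithin f (Icc a b)

/-- Second derivative on `[a, b]` (one-sided at the end points). -/
def D2 (a b : ℝ) (f : ℝ → ℝ) : ℝ → ℝ := D1 a b (D1 a b f)

/-- The operator `Δₙ = d²/dr² + (1/r) d/dr - n²/r²` on functions on `[a, b]`. -/
def modeLaplacian (a b : ℝ) (n : ℕ) (f : ℝ → ℝ) (r : ℝ) : ℝ :=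
  D2 a b f r + 1 / r * D1 a b f r - (n : ℝ) ^ 2 / r ^ 2 * f r

/-- `Ψ` is a nontrivial solution of `Δ₁² Ψ = 0` in `(a, b)` with
`Ψ = Ψ'' - (1/r - α/μ) Ψ' = 0` at `r = a` and `Ψ = Ψ'' + Ψ'/r = 0` at `r = b`. -/
structure IsNontrivialSolution (a b α μ : ℝ) (Ψ : ℝ → ℝ) : Prop where
  contDiffOn_closed : ContDiffOn ℝ 2 Ψ (Icc a b)
  contDiffOn_open : ContDiffOn ℝ 4 Ψ (Ioo a b)
  ode : ∀ r ∈ Ioo a b, modeLaplacian a b 1 (modeLaplacian a b 1 Ψ) r = 0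
  val_left : Ψ a = 0
  slip_left : D2 a b Ψ a - (1 / a - α / μ) * D1 a b Ψ a = 0
  val_right : Ψ b = 0
  free_right : D2 a b Ψ b + D1 a b Ψ b / b = 0
  nontrivial : ∃ r ∈ Icc a b, Ψ r ≠ 0

/-- The matrix of the four boundary conditions in the basis `r, r log r, 1/r, r³` (with the rows
multiplied by `a`, `b`, `b³`, `μ a³`). -/
def boundaryMatrix (a b α μ : ℝ) : Matrix (Fin 4) (Fin 4) ℝ :=
  !![a ^ 2, a ^ 2 * Real.log a, 1, a ^ 4;
     b ^ 2, b ^ 2 * Real.log b, 1, b ^ 4;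
     b ^ 2, b ^ 2 * (2 + Real.log b), 1, 9 * b ^ 4;
     -a ^ 2 * μ + α * a ^ 3,
     a ^ 3 * α - a ^ 2 * μ * Real.log a + a ^ 3 * α * Real.log a,
     3 * μ - a * α,
     3 * a ^ 5 * α + 3 * a ^ 4 * μ]

end

end AnnulusFlow

namespace AnnulusFlow

noncomputable section

/-! ### Square integrable functions -/

/-! Everything is governed by the Fourier modes of the tangential velocity on the inner circle. For
order `n` let `h = r ^ n - b ^ (2n) / r ^ n`, a solution of `Δₙ h = 0` with `h b = 0`. If `Φ`
vanishes at both ends, Green's formula gives `∫ r (ΔₙΦ) h = -a h(a) Φ'(a)`, and the Cauchy-Schwarz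
inequality yields `γₙ = a² h(a)² / ∫ r h²`, attained when `ΔₙΦ = h` (`gammaMode_eq`). The ratio
`h(r) / h(a)` decreases as `n` grows, so `γₙ` increases (`gammaVal_lt`).

The extremal profile `Φ` produces the fields with stream function `Φ(r) Re (c exp(inθ))`. Their
vorticity is harmonic and vanishes on `|x| = b`, so they solve the Stokes equations, the pressure
being the harmonic conjugate of the vorticity. Green's formula then gives `E₁(v, w) = κₙ E₂(v, w)`
for such a `w` and every `v` in `X₁`, where `κₙ = (γₙ + 1) / a` (`E1_modeField`). Thus no expansion
inside the annulus is needed: Parseval for `E₂` on the inner circle (the mode of order zero is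
excluded by the zero circulation) and a Bessel inequality for `E₁` give `E₁ ≥ κ₁ E₂`, and `E₁ ≥ κ₂
E₂` when the first mode is absent (`kappa_mul_E2_le_E1`). In particular `γ = κ₁`.

For the eigenvalue write the energy as `μ A - α E₂` with `A = E₁ + E₂ / a`. At `μ = μ_c` it is
nonnegative and the fields of order one lie in its kernel, so `λ₁(μ_c) = 0`. A trace inequality
bounds the energy quotients below, and a Poincaré inequality `E₃ ≤ C A` makes the infimum positive
for `μ > μ_c`. Testing with the first mode bounds the infimum above by `s (μ - μ_c)`, where `s = A /
E₃` on that mode. A matching lower bound `s (μ - μ_c) - O((μ - μ_c)²)` comes from splitting off the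
first mode and using the gap between orders one and two (`exists_slipEnergy_ge`). Hence the
derivative is `-s < 0`, with no existence theory for minimizers at `μ ≠ μ_c`.

The trace and Poincaré inequalities are obtained without compactness, by inserting explicit test
functions into the weak Gauss-Green formula; for the second one, duality with polynomials `φ` is
used together with explicit solutions of `2 ξ + x · ∇ξ = φ`.

The differential equation is solved by inverting `Δ₁` twice. The four boundary conditions become a
`4 × 4` system whose determinant is affine in `μ`, and its root is identified with `μ_c` through the
explicit value of `∫ r h²` for `n = 1` (`muC_closed`). -/

lemma integrable_mul_of_memLp {X : Type*} [MeasurableSpace X] {μ : Measure X} {f g : X → ℝ}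
    (hf : MemLp f 2 μ) (hg : MemLp g 2 μ) : Integrable (fun x => f x * g x) μ :=
  hf.integrable_mul hg

lemma memLp_Ioc_of_continuous {f : ℝ → ℝ} (hf : Continuous f) (s t : ℝ) (p : ENNReal) :
    MemLp f p (volume.restrict (Ioc s t)) := by
  obtain ⟨C, hC⟩ := isCompact_Icc.exists_bound_of_continuousOn (hf.continuousOn (s := Icc s t))
  refine MemLp.of_bound hf.aestronglyMeasurable C ?_
  filter_upwards [ae_restrict_mem measurableSet_Ioc] with x hx
  exact hC x (Ioc_subset_Icc_self hx)

/-- The Cauchy-Schwarz inequality for integrals. -/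
lemma sq_integral_mul_le {X : Type*} [MeasurableSpace X] {μ : Measure X} {f g : X → ℝ}
    (hf : MemLp f 2 μ) (hg : MemLp g 2 μ) :
    (∫ x, f x * g x ∂μ) ^ 2 ≤ (∫ x, f x ^ 2 ∂μ) * ∫ x, g x ^ 2 ∂μ := by
  -- The quadratic in `t` is `∫ (t g + f)²`; its discriminant cannot be positive.
  have hquad : ∀ t : ℝ, 0 ≤ (∫ x, g x ^ 2 ∂μ) * (t * t) + (2 * ∫ x, f x * g x ∂μ) * t
      + ∫ x, f x ^ 2 ∂μ := fun t => by
    have h1 : (∫ x, g x ^ 2 ∂μ) * (t * t) + (2 * ∫ x, f x * g x ∂μ) * t + ∫ x, f x ^ 2 ∂μ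
        = ∫ x, (t * g x + f x) ^ 2 ∂μ := by
      have h2 : ∀ x, (t * g x + f x) ^ 2
          = (t * t) * g x ^ 2 + (2 * t) * (f x * g x) + f x ^ 2 := fun x => by ring
      have h3 : Integrable (fun x => (t * t) * g x ^ 2 + (2 * t) * (f x * g x)) μ :=
        (hg.integrable_sq.const_mul _).add ((integrable_mul_of_memLp hf hg).const_mul _)
      simp only [h2]
      rw [integral_add h3 hf.integrable_sq, integral_add (hg.integrable_sq.const_mul _) ((integrable_mul_of_memLp hf hg).const_mul _),
        integral_const_mul, integral_const_mul]
      ring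
    rw [h1]
    exact integral_nonneg fun x => sq_nonneg _
  have := discrim_le_zero hquad
  unfold discrim at this
  nlinarith

/-! ### Integration over the annulus in polar coordinates -/

lemma circlePt_sq (r θ : ℝ) : (circlePt r θ).1 ^ 2 + (circlePt r θ).2 ^ 2 = r ^ 2 := by
  simp only [circlePt]
  nlinarith [Real.sin_sq_add_cos_sq θ]

lemma circlePt_mem_annulus {a b r : ℝ} (ha : 0 < a) (hr : r ∈ Ioo a b) (θ : ℝ) :
    circlePt r θ ∈ annulus a b := by
  obtain ⟨h1, h2⟩ := hr
  simp only [annulus, mem_ofPred_eq, circlePt_sq]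
  constructor <;> nlinarith

lemma of_circlePt_mem_annulus {a b r θ : ℝ} (ha : 0 < a) (hab : a < b) (hr : 0 < r)
    (h : circlePt r θ ∈ annulus a b) : r ∈ Ioo a b := by
  simp only [annulus, mem_ofPred_eq, circlePt_sq] at h
  exact ⟨lt_of_pow_lt_pow_left₀ 2 hr.le h.1, lt_of_pow_lt_pow_left₀ 2 (ha.trans hab).le h.2⟩

lemma circlePt_periodic (r : ℝ) : Function.Periodic (circlePt r) (2 * Real.pi) := by
  intro θ
  simp [circlePt]

lemma continuous_circlePt (r : ℝ) : Continuous (circlePt r) := by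
  unfold circlePt; fun_prop

lemma circlePt_ne_zero {r : ℝ} (hr : 0 < r) (θ : ℝ) : circlePt r θ ≠ 0 := by
  intro h
  have := circlePt_sq r θ
  rw [h] at this
  have h0 : 0 < r ^ 2 := by positivity
  simp at this
  linarith

lemma isOpen_annulus (a b : ℝ) : IsOpen (annulus a b) := by
  have hc : Continuous fun x : ℝ × ℝ => x.1 ^ 2 + x.2 ^ 2 := by fun_prop
  exact (isOpen_lt continuous_const hc).inter (isOpen_lt hc continuous_const)

lemma measurableSet_annulus (a b : ℝ) : MeasurableSet (annulus a b) :=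
  (isOpen_annulus a b).measurableSet

/-- The closed annulus. -/
def closedAnnulus (a b : ℝ) : Set (ℝ × ℝ) :=
  {x | a ^ 2 ≤ x.1 ^ 2 + x.2 ^ 2 ∧ x.1 ^ 2 + x.2 ^ 2 ≤ b ^ 2}

lemma annulus_subset_closedAnnulus (a b : ℝ) : annulus a b ⊆ closedAnnulus a b :=
  fun _ h => ⟨h.1.le, h.2.le⟩

lemma isCompact_closedAnnulus (a b : ℝ) : IsCompact (closedAnnulus a b) := by
  have hK : IsCompact (Icc (-|b|) |b| ×ˢ Icc (-|b|) |b| : Set (ℝ × ℝ)) :=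
    isCompact_Icc.prod isCompact_Icc
  refine hK.of_isClosed_subset ?_ ?_
  · have hc : Continuous fun x : ℝ × ℝ => x.1 ^ 2 + x.2 ^ 2 := by fun_prop
    exact (isClosed_le continuous_const hc).inter (isClosed_le hc continuous_const)
  · intro x hx
    have h1 : x.1 ^ 2 ≤ b ^ 2 := by nlinarith [hx.2, sq_nonneg x.2]
    have h2 : x.2 ^ 2 ≤ b ^ 2 := by nlinarith [hx.2, sq_nonneg x.1]
    exact ⟨abs_le.1 (sq_le_sq.1 h1), abs_le.1 (sq_le_sq.1 h2)⟩

lemma closedAnnulus_subset {a b : ℝ} (ha : 0 < a) : closedAnnulus a b ⊆ {0}ᶜ := by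
  rintro x hx rfl
  have := hx.1
  simp at this
  nlinarith

instance isFiniteMeasure_annulus (a b : ℝ) : IsFiniteMeasure (volume.restrict (annulus a b)) :=
  ⟨by
    rw [Measure.restrict_apply_univ]
    exact (measure_mono (annulus_subset_closedAnnulus a b)).trans_lt
      (isCompact_closedAnnulus a b).measure_lt_top⟩

/-- Change of variables by the injective inverse polar chart, whose Jacobian is `r`. This is the
integrability that Fubini's theorem needs, for the integral over the annulus and for almost every
circle. -/
lemma integrableOn_polar {a b : ℝ} (ha : 0 < a) {f : ℝ × ℝ → ℝ}
    (hf : Integrable f (volume.restrict (annulus a b))) :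
    Integrable (fun p : ℝ × ℝ => p.1 * f (circlePt p.1 p.2))
      ((volume.restrict (Ioo a b)).prod (volume.restrict (Ioo (-Real.pi) Real.pi))) := by
  rw [Measure.prod_restrict]
  have hsub : (Ioo a b ×ˢ Ioo (-Real.pi) Real.pi : Set (ℝ × ℝ)) ⊆ polarCoord.target := by
    rintro ⟨r, θ⟩ ⟨hr, hθ⟩
    exact ⟨ha.trans hr.1, hθ⟩
  have h := (integrableOn_image_iff_integrableOn_abs_det_fderiv_smul volume
    (measurableSet_Ioo.prod measurableSet_Ioo : MeasurableSet (Ioo a b ×ˢ Ioo (-Real.pi) Real.pi))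
    (fun p _ => (hasFDerivAt_polarCoord_symm p).hasFDerivWithinAt)
    (polarCoord.symm.injOn.mono hsub) f).1 ?_
  · refine (integrableOn_congr_fun ?_ (measurableSet_Ioo.prod measurableSet_Ioo)).1 h
    rintro ⟨r, θ⟩ ⟨hr, hθ⟩
    simp [det_fderivPolarCoordSymm, abs_of_pos (ha.trans hr.1), circlePt]
  · refine IntegrableOn.mono_set hf ?_
    rintro _ ⟨⟨r, θ⟩, ⟨hr, hθ⟩, rfl⟩
    exact circlePt_mem_annulus ha hr θ

/-- The polar chart uses angles in `(-π, π)` while `arcInt` uses `(0, 2π)`; periodicity reconciles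
the two. -/
lemma arcInt_eq_setIntegral (r : ℝ) (f : ℝ × ℝ → ℝ) :
    arcInt r (fun θ => f (circlePt r θ))
      = ∫ θ in Ioo (-Real.pi) Real.pi, r * f (circlePt r θ) := by
  have hp : Function.Periodic (fun θ => f (circlePt r θ) * r) (2 * Real.pi) := fun θ => by
    simp only [circlePt_periodic r θ]
  rw [← integral_Ioc_eq_integral_Ioo, ← intervalIntegral.integral_of_le
    (by linarith [Real.pi_pos]), arcInt]
  have := hp.intervalIntegral_add_eq 0 (-Real.pi)
  rw [zero_add, show -Real.pi + 2 * Real.pi = Real.pi by ring] at this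
  rw [this]
  exact intervalIntegral.integral_congr fun θ _ => mul_comm _ _

/-- Integration over the annulus in polar coordinates. -/
theorem integral_annulus {a b : ℝ} (ha : 0 < a) (hab : a < b) {f : ℝ × ℝ → ℝ}
    (hf : Integrable f (volume.restrict (annulus a b))) :
    ∫ x in annulus a b, f x = ∫ r in Ioo a b, arcInt r (fun θ => f (circlePt r θ)) := by
  rw [← integral_indicator (measurableSet_annulus a b), ← integral_comp_polarCoord_symm]
  have h1 : ∫ p in polarCoord.target, p.1 • (annulus a b).indicator f (polarCoord.symm p)
      = ∫ p in Ioo a b ×ˢ Ioo (-Real.pi) Real.pi, p.1 * f (circlePt p.1 p.2) := by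
    have hsub : (Ioo a b ×ˢ Ioo (-Real.pi) Real.pi : Set (ℝ × ℝ)) ⊆ polarCoord.target := by
      rintro ⟨r, θ⟩ ⟨hr, hθ⟩
      exact ⟨ha.trans hr.1, hθ⟩
    rw [setIntegral_eq_of_subset_of_forall_sdiff_eq_zero
      polarCoord.open_target.measurableSet hsub (f := fun p : ℝ × ℝ =>
        p.1 • (annulus a b).indicator f (polarCoord.symm p))]
    · refine setIntegral_congr_fun (measurableSet_Ioo.prod measurableSet_Ioo) ?_
      rintro ⟨r, θ⟩ ⟨hr, hθ⟩
      have := indicator_of_mem (circlePt_mem_annulus ha hr θ) f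
      simp only [smul_eq_mul, polarCoord_symm_apply]
      rw [← this]; rfl
    · rintro ⟨r, θ⟩ ⟨⟨hr, hθ⟩, hn⟩
      have : circlePt r θ ∉ annulus a b := fun h =>
        hn ⟨of_circlePt_mem_annulus ha hab hr h, hθ⟩
      have := indicator_of_notMem this f
      simp only [smul_eq_mul, polarCoord_symm_apply]
      rw [show (r * Real.cos θ, r * Real.sin θ) = circlePt r θ from rfl, this, mul_zero]
  rw [h1, Measure.volume_eq_prod, ← Measure.prod_restrict,
    integral_prod _ (integrableOn_polar ha hf)]
  exact integral_congr_ae (Eventually.of_forall fun r => (arcInt_eq_setIntegral r f).symm)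

lemma ae_intervalIntegrable_circle {a b : ℝ} (ha : 0 < a) {f : ℝ × ℝ → ℝ}
    (hf : Integrable f (volume.restrict (annulus a b))) :
    ∀ᵐ r ∂(volume.restrict (Ioo a b)),
      IntervalIntegrable (fun θ => f (circlePt r θ)) volume 0 (2 * Real.pi) := by
  filter_upwards [(integrableOn_polar ha hf).prod_right_ae, ae_restrict_mem measurableSet_Ioo]
    with r hr hmem
  have hr0 : r ≠ 0 := (ha.trans hmem.1).ne'
  have h2 : IntervalIntegrable (fun θ => f (circlePt r θ)) volume (-Real.pi)
      (-Real.pi + 2 * Real.pi) := by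
    rw [show -Real.pi + 2 * Real.pi = Real.pi by ring,
      intervalIntegrable_iff_integrableOn_Ioo_of_le (by linarith [Real.pi_pos])]
    have := hr.const_mul r⁻¹
    simp only [inv_mul_cancel_left₀ hr0] at this
    exact this
  refine Function.Periodic.intervalIntegrable (T := 2 * Real.pi) ?_ (by positivity) h2 0 _
  intro θ
  simp only [circlePt_periodic r θ]

lemma aestronglyMeasurable_of_continuousOn {a b : ℝ} (ha : 0 < a) {φ : ℝ × ℝ → ℝ}
    (hφ : ContinuousOn φ {0}ᶜ) :
    AEStronglyMeasurable φ (volume.restrict (annulus a b)) :=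
  (hφ.mono ((annulus_subset_closedAnnulus a b).trans
    (closedAnnulus_subset ha))).aestronglyMeasurable (measurableSet_annulus a b)

lemma exists_bound_annulus {a b : ℝ} (ha : 0 < a) {φ : ℝ × ℝ → ℝ}
    (hφ : ContinuousOn φ {0}ᶜ) : ∃ C, 0 ≤ C ∧ ∀ x ∈ closedAnnulus a b, |φ x| ≤ C := by
  obtain ⟨C, hC⟩ := (isCompact_closedAnnulus a b).exists_bound_of_continuousOn
    (hφ.mono (closedAnnulus_subset ha))
  exact ⟨max C 0, le_max_right _ _, fun x hx => (hC x hx).trans (le_max_left _ _)⟩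

lemma memLp_of_continuousOn {a b : ℝ} (ha : 0 < a) {φ : ℝ × ℝ → ℝ}
    (hφ : ContinuousOn φ {0}ᶜ) (p : ENNReal) : MemLp φ p (volume.restrict (annulus a b)) := by
  obtain ⟨C, _, hC⟩ := exists_bound_annulus (b := b) ha hφ
  refine MemLp.of_bound (aestronglyMeasurable_of_continuousOn ha hφ) C ?_
  filter_upwards [ae_restrict_mem (measurableSet_annulus a b)] with x hx
  exact hC x (annulus_subset_closedAnnulus a b hx)

lemma integrable_of_continuousOn {a b : ℝ} (ha : 0 < a) {φ : ℝ × ℝ → ℝ}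
    (hφ : ContinuousOn φ {0}ᶜ) : Integrable φ (volume.restrict (annulus a b)) :=
  memLp_one_iff_integrable.1 (memLp_of_continuousOn ha hφ 1)

lemma integrable_mul_of_continuousOn {a b : ℝ} (ha : 0 < a) {u φ : ℝ × ℝ → ℝ}
    (hu : MemLp u 2 (volume.restrict (annulus a b))) (hφ : ContinuousOn φ {0}ᶜ) :
    Integrable (fun x => u x * φ x) (volume.restrict (annulus a b)) :=
  hu.integrable_mul (memLp_of_continuousOn ha hφ 2)

/-! ### Calculus away from the origin -/

/-- Smoothness away from the origin. -/
abbrev SmoothOff (φ : ℝ × ℝ → ℝ) : Prop := ContDiffOn ℝ ∞ φ {0}ᶜ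

lemma isOpen_compl_zero : IsOpen ({0}ᶜ : Set (ℝ × ℝ)) := isOpen_compl_singleton

lemma SmoothOff.differentiableAt {φ : ℝ × ℝ → ℝ} (h : SmoothOff φ) {x : ℝ × ℝ} (hx : x ≠ 0) :
    DifferentiableAt ℝ φ x :=
  (h.contDiffAt (isOpen_compl_zero.mem_nhds hx)).differentiableAt (by simp)

lemma SmoothOff.partialD {φ : ℝ × ℝ → ℝ} (h : SmoothOff φ) (i : Fin 2) :
    SmoothOff (partialD i φ) :=
  (h.fderiv_of_isOpen isOpen_compl_zero (by simp)).clm_apply contDiffOn_const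

lemma partialD_add {φ ψ : ℝ × ℝ → ℝ} {x : ℝ × ℝ} (i : Fin 2) (hφ : DifferentiableAt ℝ φ x)
    (hψ : DifferentiableAt ℝ ψ x) :
    partialD i (fun y => φ y + ψ y) x = partialD i φ x + partialD i ψ x := by
  simp only [partialD]
  rw [fderiv_fun_add hφ hψ]; rfl

lemma partialD_neg {φ : ℝ × ℝ → ℝ} {x : ℝ × ℝ} (i : Fin 2) :
    partialD i (fun y => -φ y) x = -partialD i φ x := by
  simp only [partialD]
  rw [fderiv_fun_neg]; rfl

lemma partialD_const_mul {φ : ℝ × ℝ → ℝ} {x : ℝ × ℝ} (i : Fin 2) (c : ℝ)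
    (hφ : DifferentiableAt ℝ φ x) :
    partialD i (fun y => c * φ y) x = c * partialD i φ x := by
  simp only [partialD]
  rw [fderiv_const_mul hφ]; rfl

lemma partialD_mul {φ ψ : ℝ × ℝ → ℝ} {x : ℝ × ℝ} (i : Fin 2) (hφ : DifferentiableAt ℝ φ x)
    (hψ : DifferentiableAt ℝ ψ x) :
    partialD i (fun y => φ y * ψ y) x = φ x * partialD i ψ x + partialD i φ x * ψ x := by
  simp only [partialD]
  rw [fderiv_fun_mul hφ hψ]
  simp [mul_comm]

lemma partialD_comp {F : ℝ → ℝ} {F' : ℝ} {φ : ℝ × ℝ → ℝ} {x : ℝ × ℝ} (i : Fin 2)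
    (hF : HasDerivAt F F' (φ x)) (hφ : DifferentiableAt ℝ φ x) :
    partialD i (fun y => F (φ y)) x = F' * partialD i φ x := by
  simp only [partialD]
  have := (hF.comp_hasFDerivAt x hφ.hasFDerivAt).fderiv
  rw [show (F ∘ φ) = fun y => F (φ y) from rfl] at this
  rw [this]; simp

lemma partialD_congr {φ ψ : ℝ × ℝ → ℝ} (h : EqOn φ ψ {0}ᶜ) (i : Fin 2) {x : ℝ × ℝ} (hx : x ≠ 0) :
    partialD i φ x = partialD i ψ x := by
  simp only [partialD]
  rw [(h.eventuallyEq_of_mem (isOpen_compl_zero.mem_nhds hx)).fderiv_eq]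

lemma partialD_comm {φ : ℝ × ℝ → ℝ} (h : SmoothOff φ) (i j : Fin 2) {x : ℝ × ℝ} (hx : x ≠ 0) :
    partialD i (partialD j φ) x = partialD j (partialD i φ) x := by
  have hc : ContDiffAt ℝ ∞ φ x := h.contDiffAt (isOpen_compl_zero.mem_nhds hx)
  have hdf : DifferentiableAt ℝ (fderiv ℝ φ) x :=
    (hc.fderiv_right (m := 1) (by norm_cast)).differentiableAt (by simp)
  have hd : ∀ k l : Fin 2, partialD k (partialD l φ) x
      = fderiv ℝ (fderiv ℝ φ) x (unitVec k) (unitVec l) := by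
    intro k l
    have h1 := (hdf.hasFDerivAt.clm_apply (hasFDerivAt_const (unitVec l) x)).fderiv
    simp only [partialD]
    rw [show (fun y => fderiv ℝ φ y (unitVec l)) = partialD l φ from rfl] at h1
    rw [h1]
    simp
  rw [hd, hd]
  exact (hc.isSymmSndFDerivAt (by simp only [minSmoothness_of_isRCLikeNormedField]; norm_cast)) _ _

/-- The square of the distance to the origin. -/
def normSqr (x : ℝ × ℝ) : ℝ := x.1 ^ 2 + x.2 ^ 2

lemma contDiff_normSqr : ContDiff ℝ ∞ normSqr := by unfold normSqr; fun_prop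

lemma normSqr_pos {x : ℝ × ℝ} (hx : x ≠ 0) : 0 < normSqr x := by
  by_contra h
  unfold normSqr at h
  have h1 : x.1 ^ 2 = 0 := by nlinarith [sq_nonneg x.1, sq_nonneg x.2]
  have h2 : x.2 ^ 2 = 0 := by nlinarith [sq_nonneg x.1, sq_nonneg x.2]
  exact hx (Prod.ext (by simpa using h1) (by simpa using h2))

lemma normSqr_circlePt (r θ : ℝ) : normSqr (circlePt r θ) = r ^ 2 := circlePt_sq r θ

/-- The coordinate functions. -/
def coord (i : Fin 2) (x : ℝ × ℝ) : ℝ := ![x.1, x.2] i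

@[simp] lemma coord_zero (x : ℝ × ℝ) : coord 0 x = x.1 := rfl
@[simp] lemma coord_one (x : ℝ × ℝ) : coord 1 x = x.2 := rfl

lemma contDiff_coord (i : Fin 2) : ContDiff ℝ ∞ (coord i) := by
  fin_cases i
  · exact contDiff_fst
  · exact contDiff_snd

lemma partialD_coord (i j : Fin 2) (x : ℝ × ℝ) : partialD i (coord j) x = if i = j then 1 else 0 := by
  have h0 : coord 0 = (Prod.fst : ℝ × ℝ → ℝ) := rfl
  have h1 : coord 1 = (Prod.snd : ℝ × ℝ → ℝ) := rfl
  fin_cases i <;> fin_cases j <;>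
    simp [partialD, h0, h1, fderiv_fst, fderiv_snd, unitVec]

lemma coord_circlePt (i : Fin 2) (r θ : ℝ) : coord i (circlePt r θ) = r * radialVec θ i := by
  fin_cases i <;> simp [coord, circlePt, radialVec]

lemma partialD_normSqr (i : Fin 2) (x : ℝ × ℝ) : partialD i normSqr x = 2 * coord i x := by
  have hc : ∀ j, DifferentiableAt ℝ (coord j) x := fun j =>
    (contDiff_coord j).differentiable (by simp) x
  have : normSqr = fun y => coord 0 y * coord 0 y + coord 1 y * coord 1 y := by
    ext y; simp [normSqr]; ring
  rw [this, partialD_add i ((hc 0).fun_mul (hc 0)) ((hc 1).fun_mul (hc 1)), partialD_mul i (hc 0) (hc 0),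
    partialD_mul i (hc 1) (hc 1)]
  simp only [partialD_coord]
  fin_cases i <;> simp <;> ring

lemma SmoothOff.comp_normSqr {F : ℝ → ℝ} (hF : ContDiffOn ℝ ∞ F (Ioi 0)) :
    SmoothOff (fun x => F (normSqr x)) :=
  hF.comp contDiff_normSqr.contDiffOn fun _ hx => normSqr_pos hx

lemma partialD_comp_normSqr {F : ℝ → ℝ} {F' : ℝ} {x : ℝ × ℝ} (i : Fin 2)
    (hF : HasDerivAt F F' (normSqr x)) :
    partialD i (fun y => F (normSqr y)) x = 2 * F' * coord i x := by
  rw [partialD_comp i hF (contDiff_normSqr.differentiable (by simp) x), partialD_normSqr]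
  ring

lemma fderiv_apply_eq (φ : ℝ × ℝ → ℝ) (x v : ℝ × ℝ) :
    fderiv ℝ φ x v = v.1 * partialD 0 φ x + v.2 * partialD 1 φ x := by
  have : v = v.1 • unitVec 0 + v.2 • unitVec 1 := by
    ext <;> simp [unitVec]
  conv_lhs => rw [this]
  simp [partialD, -Prod.smul_mk]

lemma hasDerivAt_circlePt_radius {φ : ℝ × ℝ → ℝ} {r θ : ℝ}
    (h : DifferentiableAt ℝ φ (circlePt r θ)) :
    HasDerivAt (fun s => φ (circlePt s θ))
      (∑ i, radialVec θ i * partialD i φ (circlePt r θ)) r := by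
  have h1 : HasDerivAt (fun s => circlePt s θ) (Real.cos θ, Real.sin θ) r :=
    (hasDerivAt_mul_const _).prodMk (hasDerivAt_mul_const _)
  have := h.hasFDerivAt.comp_hasDerivAt r h1
  rw [fderiv_apply_eq] at this
  simp only [Fin.sum_univ_two, radialVec]
  exact this

lemma hasDerivAt_circlePt_angle {φ : ℝ × ℝ → ℝ} {r θ : ℝ}
    (h : DifferentiableAt ℝ φ (circlePt r θ)) :
    HasDerivAt (fun t => φ (circlePt r t))
      (r * ∑ i, tangentVec θ i * partialD i φ (circlePt r θ)) θ := by
  have h1 : HasDerivAt (fun t => circlePt r t) (r * -Real.sin θ, r * Real.cos θ) θ :=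
    ((Real.hasDerivAt_cos θ).const_mul r).prodMk ((Real.hasDerivAt_sin θ).const_mul r)
  have := h.hasFDerivAt.comp_hasDerivAt θ h1
  rw [fderiv_apply_eq] at this
  refine this.congr_deriv ?_
  simp [Fin.sum_univ_two, tangentVec]; ring

/-! ### The Gauss-Green formula -/

lemma partialD_eq_radial_tangential (φ : ℝ × ℝ → ℝ) (x : ℝ × ℝ) (θ : ℝ) (i : Fin 2) :
    partialD i φ x = radialVec θ i * ∑ j, radialVec θ j * partialD j φ x
      + tangentVec θ i * ∑ j, tangentVec θ j * partialD j φ x := by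
  have := Real.sin_sq_add_cos_sq θ
  fin_cases i <;> simp [Fin.sum_univ_two, radialVec, tangentVec]
  · linear_combination (-partialD 0 φ x) * this
  · linear_combination (-partialD 1 φ x) * this

lemma hasDerivAt_radialVec (θ : ℝ) (i : Fin 2) :
    HasDerivAt (fun t => radialVec t i) (tangentVec θ i) θ := by
  fin_cases i
  · exact Real.hasDerivAt_cos θ
  · exact Real.hasDerivAt_sin θ

lemma hasDerivAt_tangentVec (θ : ℝ) (i : Fin 2) :
    HasDerivAt (fun t => tangentVec t i) (-radialVec θ i) θ := by
  fin_cases i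
  · exact (Real.hasDerivAt_sin θ).neg
  · exact Real.hasDerivAt_cos θ

lemma continuous_radialVec (i : Fin 2) : Continuous (fun θ => radialVec θ i) :=
  continuous_iff_continuousAt.2 fun θ => (hasDerivAt_radialVec θ i).continuousAt

lemma continuous_tangentVec (i : Fin 2) : Continuous (fun θ => tangentVec θ i) :=
  continuous_iff_continuousAt.2 fun θ => (hasDerivAt_tangentVec θ i).continuousAt

/-- In polar coordinates `r ∂ᵢφ = ∂ᵣ(r φ nᵢ) + ∂_θ(φ τᵢ)`, so this is the divergence theorem on the
rectangle `[a, b] × [0, 2π]`. The sides `θ = 0` and `θ = 2π` cancel by periodicity. -/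
theorem integral_partialD {a b : ℝ} (ha : 0 < a) (hab : a < b) {φ : ℝ × ℝ → ℝ}
    (hφ : SmoothOff φ) (i : Fin 2) :
    ∫ x in annulus a b, partialD i φ x
      = arcInt b (fun θ => φ (circlePt b θ) * radialVec θ i)
        - arcInt a (fun θ => φ (circlePt a θ) * radialVec θ i) := by
  rw [integral_annulus ha hab (integrable_of_continuousOn ha (hφ.partialD i).continuousOn),
    ← integral_Ioc_eq_integral_Ioo, ← intervalIntegral.integral_of_le hab.le]
  set f : ℝ × ℝ → ℝ := fun p => φ (circlePt p.1 p.2) * radialVec p.2 i * p.1 with hf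
  set g : ℝ × ℝ → ℝ := fun p => φ (circlePt p.1 p.2) * tangentVec p.2 i with hg
  have hcirc : Differentiable ℝ (fun p : ℝ × ℝ => circlePt p.1 p.2) := by
    unfold circlePt; fun_prop
  have hrad : Differentiable ℝ (fun p : ℝ × ℝ => radialVec p.2 i) := fun p =>
    (hasDerivAt_radialVec p.2 i).differentiableAt.comp p differentiableAt_snd
  have htan : Differentiable ℝ (fun p : ℝ × ℝ => tangentVec p.2 i) := fun p =>
    (hasDerivAt_tangentVec p.2 i).differentiableAt.comp p differentiableAt_snd
  have hfd : ∀ p : ℝ × ℝ, 0 < p.1 → DifferentiableAt ℝ f p := fun p hp =>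
    (((hφ.differentiableAt (circlePt_ne_zero hp p.2)).comp p (hcirc p)).mul (hrad p)).mul
      differentiableAt_fst
  have hgd : ∀ p : ℝ × ℝ, 0 < p.1 → DifferentiableAt ℝ g p := fun p hp =>
    ((hφ.differentiableAt (circlePt_ne_zero hp p.2)).comp p (hcirc p)).mul (htan p)
  have hdiv : ∀ p : ℝ × ℝ, 0 < p.1 → fderiv ℝ f p (1, 0) + fderiv ℝ g p (0, 1)
      = partialD i φ (circlePt p.1 p.2) * p.1 := by
    rintro ⟨r, θ⟩ hp
    have hd := hφ.differentiableAt (circlePt_ne_zero hp θ)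
    have h1 : HasDerivAt (fun s => f (s, θ)) (fderiv ℝ f (r, θ) (1, 0)) r :=
      HasFDerivAt.comp_hasDerivAt (l := f) (f := fun s => (s, θ)) r (hfd (r, θ) hp).hasFDerivAt ((hasDerivAt_id r).prodMk (hasDerivAt_const r θ))
    have h2 : HasDerivAt (fun t => g (r, t)) (fderiv ℝ g (r, θ) (0, 1)) θ :=
      HasFDerivAt.comp_hasDerivAt (l := g) (f := fun t => (r, t)) θ (hgd (r, θ) hp).hasFDerivAt ((hasDerivAt_const θ r).prodMk (hasDerivAt_id θ))
    have h1' := ((hasDerivAt_circlePt_radius hd).mul_const (radialVec θ i)).mul (hasDerivAt_id r)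
    have h2' := (hasDerivAt_circlePt_angle hd).mul (hasDerivAt_tangentVec θ i)
    rw [h1.unique h1', h2.unique h2', partialD_eq_radial_tangential φ _ θ i]
    simp only [id]
    ring
  have hsub : (uIcc a b ×ˢ uIcc 0 (2 * Real.pi) : Set (ℝ × ℝ)) ⊆ {p | 0 < p.1} := by
    rintro ⟨r, θ⟩ ⟨hr, -⟩
    rw [uIcc_of_le hab.le] at hr
    exact ha.trans_le hr.1
  have hcont : ContinuousOn (fun p : ℝ × ℝ => partialD i φ (circlePt p.1 p.2) * p.1)
      (uIcc a b ×ˢ uIcc 0 (2 * Real.pi)) := by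
    refine ContinuousOn.mul ?_ continuousOn_fst
    exact (hφ.partialD i).continuousOn.comp hcirc.continuous.continuousOn
      fun p hp => circlePt_ne_zero (hsub hp) p.2
  have key := integral2_divergence_prod_of_hasFDerivAt_off_countable f g (fderiv ℝ f) (fderiv ℝ g)
    a 0 b (2 * Real.pi) ∅ countable_empty
    (fun p hp => (hfd p (hsub hp)).continuousAt.continuousWithinAt)
    (fun p hp => (hgd p (hsub hp)).continuousAt.continuousWithinAt)
    (fun p hp => (hfd p (by
      have := hp.1.1.1
      rw [min_eq_left hab.le] at this
      exact ha.trans this)).hasFDerivAt)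
    (fun p hp => (hgd p (by
      have := hp.1.1.1
      rw [min_eq_left hab.le] at this
      exact ha.trans this)).hasFDerivAt)
    ((hcont.integrableOn_compact (isCompact_uIcc.prod isCompact_uIcc)).congr_fun
      (fun p hp => (hdiv p (hsub hp)).symm) (measurableSet_uIcc.prod measurableSet_uIcc))
  have hlhs : (∫ r in a..b, arcInt r fun θ => partialD i φ (circlePt r θ))
      = ∫ x in a..b, ∫ y in (0 : ℝ)..2 * Real.pi,
          fderiv ℝ f (x, y) (1, 0) + fderiv ℝ g (x, y) (0, 1) := by
    refine intervalIntegral.integral_congr fun r hr => ?_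
    refine intervalIntegral.integral_congr fun θ hθ => ?_
    exact (hdiv (r, θ) (hsub ⟨hr, hθ⟩)).symm
  have hper : (∫ x in a..b, g (x, 2 * Real.pi)) = ∫ x in a..b, g (x, 0) := by
    refine intervalIntegral.integral_congr fun r _ => ?_
    have h1 := circlePt_periodic r 0
    rw [zero_add] at h1
    have h2 : tangentVec (2 * Real.pi) i = tangentVec 0 i := by
      fin_cases i <;> simp [tangentVec]
    simp only [hg, h1, h2]
  rw [hlhs, key, hper]
  simp only [sub_self, zero_add, arcInt, hf]

/-! ### The space `X₁`: linear structure, forms, and test functions singular at the origin -/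

/-- Multiplication by a smooth radial cutoff that is `0` for `|x|² ≤ a² / 4` and `1` for `|x|² ≥ a²
/ 2` removes the singularity at the origin without changing anything near the closed annulus. -/
lemma exists_contDiff_eqOn {a : ℝ} (ha : 0 < a) {φ : ℝ × ℝ → ℝ} (hφ : SmoothOff φ) :
    ∃ φ' : ℝ × ℝ → ℝ, ContDiff ℝ ∞ φ' ∧ ∀ x, a ^ 2 / 2 < normSqr x → φ' =ᶠ[𝓝 x] φ := by
  have ha2 : 0 < a ^ 2 / 4 := by positivity
  refine ⟨fun x => Real.smoothTransition ((normSqr x - a ^ 2 / 4) / (a ^ 2 / 4)) * φ x, ?_, ?_⟩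
  · rw [contDiff_iff_contDiffAt]
    intro x
    by_cases hx : x = 0
    · have hopen : IsOpen {y : ℝ × ℝ | normSqr y < a ^ 2 / 4} :=
        isOpen_lt contDiff_normSqr.continuous continuous_const
      have h0 : (fun x => Real.smoothTransition ((normSqr x - a ^ 2 / 4) / (a ^ 2 / 4)) * φ x)
          =ᶠ[𝓝 x] fun _ => 0 := by
        filter_upwards [hopen.mem_nhds (by simp [hx, normSqr, ha])] with y hy
        rw [Real.smoothTransition.zero_of_nonpos, zero_mul]
        have hy' : normSqr y < a ^ 2 / 4 := hy
        exact div_nonpos_of_nonpos_of_nonneg (by linarith) ha2.le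
      exact contDiffAt_const.congr_of_eventuallyEq h0
    · refine ContDiffAt.mul ?_ (hφ.contDiffAt (isOpen_compl_zero.mem_nhds hx))
      exact Real.smoothTransition.contDiff.contDiffAt.comp x
        ((contDiff_normSqr.contDiffAt.sub contDiffAt_const).div_const _)
  · intro x hx
    have hopen : IsOpen {y : ℝ × ℝ | a ^ 2 / 2 < normSqr y} :=
      isOpen_lt continuous_const contDiff_normSqr.continuous
    filter_upwards [hopen.mem_nhds hx] with y hy
    have hy' : a ^ 2 / 2 < normSqr y := hy
    rw [Real.smoothTransition.one_of_one_le, one_mul]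
    rw [le_div_iff₀ ha2]
    linarith

lemma normSqr_of_mem_annulus {a b : ℝ} {x : ℝ × ℝ} (hx : x ∈ annulus a b) :
    a ^ 2 / 2 < normSqr x := by
  have := hx.1
  unfold normSqr
  nlinarith [sq_nonneg a]

/-- The defining formula of traces holds for test functions that are singular at the origin. -/
theorem IsTrace.smoothOff {a b : ℝ} (ha : 0 < a) (hab : a < b) {u : ℝ × ℝ → ℝ}
    {g : Fin 2 → ℝ × ℝ → ℝ} {t : ℝ × ℝ → ℝ} (h : IsTrace a b u g t) {φ : ℝ × ℝ → ℝ}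
    (hφ : SmoothOff φ) (i : Fin 2) :
    ∫ x in annulus a b, (u x * partialD i φ x + g i x * φ x)
      = arcInt b (fun θ => t (circlePt b θ) * φ (circlePt b θ) * radialVec θ i)
        - arcInt a (fun θ => t (circlePt a θ) * φ (circlePt a θ) * radialVec θ i) := by
  obtain ⟨φ', h1, h2⟩ := exists_contDiff_eqOn ha hφ
  have hint : ∫ x in annulus a b, (u x * partialD i φ x + g i x * φ x)
      = ∫ x in annulus a b, (u x * partialD i φ' x + g i x * φ' x) := by
    refine setIntegral_congr_fun (measurableSet_annulus a b) fun x hx => ?_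
    have := h2 x (normSqr_of_mem_annulus hx)
    simp only [partialD, this.fderiv_eq, this.eq_of_nhds]
  have hbd : ∀ r, a ≤ r → ∀ θ, φ' (circlePt r θ) = φ (circlePt r θ) := fun r hr θ => by
    refine (h2 _ ?_).eq_of_nhds
    rw [normSqr_circlePt]
    nlinarith
  rw [hint, h φ' h1 i]
  simp only [hbd a le_rfl, hbd b hab.le]

/-- A test function with compact support in the open annulus vanishes on both circles, so the
boundary terms of the trace formula drop out. -/
lemma IsTrace.isWeakGradient {a b : ℝ} {u : ℝ × ℝ → ℝ} {g : Fin 2 → ℝ × ℝ → ℝ} {t : ℝ × ℝ → ℝ}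
    (hu : MemLp u 2 (volume.restrict (annulus a b)))
    (hg : ∀ i, MemLp (g i) 2 (volume.restrict (annulus a b)))
    (h : IsTrace a b u g t) : IsWeakGradient a b u g := by
  intro φ hφ hc hsupp i
  have hzero : ∀ r ∈ ({a, b} : Set ℝ), ∀ θ, φ (circlePt r θ) = 0 := by
    intro r hr θ
    refine image_eq_zero_of_notMem_tsupport fun hmem => ?_
    obtain ⟨h1, h2⟩ := hsupp hmem
    rw [circlePt_sq] at h1 h2
    rcases hr with rfl | hr
    · exact lt_irrefl _ h1
    · rw [mem_singleton_iff.1 hr] at h2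
      exact lt_irrefl _ h2
  have hφL : MemLp φ 2 (volume.restrict (annulus a b)) :=
    (hφ.continuous.memLp_of_hasCompactSupport hc).restrict _
  have hdφL : MemLp (partialD i φ) 2 (volume.restrict (annulus a b)) := by
    refine MemLp.restrict _ (Continuous.memLp_of_hasCompactSupport ?_ ?_)
    · exact (hφ.continuous_fderiv (by simp)).clm_apply continuous_const
    · exact hc.fderiv_apply (𝕜 := ℝ) _
  have key := h φ hφ i
  rw [integral_add (integrable_mul_of_memLp hu hdφL) (integrable_mul_of_memLp (hg i) hφL)] at key
  simp only [hzero b (by simp), hzero a (by simp), mul_zero, zero_mul, arcInt,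
    intervalIntegral.integral_zero, sub_self] at key
  linarith

namespace X1

variable {a b : ℝ}

lemma trace_intervalIntegrable_mul (u : X1 a b) (i : Fin 2) {r : ℝ} (hr : r ∈ ({a, b} : Set ℝ))
    {f : ℝ → ℝ} (hf : Continuous f) :
    IntervalIntegrable (fun θ => u.trace i (circlePt r θ) * f θ) volume 0 (2 * Real.pi) := by
  rw [intervalIntegrable_iff_integrableOn_Ioc_of_le (by positivity)]
  exact integrable_mul_of_memLp (u.trace_memLp i r hr) (memLp_Ioc_of_continuous hf _ _ 2)

lemma tangential_memLp (u : X1 a b) {r : ℝ} (hr : r ∈ ({a, b} : Set ℝ)) :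
    MemLp (fun θ => tangential u.trace r θ) 2 (volume.restrict (Ioc 0 (2 * Real.pi))) := by
  unfold tangential
  refine memLp_finsetSum _ fun i _ => ?_
  refine MemLp.of_le (u.trace_memLp i r hr) ((u.trace_memLp i r hr).1.mul
    (continuous_tangentVec i).aestronglyMeasurable) (Eventually.of_forall fun θ => ?_)
  rw [norm_mul]
  refine mul_le_of_le_one_right (norm_nonneg _) ?_
  fin_cases i
  · simpa [tangentVec] using Real.abs_sin_le_one θ
  · simpa [tangentVec] using Real.abs_cos_le_one θ

lemma tangential_mul_intervalIntegrable (u w : X1 a b) {r : ℝ} (hr : r ∈ ({a, b} : Set ℝ)) :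
    IntervalIntegrable (fun θ => tangential u.trace r θ * tangential w.trace r θ * r)
      volume 0 (2 * Real.pi) := by
  rw [intervalIntegrable_iff_integrableOn_Ioc_of_le (by positivity)]
  exact ((u.tangential_memLp hr).integrable_mul (w.tangential_memLp hr)).mul_const r

lemma grad_mul_integrable (u w : X1 a b) :
    Integrable (fun x => ∑ i, ∑ j, u.grad i j x * w.grad i j x)
      (volume.restrict (annulus a b)) :=
  integrable_finsetSum _ fun i _ => integrable_finsetSum _ fun j _ =>
    (u.grad_memLp i j).integrable_mul (w.grad_memLp i j)

lemma vel_mul_integrable (u w : X1 a b) :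
    Integrable (fun x => ∑ i, u.vel i x * w.vel i x) (volume.restrict (annulus a b)) :=
  integrable_finsetSum _ fun i _ => (u.vel_memLp i).integrable_mul (w.vel_memLp i)

/-- The linear combination `u + c w` in `X₁`. -/
def combo (ha : 0 < a) (u : X1 a b) (c : ℝ) (w : X1 a b) : X1 a b where
  vel i x := u.vel i x + c * w.vel i x
  grad i j x := u.grad i j x + c * w.grad i j x
  trace i x := u.trace i x + c * w.trace i x
  vel_memLp i := (u.vel_memLp i).add ((w.vel_memLp i).const_mul c)
  grad_memLp i j := (u.grad_memLp i j).add ((w.grad_memLp i j).const_mul c)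
  trace_memLp i r hr := (u.trace_memLp i r hr).add ((w.trace_memLp i r hr).const_mul c)
  isWeakGradient i := by
    intro φ h1 h2 h3 j
    have hu := u.isWeakGradient i φ h1 h2 h3 j
    have hw := w.isWeakGradient i φ h1 h2 h3 j
    have hφL : MemLp φ 2 (volume.restrict (annulus a b)) :=
      memLp_of_continuousOn ha h1.continuous.continuousOn 2
    have hdφL : MemLp (partialD j φ) 2 (volume.restrict (annulus a b)) :=
      memLp_of_continuousOn ha (SmoothOff.partialD h1.contDiffOn j).continuousOn 2
    simp only [add_mul, mul_assoc]
    rw [integral_add (integrable_mul_of_memLp (u.vel_memLp i) hdφL)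
      ((integrable_mul_of_memLp (w.vel_memLp i) hdφL).const_mul c),
      integral_add (integrable_mul_of_memLp (u.grad_memLp i j) hφL)
      ((integrable_mul_of_memLp (w.grad_memLp i j) hφL).const_mul c),
      integral_const_mul, integral_const_mul, hu, hw]
    ring
  isTrace i := by
    intro φ h1 j
    have hu := u.isTrace i φ h1 j
    have hw := w.isTrace i φ h1 j
    have hφL : MemLp φ 2 (volume.restrict (annulus a b)) :=
      memLp_of_continuousOn ha h1.continuous.continuousOn 2
    have hdφL : MemLp (partialD j φ) 2 (volume.restrict (annulus a b)) :=
      memLp_of_continuousOn ha (SmoothOff.partialD h1.contDiffOn j).continuousOn 2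
    have hI : ∀ v : X1 a b, Integrable (fun x => v.vel i x * partialD j φ x + v.grad i j x * φ x)
        (volume.restrict (annulus a b)) := fun v =>
      (integrable_mul_of_memLp (v.vel_memLp i) hdφL).add (integrable_mul_of_memLp (v.grad_memLp i j) hφL)
    have hB : ∀ v : X1 a b, ∀ r ∈ ({a, b} : Set ℝ), IntervalIntegrable
        (fun θ => v.trace i (circlePt r θ) * φ (circlePt r θ) * radialVec θ j * r) volume 0
          (2 * Real.pi) := fun v r hr => by
      have := v.trace_intervalIntegrable_mul i hr (f := fun θ =>
        φ (circlePt r θ) * radialVec θ j * r)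
        (((h1.continuous.comp (continuous_circlePt r)).mul (continuous_radialVec j)).mul_const r)
      refine this.congr (fun θ _ => ?_)
      simp only [mul_assoc]
    have hA : ∀ r ∈ ({a, b} : Set ℝ), arcInt r (fun θ => (u.trace i (circlePt r θ)
          + c * w.trace i (circlePt r θ)) * φ (circlePt r θ) * radialVec θ j)
        = arcInt r (fun θ => u.trace i (circlePt r θ) * φ (circlePt r θ) * radialVec θ j)
          + c * arcInt r (fun θ => w.trace i (circlePt r θ) * φ (circlePt r θ)
            * radialVec θ j) := fun r hr => by
      simp only [arcInt]
      rw [← intervalIntegral.integral_const_mul, ← intervalIntegral.integral_add (hB u r hr)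
        ((hB w r hr).const_mul c)]
      exact intervalIntegral.integral_congr fun θ _ => by ring
    rw [hA b (by simp), hA a (by simp)]
    have : ∫ x in annulus a b, ((u.vel i x + c * w.vel i x) * partialD j φ x
          + (u.grad i j x + c * w.grad i j x) * φ x)
        = (∫ x in annulus a b, (u.vel i x * partialD j φ x + u.grad i j x * φ x))
          + c * ∫ x in annulus a b, (w.vel i x * partialD j φ x + w.grad i j x * φ x) := by
      rw [← integral_const_mul, ← integral_add (hI u) ((hI w).const_mul c)]
      exact integral_congr_ae (Eventually.of_forall fun x => by ring)
    rw [this, hu, hw]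
    ring
  div_eq_zero := by
    filter_upwards [u.div_eq_zero, w.div_eq_zero] with x hu hw
    rw [Finset.sum_add_distrib, ← Finset.mul_sum, hu, hw]
    simp
  normal_eq_zero r hr := by
    filter_upwards [u.normal_eq_zero r hr, w.normal_eq_zero r hr] with θ hu hw
    simp only [radial, Fin.sum_univ_two] at hu hw ⊢
    linear_combination hu + c * hw
  average_eq_zero := by
    -- Additivity of the circle integrals requires integrability on the circle, which is available
    -- for almost every radius by Fubini.
    have hI : ∀ v : X1 a b, ∀ i, ∀ᵐ r ∂(volume.restrict (Ioo a b)),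
        IntervalIntegrable (fun θ => v.vel i (circlePt r θ)) volume 0 (2 * Real.pi) := fun v i =>
      ae_intervalIntegrable_circle ha ((v.vel_memLp i).integrable (by norm_num))
    filter_upwards [u.average_eq_zero, w.average_eq_zero, hI u 0, hI u 1, hI w 0, hI w 1]
      with r hu hw hu0 hu1 hw0 hw1
    have hT : ∀ v : X1 a b, IntervalIntegrable (fun θ => v.vel 0 (circlePt r θ)) volume 0
        (2 * Real.pi) → IntervalIntegrable (fun θ => v.vel 1 (circlePt r θ)) volume 0
        (2 * Real.pi) → IntervalIntegrable (fun θ => tangential v.vel r θ * r) volume 0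
        (2 * Real.pi) := fun v h0 h1 => by
      simp only [tangential, Fin.sum_univ_two]
      exact ((h0.mul_continuousOn (continuous_tangentVec 0).continuousOn).add
        (h1.mul_continuousOn (continuous_tangentVec 1).continuousOn)).mul_const r
    simp only [arcInt] at hu hw ⊢
    have : ∀ θ, tangential (fun i x => u.vel i x + c * w.vel i x) r θ * r
        = tangential u.vel r θ * r + c * (tangential w.vel r θ * r) := fun θ => by
      simp only [tangential, Fin.sum_univ_two]; ring
    simp only [this]
    rw [intervalIntegral.integral_add (hT u hu0 hu1) ((hT w hw0 hw1).const_mul c),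
      intervalIntegral.integral_const_mul, hu, hw]
    simp

lemma tangential_combo (ha : 0 < a) (u w : X1 a b) (c r θ : ℝ) :
    tangential (combo ha u c w).trace r θ
      = tangential u.trace r θ + c * tangential w.trace r θ := by
  simp only [tangential, Fin.sum_univ_two, combo]; ring

lemma arcInt_tangential_combo (ha : 0 < a) (u w v : X1 a b) (c : ℝ) {r : ℝ}
    (hr : r ∈ ({a, b} : Set ℝ)) :
    arcInt r (fun θ => tangential (combo ha u c w).trace r θ * tangential v.trace r θ)
      = arcInt r (fun θ => tangential u.trace r θ * tangential v.trace r θ)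
        + c * arcInt r (fun θ => tangential w.trace r θ * tangential v.trace r θ) := by
  simp only [arcInt]
  rw [← intervalIntegral.integral_const_mul, ← intervalIntegral.integral_add
    (u.tangential_mul_intervalIntegrable v hr)
    ((w.tangential_mul_intervalIntegrable v hr).const_mul c)]
  refine intervalIntegral.integral_congr fun θ _ => ?_
  simp only [tangential_combo]
  ring

lemma E1_combo (ha : 0 < a) (u w v : X1 a b) (c : ℝ) :
    E1 (combo ha u c w) v = E1 u v + c * E1 w v := by
  simp only [E1]
  rw [arcInt_tangential_combo ha u w v c (by simp)]
  have : ∫ x in annulus a b, ∑ i, ∑ j, (combo ha u c w).grad i j x * v.grad i j x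
      = (∫ x in annulus a b, ∑ i, ∑ j, u.grad i j x * v.grad i j x)
        + c * ∫ x in annulus a b, ∑ i, ∑ j, w.grad i j x * v.grad i j x := by
    rw [← integral_const_mul, ← integral_add (u.grad_mul_integrable v)
      ((w.grad_mul_integrable v).const_mul c)]
    refine integral_congr_ae (Eventually.of_forall fun x => ?_)
    simp only [combo, Fin.sum_univ_two]
    ring
  rw [this]
  ring

lemma E2_combo (ha : 0 < a) (u w v : X1 a b) (c : ℝ) :
    E2 (combo ha u c w) v = E2 u v + c * E2 w v :=
  arcInt_tangential_combo ha u w v c (by simp)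

lemma E3_combo (ha : 0 < a) (u w v : X1 a b) (c : ℝ) :
    E3 (combo ha u c w) v = E3 u v + c * E3 w v := by
  simp only [E3]
  rw [← integral_const_mul, ← integral_add (u.vel_mul_integrable v)
    ((w.vel_mul_integrable v).const_mul c)]
  refine integral_congr_ae (Eventually.of_forall fun x => ?_)
  simp only [combo, Fin.sum_univ_two]
  ring

lemma E1_comm (u w : X1 a b) : E1 u w = E1 w u := by
  simp only [E1, mul_comm]

lemma E2_comm (u w : X1 a b) : E2 u w = E2 w u := by
  simp only [E2, mul_comm]

lemma E3_comm (u w : X1 a b) : E3 u w = E3 w u := by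
  simp only [E3, mul_comm]

lemma arcInt_sq_nonneg {r : ℝ} (hr : 0 ≤ r) (f : ℝ → ℝ) : 0 ≤ arcInt r (fun θ => f θ * f θ) :=
  intervalIntegral.integral_nonneg (by positivity) fun θ _ => mul_nonneg (mul_self_nonneg _) hr

lemma integral_grad_le_E1 (hb : 0 < b) (u : X1 a b) :
    ∫ x in annulus a b, ∑ i, ∑ j, u.grad i j x * u.grad i j x ≤ E1 u u :=
  le_add_of_nonneg_right (mul_nonneg (by positivity) (arcInt_sq_nonneg hb.le _))

lemma E1_nonneg (hb : 0 < b) (u : X1 a b) : 0 ≤ E1 u u :=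
  (integral_nonneg fun x => Finset.sum_nonneg fun i _ => Finset.sum_nonneg fun j _ =>
    mul_self_nonneg (u.grad i j x)).trans (u.integral_grad_le_E1 hb)

lemma E2_nonneg (ha : 0 < a) (u : X1 a b) : 0 ≤ E2 u u := arcInt_sq_nonneg ha.le _

lemma E3_nonneg (u : X1 a b) : 0 ≤ E3 u u :=
  integral_nonneg fun x => Finset.sum_nonneg fun i _ => mul_self_nonneg (u.vel i x)

lemma E1_combo_self (ha : 0 < a) (u w : X1 a b) (c : ℝ) :
    E1 (combo ha u c w) (combo ha u c w) = E1 u u + 2 * c * E1 u w + c ^ 2 * E1 w w := by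
  rw [E1_combo, E1_comm u, E1_comm w, E1_combo, E1_combo, E1_comm w u]; ring

lemma E2_combo_self (ha : 0 < a) (u w : X1 a b) (c : ℝ) :
    E2 (combo ha u c w) (combo ha u c w) = E2 u u + 2 * c * E2 u w + c ^ 2 * E2 w w := by
  rw [E2_combo, E2_comm u, E2_comm w, E2_combo, E2_combo, E2_comm w u]; ring

lemma E3_combo_self (ha : 0 < a) (u w : X1 a b) (c : ℝ) :
    E3 (combo ha u c w) (combo ha u c w) = E3 u u + 2 * c * E3 u w + c ^ 2 * E3 w w := by
  rw [E3_combo, E3_comm u, E3_comm w, E3_combo, E3_combo, E3_comm w u]; ring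

/-- On the boundary a field of `X₁` is tangential. -/
lemma trace_eq (u : X1 a b) {r : ℝ} (hr : r ∈ ({a, b} : Set ℝ)) :
    ∀ᵐ θ ∂(volume.restrict (Ioc 0 (2 * Real.pi))), ∀ i,
      u.trace i (circlePt r θ) = tangential u.trace r θ * tangentVec θ i := by
  filter_upwards [u.normal_eq_zero r hr] with θ hθ i
  have := Real.sin_sq_add_cos_sq θ
  simp only [radial, tangential, Fin.sum_univ_two, radialVec, tangentVec,
    Matrix.cons_val_zero, Matrix.cons_val_one] at hθ ⊢
  fin_cases i <;> simp
  · linear_combination (-u.trace 0 (circlePt r θ)) * this + Real.cos θ * hθ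
  · linear_combination (-u.trace 1 (circlePt r θ)) * this + Real.sin θ * hθ

end X1

/-! ### Fields with a smooth stream function -/

/-- The field `∇^⊥ ψ` with stream function `ψ`. -/
def streamVel (ψ : ℝ × ℝ → ℝ) : Fin 2 → ℝ × ℝ → ℝ := ![fun x => -partialD 1 ψ x, partialD 0 ψ]

lemma SmoothOff.streamVel {ψ : ℝ × ℝ → ℝ} (hψ : SmoothOff ψ) (i : Fin 2) :
    SmoothOff (streamVel ψ i) := by
  fin_cases i
  · exact (hψ.partialD 1).neg
  · exact hψ.partialD 0

lemma tangential_streamVel (ψ : ℝ × ℝ → ℝ) (r θ : ℝ) :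
    tangential (streamVel ψ) r θ = ∑ i, radialVec θ i * AnnulusFlow.partialD i ψ (circlePt r θ) := by
  simp [tangential, streamVel, Fin.sum_univ_two, tangentVec, radialVec]; ring

lemma radial_streamVel (ψ : ℝ × ℝ → ℝ) (r θ : ℝ) :
    radial (streamVel ψ) r θ = -∑ i, tangentVec θ i * partialD i ψ (circlePt r θ) := by
  simp [radial, streamVel, Fin.sum_univ_two, tangentVec, radialVec]; ring

/-- The divergence theorem applied to the product `u φ`. -/
lemma isTrace_of_smoothOff {a b : ℝ} (ha : 0 < a) (hab : a < b) {u : ℝ × ℝ → ℝ}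
    (hu : SmoothOff u) : IsTrace a b u (fun j => partialD j u) u := by
  intro φ hφ i
  have hφ' : SmoothOff φ := hφ.contDiffOn
  rw [← integral_partialD ha hab (hu.mul hφ') i]
  refine setIntegral_congr_fun (measurableSet_annulus a b) fun x hx => ?_
  have hx0 : x ≠ 0 := closedAnnulus_subset ha (annulus_subset_closedAnnulus a b hx)
  exact (partialD_mul i (hu.differentiableAt hx0) (hφ'.differentiableAt hx0)).symm

/-- The element of `X₁` with a given smooth stream function. -/
def ofStream {a b : ℝ} (ha : 0 < a) (hab : a < b) (ψ : ℝ × ℝ → ℝ) (hψ : SmoothOff ψ)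
    (hbd : ∀ r ∈ ({a, b} : Set ℝ), ∀ θ, ψ (circlePt r θ) = 0)
    (havg : ∀ r ∈ Ioo a b, arcInt r (tangential (streamVel ψ) r) = 0) : X1 a b where
  vel := streamVel ψ
  grad i j := partialD j (streamVel ψ i)
  trace := streamVel ψ
  vel_memLp i := memLp_of_continuousOn ha (hψ.streamVel i).continuousOn 2
  grad_memLp i j := memLp_of_continuousOn ha ((hψ.streamVel i).partialD j).continuousOn 2
  trace_memLp i r hr := by
    have hr0 : 0 < r := by
      rcases hr with rfl | hr
      · exact ha
      · rw [mem_singleton_iff.1 hr]; exact ha.trans hab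
    have hc : Continuous fun θ => streamVel ψ i (circlePt r θ) :=
      (hψ.streamVel i).continuousOn.comp_continuous (continuous_circlePt r)
        fun θ => circlePt_ne_zero hr0 θ
    exact memLp_Ioc_of_continuous hc _ _ 2
  isWeakGradient i := (isTrace_of_smoothOff ha hab (hψ.streamVel i)).isWeakGradient
    (memLp_of_continuousOn ha (hψ.streamVel i).continuousOn 2)
    fun j => memLp_of_continuousOn ha ((hψ.streamVel i).partialD j).continuousOn 2
  isTrace i := isTrace_of_smoothOff ha hab (hψ.streamVel i)
  div_eq_zero := by
    filter_upwards [ae_restrict_mem (measurableSet_annulus a b)] with x hx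
    have hx0 : x ≠ 0 := closedAnnulus_subset ha (annulus_subset_closedAnnulus a b hx)
    rw [Fin.sum_univ_two]
    change partialD 0 (fun x => -partialD 1 ψ x) x + partialD 1 (partialD 0 ψ) x = 0
    rw [partialD_neg, partialD_comm hψ 0 1 hx0]
    ring
  normal_eq_zero r hr := by
    have hr0 : 0 < r := by
      rcases hr with rfl | hr
      · exact ha
      · rw [mem_singleton_iff.1 hr]; exact ha.trans hab
    refine Eventually.of_forall fun θ => ?_
    -- The normal component is, up to sign, the tangential derivative of `ψ`, which is zero because
    -- `ψ` is constant on the boundary circle.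
    have h1 := hasDerivAt_circlePt_angle (hψ.differentiableAt (circlePt_ne_zero hr0 θ))
    have h2 : HasDerivAt (fun t => ψ (circlePt r t)) 0 θ := by
      simp only [hbd r hr]
      exact hasDerivAt_const θ 0
    have h3 := h1.unique h2
    rw [radial_streamVel, neg_eq_zero]
    exact (mul_eq_zero.1 h3).resolve_left hr0.ne'
  average_eq_zero := by
    filter_upwards [ae_restrict_mem measurableSet_Ioo] with r hr
    exact havg r hr

/-! ### The radial problems: the harmonic weight -/

/-- The radial harmonic function of order `n` vanishing at `b`. -/
def radialHarmonic (b : ℝ) (n : ℕ) (r : ℝ) : ℝ := r ^ n - b ^ (2 * n) / r ^ n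

/-- The derivative of `radialHarmonic`. -/
def radialHarmonicDeriv (b : ℝ) (n : ℕ) (r : ℝ) : ℝ := n * (r ^ n + b ^ (2 * n) / r ^ n) / r

lemma radialHarmonic_right {b : ℝ} (hb : b ≠ 0) (n : ℕ) : radialHarmonic b n b = 0 := by
  rw [radialHarmonic, two_mul, pow_add, mul_div_cancel_right₀ _ (pow_ne_zero n hb), sub_self]

lemma radialHarmonic_neg {b r : ℝ} {n : ℕ} (hn : 1 ≤ n) (hr : 0 < r) (hrb : r < b) :
    radialHarmonic b n r < 0 := by
  unfold radialHarmonic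
  rw [sub_neg, lt_div_iff₀ (by positivity), ← mul_pow, pow_mul]
  exact pow_lt_pow_left₀ (by nlinarith) (by positivity) (by omega)

lemma hasDerivAt_pow_div {r : ℝ} (hr : r ≠ 0) (n : ℕ) :
    HasDerivAt (fun s : ℝ => s ^ n) (n * r ^ n / r) r := by
  refine (hasDerivAt_pow n r).congr_deriv ?_
  cases n with
  | zero => simp
  | succ n => field_simp; simp [pow_succ]

lemma hasDerivAt_const_div_pow {r : ℝ} (hr : r ≠ 0) (c : ℝ) (n : ℕ) :
    HasDerivAt (fun s : ℝ => c / s ^ n) (-(n * c / r ^ n) / r) r := by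
  refine ((hasDerivAt_const r c).fun_div (hasDerivAt_pow_div hr n) (pow_ne_zero n hr)).congr_deriv ?_
  field_simp
  ring

lemma hasDerivAt_radialHarmonic {b r : ℝ} (hr : r ≠ 0) (n : ℕ) :
    HasDerivAt (radialHarmonic b n) (radialHarmonicDeriv b n r) r := by
  refine ((hasDerivAt_pow_div hr n).sub (hasDerivAt_const_div_pow hr _ n)).congr_deriv ?_
  unfold radialHarmonicDeriv
  field_simp
  ring

lemma hasDerivAt_mul_radialHarmonicDeriv {b r : ℝ} (hr : r ≠ 0) (n : ℕ) :
    HasDerivAt (fun s => s * radialHarmonicDeriv b n s) ((n : ℝ) ^ 2 * radialHarmonic b n r / r)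
      r := by
  have h : HasDerivAt (fun s : ℝ => (n : ℝ) * (s ^ n + b ^ (2 * n) / s ^ n))
      ((n : ℝ) ^ 2 * radialHarmonic b n r / r) r := by
    refine (((hasDerivAt_pow_div hr n).fun_add
      (hasDerivAt_const_div_pow hr _ n)).const_mul (n : ℝ)).congr_deriv ?_
    unfold radialHarmonic
    field_simp
    ring
  refine h.congr_of_eventuallyEq ?_
  filter_upwards [isOpen_ne.mem_nhds hr] with s hs
  have hs' : s ≠ 0 := hs
  unfold radialHarmonicDeriv
  field_simp

lemma continuousOn_radialHarmonic (b : ℝ) (n : ℕ) : ContinuousOn (radialHarmonic b n) (Ioi 0) :=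
  fun _ hr => (hasDerivAt_radialHarmonic (ne_of_gt hr) n).continuousAt.continuousWithinAt

/-- The weighted norm of the harmonic weight. -/
def harmonicNorm (a b : ℝ) (n : ℕ) : ℝ := ∫ r in a..b, r * radialHarmonic b n r ^ 2

/-- The closed form of `gammaMode`. -/
def gammaVal (a b : ℝ) (n : ℕ) : ℝ := a ^ 2 * radialHarmonic b n a ^ 2 / harmonicNorm a b n

lemma uIcc_subset_Ioi {a b : ℝ} (ha : 0 < a) (hab : a < b) : uIcc a b ⊆ Ioi 0 := by
  rw [uIcc_of_le hab.le]
  exact fun r hr => ha.trans_le hr.1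

lemma harmonicNorm_intervalIntegrable {a b : ℝ} (ha : 0 < a) (hab : a < b) (n : ℕ) :
    IntervalIntegrable (fun r => r * radialHarmonic b n r ^ 2) volume a b :=
  ContinuousOn.intervalIntegrable
    (continuousOn_id.mul (((continuousOn_radialHarmonic b n).mono (uIcc_subset_Ioi ha hab)).pow 2))

lemma harmonicNorm_pos {a b : ℝ} {n : ℕ} (hn : 1 ≤ n) (ha : 0 < a) (hab : a < b) :
    0 < harmonicNorm a b n := by
  refine intervalIntegral.intervalIntegral_pos_of_pos_on
    (harmonicNorm_intervalIntegrable ha hab n) (fun r hr => ?_) hab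
  have h1 := (radialHarmonic_neg hn (ha.trans hr.1) hr.2).ne
  have h2 := ha.trans hr.1
  positivity

lemma gammaVal_pos {a b : ℝ} {n : ℕ} (hn : 1 ≤ n) (ha : 0 < a) (hab : a < b) :
    0 < gammaVal a b n := by
  have h1 := (radialHarmonic_neg hn ha hab).ne
  have h2 := harmonicNorm_pos hn ha hab
  unfold gammaVal
  positivity

/-! ### Integration by parts in `H²(a, b)` -/

namespace H2

variable {a b : ℝ}

lemma d2_intervalIntegrable (hab : a < b) (Φ : H2 a b) : IntervalIntegrable Φ.d2 volume a b := by
  rw [intervalIntegrable_iff_integrableOn_Ioo_of_le hab.le]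
  exact Φ.d2_memLp.integrable (by norm_num)

lemma continuousOn_d1 (hab : a < b) (Φ : H2 a b) : ContinuousOn Φ.d1 (Icc a b) := by
  have h := intervalIntegral.continuousOn_primitive_interval'
    (Φ.d2_intervalIntegrable hab) left_mem_uIcc
  rw [uIcc_of_le hab.le] at h
  exact (continuousOn_const.add h).congr Φ.d1_eq

lemma d1_intervalIntegrable (hab : a < b) (Φ : H2 a b) : IntervalIntegrable Φ.d1 volume a b :=
  ContinuousOn.intervalIntegrable_of_Icc hab.le (Φ.continuousOn_d1 hab)

lemma continuousOn_val (hab : a < b) (Φ : H2 a b) : ContinuousOn Φ.val (Icc a b) := by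
  have h := intervalIntegral.continuousOn_primitive_interval'
    (Φ.d1_intervalIntegrable hab) left_mem_uIcc
  rw [uIcc_of_le hab.le] at h
  exact (continuousOn_const.add h).congr Φ.val_eq

lemma hasDerivAt_val (hab : a < b) (Φ : H2 a b) {r : ℝ} (hr : r ∈ Ioo a b) :
    HasDerivAt Φ.val (Φ.d1 r) r := by
  have hnhds : Icc a b ∈ 𝓝 r := Icc_mem_nhds hr.1 hr.2
  have h1 : HasDerivAt (fun s => ∫ t in a..s, Φ.d1 t) (Φ.d1 r) r := by
    refine intervalIntegral.integral_hasDerivAt_right ?_ ?_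
      ((Φ.continuousOn_d1 hab).continuousAt hnhds)
    · exact (Φ.d1_intervalIntegrable hab).mono_set (uIcc_subset_uIcc_left
        (by rw [uIcc_of_le hab.le]; exact Ioo_subset_Icc_self hr))
    · exact (Φ.continuousOn_d1 hab).stronglyMeasurableAtFilter_nhdsWithin measurableSet_Icc r
        |>.filter_mono (by rw [nhdsWithin_eq_nhds.2 hnhds])
  refine (h1.const_add (Φ.val a)).congr_of_eventuallyEq ?_
  filter_upwards [hnhds] with s hs using Φ.val_eq s hs

/-- Integration by parts against a smooth weight vanishing at `b`. -/
lemma integral_mul_d2 (hab : a < b) (Φ : H2 a b) {p p' : ℝ → ℝ}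
    (hp : ∀ r ∈ Icc a b, HasDerivAt p (p' r) r) (hp' : ContinuousOn p' (Icc a b))
    (hpb : p b = 0) :
    ∫ r in a..b, p r * Φ.d2 r = -(p a * Φ.d1 a) - ∫ r in a..b, p' r * Φ.d1 r := by
  have hu : uIcc a b = Icc a b := uIcc_of_le hab.le
  -- Since `d2` is only square integrable, the integration by parts is the one for absolutely
  -- continuous functions, applied to `∫ₐʳ d2 = d1 r - d1 a`. The constant `d1 a` is what produces
  -- the boundary term at `a`.
  have hI := (Φ.d2_intervalIntegrable hab).absolutelyContinuousOnInterval_intervalIntegral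
    (c := a) (by simp)
  have hpc : ContDiffOn ℝ 1 p (uIcc a b) := by
    rw [hu]
    refine (contDiffOn_one_iff_derivWithin (uniqueDiffOn_Icc hab)).2
      ⟨fun r hr => (hp r hr).differentiableAt.differentiableWithinAt, hp'.congr fun r hr => ?_⟩
    exact (hp r hr).hasDerivWithinAt.derivWithin (uniqueDiffOn_Icc hab r hr)
  have hpA := hpc.absolutelyContinuousOnInterval
  have key := hpA.integral_mul_deriv_eq_deriv_mul hI
  have h1 : ∫ r in a..b, p r * deriv (fun x => ∫ t in a..x, Φ.d2 t) r
      = ∫ r in a..b, p r * Φ.d2 r := by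
    refine intervalIntegral.integral_congr_ae ?_
    filter_upwards [(Φ.d2_intervalIntegrable hab).ae_hasDerivAt_integral] with r hr hmem
    rw [(hr (uIoc_subset_uIcc hmem) a (by simp)).deriv]
  have hp'i : IntervalIntegrable p' volume a b :=
    ContinuousOn.intervalIntegrable_of_Icc hab.le hp'
  have hp'd : IntervalIntegrable (fun r => p' r * Φ.d1 r) volume a b :=
    ContinuousOn.intervalIntegrable_of_Icc hab.le (hp'.mul (Φ.continuousOn_d1 hab))
  have h2 : ∫ r in a..b, deriv p r * (∫ t in a..r, Φ.d2 t)
      = (∫ r in a..b, p' r * Φ.d1 r) - (∫ r in a..b, p' r) * Φ.d1 a := by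
    rw [← intervalIntegral.integral_mul_const, ← intervalIntegral.integral_sub hp'd
      (hp'i.mul_const _)]
    refine intervalIntegral.integral_congr fun r hr => ?_
    rw [hu] at hr
    simp only [(hp r hr).deriv, Φ.d1_eq r hr]
    ring
  have h3 : ∫ r in a..b, p' r = p b - p a :=
    intervalIntegral.integral_eq_sub_of_hasDerivAt (fun r hr => hp r (hu ▸ hr)) hp'i
  rw [h1, h2, h3, hpb] at key
  rw [key]
  simp
  ring

/-- Green's formula for `Δₙ Φ` against the radial harmonic function vanishing at `b`. -/
lemma integral_laplacian_mul_harmonic (ha : 0 < a) (hab : a < b) (n : ℕ) (Φ : H2 a b)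
    (h0 : Φ.val a = 0) (h1 : Φ.val b = 0) :
    ∫ r in a..b, r * (Φ.d2 r + 1 / r * Φ.d1 r - (n : ℝ) ^ 2 / r ^ 2 * Φ.val r)
        * radialHarmonic b n r
      = -(a * radialHarmonic b n a * Φ.d1 a) := by
  have hb : 0 < b := ha.trans hab
  have hu : uIcc a b = Icc a b := uIcc_of_le hab.le
  have hne : ∀ r ∈ Icc a b, r ≠ 0 := fun r hr => (ha.trans_le hr.1).ne'
  have hsub : Icc a b ⊆ Ioi 0 := fun r hr => ha.trans_le hr.1
  have hhc := (continuousOn_radialHarmonic b n).mono hsub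
  have hdc : ContinuousOn (fun r => r * radialHarmonicDeriv b n r) (Icc a b) := fun r hr =>
    (hasDerivAt_mul_radialHarmonicDeriv (hne r hr) n).continuousAt.continuousWithinAt
  have hqc : ContinuousOn (fun r => (n : ℝ) ^ 2 * radialHarmonic b n r / r) (Icc a b) :=
    (continuousOn_const.mul hhc).div continuousOn_id hne
  have hpd : ∀ r ∈ Icc a b, HasDerivAt (fun s => s * radialHarmonic b n s)
      (radialHarmonic b n r + r * radialHarmonicDeriv b n r) r := fun r hr => by
    simpa using (hasDerivAt_id r).fun_mul (hasDerivAt_radialHarmonic (b := b) (hne r hr) n)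
  have e1 := Φ.integral_mul_d2 hab hpd (hhc.add hdc) (by simp [radialHarmonic_right hb.ne'])
  have e2 : ∫ r in a..b, (r * radialHarmonicDeriv b n r) * Φ.d1 r
      = -∫ r in a..b, ((n : ℝ) ^ 2 * radialHarmonic b n r / r) * Φ.val r := by
    rw [intervalIntegral.integral_mul_deriv_eq_deriv_mul_of_hasDerivAt (hu ▸ hdc)
      (hu ▸ Φ.continuousOn_val hab) (fun r hr => hasDerivAt_mul_radialHarmonicDeriv ?_ n)
      (fun r hr => Φ.hasDerivAt_val hab ?_) (ContinuousOn.intervalIntegrable_of_Icc hab.le hqc)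
      (Φ.d1_intervalIntegrable hab), h0, h1]
    · ring
    · rw [min_eq_left hab.le, max_eq_right hab.le] at hr
      exact (ha.trans hr.1).ne'
    · rwa [min_eq_left hab.le, max_eq_right hab.le] at hr
  have i1 : IntervalIntegrable (fun r => r * radialHarmonic b n r * Φ.d2 r) volume a b :=
    (Φ.d2_intervalIntegrable hab).continuousOn_mul (hu ▸ continuousOn_id.mul hhc)
  have i2 : IntervalIntegrable (fun r => radialHarmonic b n r * Φ.d1 r) volume a b :=
    (Φ.d1_intervalIntegrable hab).continuousOn_mul (hu ▸ hhc)
  have i3 : IntervalIntegrable (fun r => (n : ℝ) ^ 2 * radialHarmonic b n r / r * Φ.val r)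
      volume a b :=
    ContinuousOn.intervalIntegrable_of_Icc hab.le (hqc.mul (Φ.continuousOn_val hab))
  have i4 : IntervalIntegrable (fun r => r * radialHarmonicDeriv b n r * Φ.d1 r) volume a b :=
    (Φ.d1_intervalIntegrable hab).continuousOn_mul (hu ▸ hdc)
  have e3 : ∫ r in a..b, (radialHarmonic b n r + r * radialHarmonicDeriv b n r) * Φ.d1 r
      = (∫ r in a..b, radialHarmonic b n r * Φ.d1 r)
        + ∫ r in a..b, r * radialHarmonicDeriv b n r * Φ.d1 r := by
    rw [← intervalIntegral.integral_add i2 i4]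
    exact intervalIntegral.integral_congr fun r _ => by ring
  have e4 : ∫ r in a..b, r * (Φ.d2 r + 1 / r * Φ.d1 r - (n : ℝ) ^ 2 / r ^ 2 * Φ.val r)
        * radialHarmonic b n r
      = (∫ r in a..b, r * radialHarmonic b n r * Φ.d2 r)
        + (∫ r in a..b, radialHarmonic b n r * Φ.d1 r)
        - ∫ r in a..b, (n : ℝ) ^ 2 * radialHarmonic b n r / r * Φ.val r := by
    rw [← intervalIntegral.integral_add i1 i2, ← intervalIntegral.integral_sub (i1.add i2) i3]
    refine intervalIntegral.integral_congr fun r hr => ?_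
    have := hne r (hu ▸ hr)
    field_simp
  rw [e4, e1, e3, e2]
  ring

end H2

/-! ### The radial minimizers -/

/-- The antisymmetric powers `q ^ n - q ^ (-n)`. -/
def powDiff (q : ℝ) (n : ℕ) : ℝ := q ^ n - 1 / q ^ n

lemma powDiff_pos {q : ℝ} (hq : 1 < q) {n : ℕ} (hn : 1 ≤ n) : 0 < powDiff q n := by
  have h1 : 1 < q ^ n := one_lt_pow₀ hq (by omega)
  have h2 : 1 / q ^ n < 1 := by rw [div_lt_one (by linarith)]; exact h1
  unfold powDiff
  linarith

/-- With `q = exp t` this is the addition formula for `2 sinh (n t)`. -/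
lemma powDiff_rec {q : ℝ} (hq : q ≠ 0) (n : ℕ) :
    powDiff q (n + 2) = (q + 1 / q) * powDiff q (n + 1) - powDiff q n := by
  unfold powDiff
  field_simp
  ring

/-- The ratio `Rₙ(q) = powDiff q (n + 2) / powDiff q (n + 1)` increases with `q > 1`: the recursion
reads `Rₙ₊₁ = (q + 1 / q) - 1 / Rₙ`, and `q + 1 / q` is increasing there. -/
lemma powDiff_lt {p q : ℝ} (hp : 1 < p) (hpq : p < q) (n : ℕ) :
    powDiff p (n + 2) * powDiff q (n + 1) < powDiff q (n + 2) * powDiff p (n + 1) := by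
  have hp0 : 0 < p := by linarith
  have hq0 : 0 < q := by linarith
  have hlt : p + 1 / p < q + 1 / q := by
    rw [← sub_pos]
    have : q + 1 / q - (p + 1 / p) = (q - p) * (p * q - 1) / (p * q) := by
      field_simp; ring
    rw [this]
    have h1 : 0 < q - p := by linarith
    have h2 : 0 < p * q - 1 := by nlinarith
    positivity
  have hP := powDiff_pos hp (n := n + 1) (by omega)
  have hQ := powDiff_pos (hp.trans hpq) (n := n + 1) (by omega)
  -- The positivity facts depend on `n`, so the induction carries them along as hypotheses of the
  -- inductive statement.
  have hmul := mul_pos (mul_pos hP hQ) (sub_pos.2 hlt)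
  induction n with
  | zero =>
    rw [powDiff_rec hp0.ne', powDiff_rec hq0.ne']
    have h0 : ∀ x : ℝ, powDiff x 0 = 0 := fun x => by simp [powDiff]
    rw [h0, h0]
    nlinarith
  | succ n ih =>
    have hP' := powDiff_pos hp (n := n + 1) (by omega)
    have hQ' := powDiff_pos (hp.trans hpq) (n := n + 1) (by omega)
    have := ih hP' hQ' (mul_pos (mul_pos hP' hQ') (sub_pos.2 hlt))
    rw [powDiff_rec hp0.ne' (n + 1), powDiff_rec hq0.ne' (n + 1)]
    nlinarith

lemma radialHarmonic_eq {b r : ℝ} (hb : b ≠ 0) (hr : r ≠ 0) (n : ℕ) :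
    radialHarmonic b n r = -(b ^ n * powDiff (b / r) n) := by
  unfold radialHarmonic powDiff
  rw [two_mul, pow_add, div_pow]
  field_simp
  ring

/-- Written as `a² / ∫ r (h(r) / h(a))²`, the constant increases because for `a < r < b` the ratio
`h(r) / h(a)` decreases strictly when the order grows; this is `powDiff_lt` at `b / r < b / a`. -/
lemma gammaVal_lt {a b : ℝ} {n : ℕ} (hn : 1 ≤ n) (ha : 0 < a) (hab : a < b) :
    gammaVal a b n < gammaVal a b (n + 1) := by
  obtain ⟨n, rfl⟩ : ∃ m, n = m + 1 := ⟨n - 1, by omega⟩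
  have hb := ha.trans hab
  have hJ := harmonicNorm_pos hn ha hab
  have hJ' := harmonicNorm_pos (n := n + 1 + 1) (by omega) ha hab
  set A := radialHarmonic b (n + 1) a with hA
  set B := radialHarmonic b (n + 1 + 1) a with hB
  have key : A ^ 2 * harmonicNorm a b (n + 1 + 1) < B ^ 2 * harmonicNorm a b (n + 1) := by
    unfold harmonicNorm
    rw [← intervalIntegral.integral_const_mul, ← intervalIntegral.integral_const_mul, ← sub_pos,
      ← intervalIntegral.integral_sub ((harmonicNorm_intervalIntegrable ha hab _).const_mul _)
        ((harmonicNorm_intervalIntegrable ha hab _).const_mul _)]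
    refine intervalIntegral.intervalIntegral_pos_of_pos_on
      (((harmonicNorm_intervalIntegrable ha hab _).const_mul _).sub
        ((harmonicNorm_intervalIntegrable ha hab _).const_mul _)) (fun r hr => ?_) hab
    have hr0 := ha.trans hr.1
    have h1 : 1 < b / r := (one_lt_div hr0).2 hr.2
    have h2 : b / r < b / a := div_lt_div_of_pos_left hb ha hr.1
    have h3 := powDiff_lt h1 h2 n
    have p1 := powDiff_pos h1 (n := n + 2) (by omega)
    have p2 := powDiff_pos (h1.trans h2) (n := n + 1) (by omega)
    have h4 : (powDiff (b / r) (n + 2) * powDiff (b / a) (n + 1)) ^ 2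
        < (powDiff (b / a) (n + 2) * powDiff (b / r) (n + 1)) ^ 2 :=
      pow_lt_pow_left₀ h3 (mul_pos p1 p2).le (by norm_num)
    rw [hA, hB, radialHarmonic_eq hb.ne' ha.ne', radialHarmonic_eq hb.ne' ha.ne',
      radialHarmonic_eq hb.ne' hr0.ne', radialHarmonic_eq hb.ne' hr0.ne']
    have h5 : 0 < r * (b ^ (n + 1) * b ^ (n + 2)) ^ 2 := by positivity
    have h6 := mul_pos h5 (sub_pos.2 h4)
    refine h6.trans_eq ?_
    rw [show n + 1 + 1 = n + 2 from rfl]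
    ring
  unfold gammaVal
  rw [div_lt_div_iff₀ hJ hJ']
  have ha2 : 0 < a ^ 2 := by positivity
  nlinarith

/-! ### The extremal profile: solving `ΔₙΦ = h` with `Φ(a) = Φ(b) = 0` -/

/-- The part of `modeSlope` that does not depend on `a`. -/
def slopeBase (b : ℝ) (n : ℕ) (t : ℝ) : ℝ := 1 / 4 * (1 / (n + 1) - b ^ (2 * n) / t ^ n)

/-- The coefficient that makes `modeRadial` vanish at `b ^ 2`. -/
def slopeConst (a b : ℝ) (n : ℕ) : ℝ :=
  -(∫ t in (a ^ 2)..(b ^ 2), slopeBase b n t) / ∫ t in (a ^ 2)..(b ^ 2), 1 / t ^ (n + 1)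

/-- The derivative of `modeRadial`. -/
def modeSlope (a b : ℝ) (n : ℕ) (t : ℝ) : ℝ := slopeBase b n t + slopeConst a b n / t ^ (n + 1)

/-- The derivative of `modeSlope`. -/
def modeSlopeDeriv (a b : ℝ) (n : ℕ) (t : ℝ) : ℝ :=
  (n / 4 * b ^ (2 * n) / t ^ n - (n + 1) * slopeConst a b n / t ^ (n + 1)) / t

/-- The radial factor of the stream function `modeRadial (|x| ^ 2) * Re (c z ^ n)`. -/
def modeRadial (a b : ℝ) (n : ℕ) (s : ℝ) : ℝ := ∫ t in (a ^ 2)..s, modeSlope a b n t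

lemma hasDerivAt_modeSlope (a b : ℝ) (n : ℕ) {t : ℝ} (ht : t ≠ 0) :
    HasDerivAt (modeSlope a b n) (modeSlopeDeriv a b n t) t := by
  refine ((((hasDerivAt_const_div_pow ht (b ^ (2 * n)) n).const_sub
    (1 / ((n : ℝ) + 1))).const_mul (1 / 4 : ℝ)).add
    (hasDerivAt_const_div_pow ht (slopeConst a b n) (n + 1))).congr_deriv ?_
  unfold modeSlopeDeriv
  push_cast
  ring

lemma contDiffOn_modeSlope (a b : ℝ) (n : ℕ) : ContDiffOn ℝ ∞ (modeSlope a b n) (Ioi 0) := by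
  have hp : ∀ k : ℕ, ContDiffOn ℝ ∞ (fun t : ℝ => t ^ k) (Ioi 0) := fun k => by fun_prop
  have hne : ∀ k : ℕ, ∀ t ∈ Ioi (0 : ℝ), t ^ k ≠ 0 := fun k t ht => pow_ne_zero k (ne_of_gt ht)
  exact (contDiffOn_const.mul (contDiffOn_const.sub (contDiffOn_const.div (hp n) (hne n)))).add
    (contDiffOn_const.div (hp (n + 1)) (hne (n + 1)))

lemma modeSlope_intervalIntegrable (a b : ℝ) (n : ℕ) {s t : ℝ} (hs : 0 < s) (ht : 0 < t) :
    IntervalIntegrable (modeSlope a b n) volume s t :=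
  ((contDiffOn_modeSlope a b n).continuousOn.mono fun _ hx =>
    (lt_min hs ht).trans_le hx.1).intervalIntegrable

lemma hasDerivAt_modeRadial {a : ℝ} (b : ℝ) (ha : 0 < a) (n : ℕ) {s : ℝ} (hs : 0 < s) :
    HasDerivAt (modeRadial a b n) (modeSlope a b n s) s :=
  intervalIntegral.integral_hasDerivAt_right
    (modeSlope_intervalIntegrable a b n (by positivity) hs)
    ((contDiffOn_modeSlope a b n).continuousOn.stronglyMeasurableAtFilter isOpen_Ioi s hs)
    ((contDiffOn_modeSlope a b n).continuousOn.continuousAt (Ioi_mem_nhds hs))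

lemma contDiffOn_modeRadial {a : ℝ} (b : ℝ) (ha : 0 < a) (n : ℕ) :
    ContDiffOn ℝ ∞ (modeRadial a b n) (Ioi 0) := by
  rw [contDiffOn_infty_iff_deriv_of_isOpen isOpen_Ioi]
  exact ⟨fun s hs => (hasDerivAt_modeRadial b ha n hs).differentiableAt.differentiableWithinAt,
    (contDiffOn_modeSlope a b n).congr fun s hs => (hasDerivAt_modeRadial b ha n hs).deriv⟩

lemma modeRadial_left (a b : ℝ) (n : ℕ) : modeRadial a b n (a ^ 2) = 0 := by
  simp [modeRadial]

/-- The free constant multiplies `t ^ (-(n + 1))`, whose integral over `[a², b²]` is positive; hence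
it can be adjusted to make the total integral of the slope zero. -/
lemma modeRadial_right {a b : ℝ} (ha : 0 < a) (hab : a < b) (n : ℕ) :
    modeRadial a b n (b ^ 2) = 0 := by
  have hb := ha.trans hab
  have hsub : uIcc (a ^ 2) (b ^ 2) ⊆ Ioi 0 := uIcc_subset_Ioi (by positivity) (by nlinarith)
  have hp : ∀ k : ℕ, ContinuousOn (fun t : ℝ => t ^ k) (uIcc (a ^ 2) (b ^ 2)) :=
    fun k => by fun_prop
  have hne : ∀ k : ℕ, ∀ t ∈ uIcc (a ^ 2) (b ^ 2), t ^ k ≠ 0 :=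
    fun k t ht => pow_ne_zero k (ne_of_gt (hsub ht))
  have i1 : IntervalIntegrable (slopeBase b n) volume (a ^ 2) (b ^ 2) :=
    ContinuousOn.intervalIntegrable (continuousOn_const.mul
      (continuousOn_const.sub (continuousOn_const.div (hp n) (hne n))))
  have i2 : IntervalIntegrable (fun t : ℝ => 1 / t ^ (n + 1)) volume (a ^ 2) (b ^ 2) :=
    ContinuousOn.intervalIntegrable (continuousOn_const.div (hp (n + 1)) (hne (n + 1)))
  have hpos : 0 < ∫ t in (a ^ 2)..(b ^ 2), 1 / t ^ (n + 1) := by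
    refine intervalIntegral.intervalIntegral_pos_of_pos_on i2 (fun t ht => ?_) (by nlinarith)
    have : 0 < t := lt_trans (by positivity) ht.1
    positivity
  have h : ∀ t, modeSlope a b n t = slopeBase b n t + slopeConst a b n * (1 / t ^ (n + 1)) :=
    fun t => by unfold modeSlope; ring
  unfold modeRadial
  simp only [h]
  rw [intervalIntegral.integral_add i1 (i2.const_mul _), intervalIntegral.integral_const_mul,
    slopeConst, div_mul_cancel₀ _ hpos.ne']
  ring

/-- The equation satisfied by `modeRadial`. -/
lemma modeSlope_ode (a b : ℝ) (n : ℕ) {t : ℝ} (ht : t ≠ 0) :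
    4 * t * modeSlopeDeriv a b n t + 4 * (n + 1) * modeSlope a b n t
      = 1 - b ^ (2 * n) / t ^ n := by
  -- For the slope `f` the equation is `(t ^ (n + 1) f)' = (t ^ n - b ^ (2n)) / 4`. Integrating it
  -- gives `slopeBase`, and the constant of integration gives the term `slopeConst / t ^ (n + 1)`.
  unfold modeSlopeDeriv modeSlope slopeBase
  have : (n : ℝ) + 1 ≠ 0 := by positivity
  field_simp
  ring

/-- The radial profile of the minimizer of order `n`. -/
def profile (a b : ℝ) (n : ℕ) (r : ℝ) : ℝ := r ^ n * modeRadial a b n (r ^ 2)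

/-- The first derivative of `profile`. -/
def profileD1 (a b : ℝ) (n : ℕ) (r : ℝ) : ℝ :=
  r ^ n * (n * modeRadial a b n (r ^ 2) / r + 2 * r * modeSlope a b n (r ^ 2))

/-- The second derivative of `profile`. -/
def profileD2 (a b : ℝ) (n : ℕ) (r : ℝ) : ℝ :=
  r ^ n * ((n ^ 2 - n) * modeRadial a b n (r ^ 2) / r ^ 2
    + (4 * n + 2) * modeSlope a b n (r ^ 2) + 4 * r ^ 2 * modeSlopeDeriv a b n (r ^ 2))

lemma hasDerivAt_profile {a : ℝ} (b : ℝ) (ha : 0 < a) (n : ℕ) {r : ℝ} (hr : 0 < r) :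
    HasDerivAt (profile a b n) (profileD1 a b n r) r := by
  have h1 : HasDerivAt (fun r : ℝ => modeRadial a b n (r ^ 2))
      (modeSlope a b n (r ^ 2) * (2 * r)) r := by
    have := (hasDerivAt_modeRadial b ha n (s := r ^ 2) (by positivity)).comp r (hasDerivAt_pow 2 r)
    simpa using! this
  refine ((hasDerivAt_pow_div hr.ne' n).fun_mul h1).congr_deriv ?_
  unfold profileD1
  ring

lemma hasDerivAt_profileD1 {a : ℝ} (b : ℝ) (ha : 0 < a) (n : ℕ) {r : ℝ} (hr : 0 < r) :
    HasDerivAt (profileD1 a b n) (profileD2 a b n r) r := by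
  have h1 : HasDerivAt (fun r : ℝ => modeRadial a b n (r ^ 2))
      (modeSlope a b n (r ^ 2) * (2 * r)) r := by
    have := (hasDerivAt_modeRadial b ha n (s := r ^ 2) (by positivity)).comp r (hasDerivAt_pow 2 r)
    simpa using! this
  have h2 : HasDerivAt (fun r : ℝ => modeSlope a b n (r ^ 2))
      (modeSlopeDeriv a b n (r ^ 2) * (2 * r)) r := by
    have := (hasDerivAt_modeSlope a b n (t := r ^ 2) (by positivity)).comp r (hasDerivAt_pow 2 r)
    simpa using! this
  refine ((hasDerivAt_pow_div hr.ne' n).fun_mul (((h1.const_mul (n : ℝ)).fun_div (hasDerivAt_id' r)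
    hr.ne').fun_add (((hasDerivAt_id' r).const_mul 2).fun_mul h2))).congr_deriv ?_
  unfold profileD2
  field_simp
  ring

/-- For `Φ = r ^ n F(r²)` one has `ΔₙΦ = r ^ n (4 s F'' + 4 (n + 1) F')` at `s = r²`, which turns
the equation for the slope into `ΔₙΦ = h`. This is the equality case of the Cauchy-Schwarz
inequality in `gammaVal_le`. -/
lemma profile_ode (a b : ℝ) (n : ℕ) {r : ℝ} (hr : 0 < r) :
    profileD2 a b n r + 1 / r * profileD1 a b n r - (n : ℝ) ^ 2 / r ^ 2 * profile a b n r
      = radialHarmonic b n r := by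
  have h := modeSlope_ode a b n (t := r ^ 2) (by positivity)
  have h2 : radialHarmonic b n r = r ^ n * (1 - b ^ (2 * n) / (r ^ 2) ^ n) := by
    unfold radialHarmonic
    rw [← pow_mul, mul_comm 2 n, pow_mul r n 2]
    field_simp
  rw [h2, ← h]
  unfold profileD2 profileD1 profile
  field_simp
  ring

lemma profile_left (a b : ℝ) (n : ℕ) : profile a b n a = 0 := by
  simp [profile, modeRadial_left]

lemma profile_right {a b : ℝ} (ha : 0 < a) (hab : a < b) (n : ℕ) : profile a b n b = 0 := by
  simp [profile, modeRadial_right ha hab]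

/-- The equation expresses the second derivative through lower-order terms that are already known to
be continuous. -/
lemma continuousOn_profileD2 {a : ℝ} (b : ℝ) (ha : 0 < a) (n : ℕ) :
    ContinuousOn (profileD2 a b n) (Ioi 0) := by
  have h : ∀ r ∈ Ioi (0 : ℝ), profileD2 a b n r = radialHarmonic b n r
      - 1 / r * profileD1 a b n r + (n : ℝ) ^ 2 / r ^ 2 * profile a b n r := fun r hr => by
    rw [← profile_ode a b n hr]; ring
  refine ContinuousOn.congr ?_ h
  have c1 : ContinuousOn (profileD1 a b n) (Ioi 0) := fun r hr =>
    (hasDerivAt_profileD1 b ha n hr).continuousAt.continuousWithinAt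
  have c0 : ContinuousOn (profile a b n) (Ioi 0) := fun r hr =>
    (hasDerivAt_profile b ha n hr).continuousAt.continuousWithinAt
  refine ((continuousOn_radialHarmonic b n).sub (ContinuousOn.mul (continuousOn_const.div
    continuousOn_id fun r hr => ne_of_gt hr) c1)).add (ContinuousOn.mul (continuousOn_const.div
    (continuousOn_id.pow 2) fun r hr => pow_ne_zero 2 (ne_of_gt hr)) c0)

/-- The radial minimizer as an element of `H²(a, b)`. -/
def profileH2 {a : ℝ} (b : ℝ) (ha : 0 < a) (n : ℕ) : H2 a b where
  val := profile a b n
  d1 := profileD1 a b n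
  d2 := profileD2 a b n
  d2_memLp := by
    have hc : ContinuousOn (profileD2 a b n) (Icc a b) :=
      (continuousOn_profileD2 b ha n).mono fun r hr => ha.trans_le hr.1
    obtain ⟨C, hC⟩ := isCompact_Icc.exists_bound_of_continuousOn hc
    refine MemLp.of_bound ((hc.mono Ioo_subset_Icc_self).aestronglyMeasurable measurableSet_Ioo)
      C ?_
    filter_upwards [ae_restrict_mem measurableSet_Ioo] with r hr
    exact hC r (Ioo_subset_Icc_self hr)
  d1_eq r hr := by
    have hsub : uIcc a r ⊆ Ioi 0 := by
      rw [uIcc_of_le hr.1]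
      exact fun s hs => ha.trans_le hs.1
    rw [intervalIntegral.integral_eq_sub_of_hasDerivAt
      (fun s hs => hasDerivAt_profileD1 b ha n (hsub hs))
      ((continuousOn_profileD2 b ha n).mono hsub).intervalIntegrable]
    ring
  val_eq r hr := by
    have hsub : uIcc a r ⊆ Ioi 0 := by
      rw [uIcc_of_le hr.1]
      exact fun s hs => ha.trans_le hs.1
    have c1 : ContinuousOn (profileD1 a b n) (Ioi 0) := fun r hr =>
      (hasDerivAt_profileD1 b ha n hr).continuousAt.continuousWithinAt
    rw [intervalIntegral.integral_eq_sub_of_hasDerivAt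
      (fun s hs => hasDerivAt_profile b ha n (hsub hs)) (c1.mono hsub).intervalIntegrable]
    ring

/-- Green's formula for the profile itself, where `ΔₙΦ = h`. It expresses the weighted norm of `h`
by the boundary data `h(a)` and `Φ'(a)`. -/
lemma harmonicNorm_eq {a b : ℝ} (ha : 0 < a) (hab : a < b) (n : ℕ) :
    harmonicNorm a b n = -(a * radialHarmonic b n a * profileD1 a b n a) := by
  refine Eq.trans ?_ ((profileH2 b ha n).integral_laplacian_mul_harmonic ha hab n
    (profile_left a b n) (profile_right ha hab n))
  refine intervalIntegral.integral_congr fun r hr => ?_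
  have hr0 : 0 < r := uIcc_subset_Ioi ha hab hr
  change _ = r * (profileD2 a b n r + 1 / r * profileD1 a b n r
    - (n : ℝ) ^ 2 / r ^ 2 * profile a b n r) * radialHarmonic b n r
  rw [profile_ode a b n hr0]
  ring

/-- The sign comes from `0 < ∫ r h² = -a h(a) Φ'(a)` and `h(a) < 0`. -/
lemma profileD1_left_pos {a b : ℝ} {n : ℕ} (hn : 1 ≤ n) (ha : 0 < a) (hab : a < b) :
    0 < profileD1 a b n a := by
  have h1 := harmonicNorm_pos hn ha hab
  rw [harmonicNorm_eq ha hab] at h1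
  have h2 := radialHarmonic_neg hn ha hab
  by_contra h3
  push Not at h3
  nlinarith [mul_nonneg_of_nonpos_of_nonpos (mul_nonpos_of_nonneg_of_nonpos ha.le h2.le) h3]

lemma gammaVal_eq {a b : ℝ} {n : ℕ} (hn : 1 ≤ n) (ha : 0 < a) (hab : a < b) :
    gammaVal a b n = -(a * radialHarmonic b n a) / profileD1 a b n a := by
  have h1 := (radialHarmonic_neg hn ha hab).ne
  have h2 := (profileD1_left_pos hn ha hab).ne'
  rw [gammaVal, harmonicNorm_eq ha hab]
  field_simp

lemma memLp_Ioc_of_continuousOn {a b : ℝ} {f : ℝ → ℝ} (hf : ContinuousOn f (Icc a b)) :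
    MemLp f 2 (volume.restrict (Ioc a b)) := by
  obtain ⟨C, hC⟩ := isCompact_Icc.exists_bound_of_continuousOn hf
  refine MemLp.of_bound ((hf.mono Ioc_subset_Icc_self).aestronglyMeasurable measurableSet_Ioc) C ?_
  filter_upwards [ae_restrict_mem measurableSet_Ioc] with r hr
  exact hC r (Ioc_subset_Icc_self hr)

/-- By Green's formula `(a h(a) Φ'(a))² = (∫ r (ΔₙΦ) h)²`, and the Cauchy-Schwarz inequality bounds
this by `∫ r (ΔₙΦ)² · ∫ r h²`. The weight `r` is shared between the two factors as `√r · √r`. -/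
lemma gammaVal_le {a b : ℝ} {n : ℕ} (hn : 1 ≤ n) (ha : 0 < a) (hab : a < b) {q : ℝ}
    (hq : q ∈ modeQuotients a b n) : gammaVal a b n ≤ q := by
  obtain ⟨Φ, h0, h1, hd, rfl⟩ := hq
  have hd2 : 0 < Φ.d1 a ^ 2 := by positivity
  have hJ := harmonicNorm_pos hn ha hab
  have hG := Φ.integral_laplacian_mul_harmonic ha hab n h0 h1
  set L : ℝ → ℝ := fun r => Φ.d2 r + 1 / r * Φ.d1 r - (n : ℝ) ^ 2 / r ^ 2 * Φ.val r with hL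
  have hsub : Icc a b ⊆ Ioi 0 := fun r hr => ha.trans_le hr.1
  have hne : ∀ r ∈ Icc a b, r ≠ 0 := fun r hr => (hsub hr).ne'
  have hsq : ContinuousOn (fun r : ℝ => √r) (Icc a b) := Real.continuous_sqrt.continuousOn
  have hLm : MemLp (fun r => √r * L r) 2 (volume.restrict (Ioc a b)) := by
    have e : (fun r => √r * L r) = fun r => √r * Φ.d2 r + (√r * (1 / r) * Φ.d1 r
        - √r * ((n : ℝ) ^ 2 / r ^ 2) * Φ.val r) := by
      funext r; simp only [hL]; ring
    rw [e]
    refine MemLp.add ?_ (memLp_Ioc_of_continuousOn ?_)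
    · have hd2m : MemLp Φ.d2 2 (volume.restrict (Ioc a b)) := by
        rw [← Measure.restrict_congr_set Ioo_ae_eq_Ioc]; exact Φ.d2_memLp
      refine MemLp.of_le_mul (c := √b) hd2m
        (Real.continuous_sqrt.aestronglyMeasurable.mul hd2m.1) ?_
      filter_upwards [ae_restrict_mem measurableSet_Ioc] with r hr
      rw [norm_mul, Real.norm_of_nonneg (Real.sqrt_nonneg _)]
      gcongr
      exact hr.2
    · exact ((hsq.mul (continuousOn_const.div continuousOn_id hne)).mul
        (Φ.continuousOn_d1 hab)).sub ((hsq.mul (continuousOn_const.div (continuousOn_id.pow 2)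
        fun r hr => pow_ne_zero 2 (hne r hr))).mul (Φ.continuousOn_val hab))
  have hhm : MemLp (fun r => √r * radialHarmonic b n r) 2 (volume.restrict (Ioc a b)) :=
    memLp_Ioc_of_continuousOn (hsq.mul ((continuousOn_radialHarmonic b n).mono hsub))
  have hCS := sq_integral_mul_le hLm hhm
  have hs : ∀ r ∈ Ioc a b, √r * √r = r := fun r hr => Real.mul_self_sqrt (ha.trans hr.1).le
  have e1 : ∫ r in Ioc a b, √r * L r * (√r * radialHarmonic b n r)
      = ∫ r in a..b, r * L r * radialHarmonic b n r := by
    rw [intervalIntegral.integral_of_le hab.le]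
    refine setIntegral_congr_fun measurableSet_Ioc fun r hr => ?_
    linear_combination L r * radialHarmonic b n r * hs r hr
  have e2 : ∫ r in Ioc a b, (√r * L r) ^ 2 = ∫ r in a..b, r * L r ^ 2 := by
    rw [intervalIntegral.integral_of_le hab.le]
    refine setIntegral_congr_fun measurableSet_Ioc fun r hr => ?_
    linear_combination L r ^ 2 * hs r hr
  have e3 : ∫ r in Ioc a b, (√r * radialHarmonic b n r) ^ 2 = harmonicNorm a b n := by
    rw [harmonicNorm, intervalIntegral.integral_of_le hab.le]
    refine setIntegral_congr_fun measurableSet_Ioc fun r hr => ?_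
    linear_combination radialHarmonic b n r ^ 2 * hs r hr
  rw [e1, e2, e3, hG] at hCS
  unfold gammaVal
  rw [div_le_div_iff₀ hJ hd2]
  linarith [hCS]

lemma gammaVal_mem {a b : ℝ} {n : ℕ} (hn : 1 ≤ n) (ha : 0 < a) (hab : a < b) :
    gammaVal a b n ∈ modeQuotients a b n := by
  have hd := profileD1_left_pos hn ha hab
  refine ⟨profileH2 b ha n, profile_left a b n, profile_right ha hab n, hd.ne', ?_⟩
  have h : ∫ r in a..b, r * ((profileH2 b ha n).d2 r + 1 / r * (profileH2 b ha n).d1 r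
      - (n : ℝ) ^ 2 / r ^ 2 * (profileH2 b ha n).val r) ^ 2 = harmonicNorm a b n := by
    refine intervalIntegral.integral_congr fun r hr => ?_
    have hr0 : 0 < r := uIcc_subset_Ioi ha hab hr
    change r * (profileD2 a b n r + 1 / r * profileD1 a b n r
      - (n : ℝ) ^ 2 / r ^ 2 * profile a b n r) ^ 2 = _
    rw [profile_ode a b n hr0]
  rw [h, gammaVal_eq hn ha hab, harmonicNorm_eq ha hab]
  change _ = _ / profileD1 a b n a ^ 2
  field_simp

lemma isLeast_modeQuotients {a b : ℝ} {n : ℕ} (hn : 1 ≤ n) (ha : 0 < a) (hab : a < b) :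
    IsLeast (modeQuotients a b n) (gammaVal a b n) :=
  ⟨gammaVal_mem hn ha hab, fun _ hq => gammaVal_le hn ha hab hq⟩

theorem gammaMode_eq {a b : ℝ} {n : ℕ} (hn : 1 ≤ n) (ha : 0 < a) (hab : a < b) :
    gammaMode a b n = gammaVal a b n :=
  (isLeast_modeQuotients hn ha hab).csInf_eq

/-! ### Green's formula in the annulus -/

lemma arcInt_sum {ι : Type*} (s : Finset ι) (r : ℝ) (f : ι → ℝ → ℝ)
    (h : ∀ i ∈ s, IntervalIntegrable (f i) volume 0 (2 * Real.pi)) :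
    arcInt r (fun θ => ∑ i ∈ s, f i θ) = ∑ i ∈ s, arcInt r (f i) := by
  simp only [arcInt, Finset.sum_mul]
  exact intervalIntegral.integral_finsetSum fun i hi => (h i hi).mul_const r

lemma arcInt_congr_ae {r : ℝ} {f g : ℝ → ℝ}
    (h : ∀ᵐ θ ∂(volume.restrict (Ioc 0 (2 * Real.pi))), f θ = g θ) : arcInt r f = arcInt r g := by
  unfold arcInt
  rw [intervalIntegral.integral_of_le (by positivity), intervalIntegral.integral_of_le
    (by positivity)]
  refine integral_congr_ae ?_
  filter_upwards [h] with θ hθ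
  rw [hθ]

lemma pos_of_mem_pair {a b r : ℝ} (ha : 0 < a) (hab : a < b) (hr : r ∈ ({a, b} : Set ℝ)) :
    0 < r := by
  rcases hr with rfl | hr
  · exact ha
  · rw [mem_singleton_iff.1 hr]; exact ha.trans hab

lemma SmoothOff.continuous_circle {φ : ℝ × ℝ → ℝ} (hφ : SmoothOff φ) {r : ℝ} (hr : 0 < r) :
    Continuous fun θ => φ (circlePt r θ) :=
  hφ.continuousOn.comp_continuous (continuous_circlePt r) fun θ => circlePt_ne_zero hr θ

namespace X1

variable {a b : ℝ}

lemma trace_formula (ha : 0 < a) (hab : a < b) (v : X1 a b) {φ : ℝ × ℝ → ℝ} (hφ : SmoothOff φ)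
    (i j : Fin 2) :
    (∫ x in annulus a b, v.vel i x * partialD j φ x) + ∫ x in annulus a b, v.grad i j x * φ x
      = arcInt b (fun θ => v.trace i (circlePt b θ) * (φ (circlePt b θ) * radialVec θ j))
        - arcInt a (fun θ => v.trace i (circlePt a θ) * (φ (circlePt a θ) * radialVec θ j)) := by
  rw [← integral_add (integrable_mul_of_continuousOn ha (v.vel_memLp i)
    (hφ.partialD j).continuousOn) (integrable_mul_of_continuousOn ha (v.grad_memLp i j)
    hφ.continuousOn), (v.isTrace i).smoothOff ha hab hφ j]
  simp only [mul_assoc]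

lemma trace_test_intervalIntegrable (ha : 0 < a) (hab : a < b) (v : X1 a b) {φ : ℝ × ℝ → ℝ}
    (hφ : SmoothOff φ) (i j : Fin 2) {r : ℝ} (hr : r ∈ ({a, b} : Set ℝ)) :
    IntervalIntegrable (fun θ => v.trace i (circlePt r θ) * (φ (circlePt r θ) * radialVec θ j))
      volume 0 (2 * Real.pi) :=
  v.trace_intervalIntegrable_mul i hr
    ((hφ.continuous_circle (pos_of_mem_pair ha hab hr)).mul (continuous_radialVec j))

/-- Fields of `X₁` are orthogonal to gradients. -/
lemma sum_integral_vel_mul_partialD (ha : 0 < a) (hab : a < b) (v : X1 a b) {p : ℝ × ℝ → ℝ}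
    (hp : SmoothOff p) :
    ∑ i, ∫ x in annulus a b, v.vel i x * partialD i p x = 0 := by
  have h := Finset.sum_congr (rfl : (Finset.univ : Finset (Fin 2)) = _)
    fun i _ => v.trace_formula ha hab hp i i
  have hdiv : ∑ i, ∫ x in annulus a b, v.grad i i x * p x = 0 := by
    rw [← integral_finsetSum _ fun i _ => integrable_mul_of_continuousOn ha (v.grad_memLp i i)
      hp.continuousOn]
    refine (integral_congr_ae (g := fun _ => (0 : ℝ)) ?_).trans (by simp)
    filter_upwards [v.div_eq_zero] with x hx
    rw [← Finset.sum_mul, hx]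
    simp
  have hbd : ∀ r ∈ ({a, b} : Set ℝ), ∑ i, arcInt r (fun θ => v.trace i (circlePt r θ)
      * (p (circlePt r θ) * radialVec θ i)) = 0 := fun r hr => by
    rw [← arcInt_sum _ _ _ fun i _ => v.trace_test_intervalIntegrable ha hab hp i i hr]
    have : arcInt r (fun _ => (0 : ℝ)) = 0 := by simp [arcInt]
    rw [← this]
    refine arcInt_congr_ae ?_
    filter_upwards [v.normal_eq_zero r hr] with θ hθ
    unfold radial at hθ
    calc ∑ i, v.trace i (circlePt r θ) * (p (circlePt r θ) * radialVec θ i)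
        = (∑ i, v.trace i (circlePt r θ) * radialVec θ i) * p (circlePt r θ) := by
          rw [Finset.sum_mul]; exact Finset.sum_congr rfl fun i _ => by ring
      _ = 0 := by rw [hθ, zero_mul]
  rw [Finset.sum_add_distrib, Finset.sum_sub_distrib, hdiv, hbd a (by simp), hbd b (by simp)] at h
  simpa using h

/-- Green's formula for a field of `X₁` and a smooth solution of the Stokes equations. -/
lemma integral_grad_mul (ha : 0 < a) (hab : a < b) (v : X1 a b) {w : Fin 2 → ℝ × ℝ → ℝ}
    (hw : ∀ i, SmoothOff (w i)) {p : ℝ × ℝ → ℝ} (hp : SmoothOff p)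
    (hΔ : ∀ i, ∀ x ≠ 0, ∑ j, partialD j (partialD j (w i)) x = partialD i p x) :
    ∫ x in annulus a b, ∑ i, ∑ j, v.grad i j x * partialD j (w i) x
      = arcInt b (fun θ => tangential v.trace b θ * ∑ i, tangentVec θ i *
            ∑ j, radialVec θ j * partialD j (w i) (circlePt b θ))
        - arcInt a (fun θ => tangential v.trace a θ * ∑ i, tangentVec θ i *
            ∑ j, radialVec θ j * partialD j (w i) (circlePt a θ)) := by
  have h := Finset.sum_congr (rfl : (Finset.univ : Finset (Fin 2)) = _) fun i _ =>
    Finset.sum_congr (rfl : (Finset.univ : Finset (Fin 2)) = _) fun j _ =>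
      v.trace_formula ha hab ((hw i).partialD j) i j
  -- The Laplacian of `w` is the gradient of `p`, and fields of `X₁` are orthogonal to gradients, so
  -- the interior term disappears.
  have hlap : ∑ i, ∑ j, ∫ x in annulus a b, v.vel i x * partialD j (partialD j (w i)) x = 0 := by
    rw [← v.sum_integral_vel_mul_partialD ha hab hp]
    refine Finset.sum_congr rfl fun i _ => ?_
    rw [← integral_finsetSum _ fun j _ => integrable_mul_of_continuousOn ha (v.vel_memLp i)
      (((hw i).partialD j).partialD j).continuousOn]
    refine setIntegral_congr_fun (measurableSet_annulus a b) fun x hx => ?_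
    have hx0 : x ≠ 0 := closedAnnulus_subset ha (annulus_subset_closedAnnulus a b hx)
    simp only [← Finset.mul_sum, hΔ i x hx0]
  have hgrad : ∫ x in annulus a b, ∑ i, ∑ j, v.grad i j x * partialD j (w i) x
      = ∑ i, ∑ j, ∫ x in annulus a b, v.grad i j x * partialD j (w i) x := by
    have hI : ∀ i j, Integrable (fun x => v.grad i j x * partialD j (w i) x)
        (volume.restrict (annulus a b)) := fun i j =>
      integrable_mul_of_continuousOn ha (v.grad_memLp i j) ((hw i).partialD j).continuousOn
    rw [integral_finsetSum _ fun i _ => integrable_finsetSum _ fun j _ => hI i j]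
    exact Finset.sum_congr rfl fun i _ => integral_finsetSum _ fun j _ => hI i j
  -- Only the tangential component of `v` survives on the boundary, which leaves the tangential part
  -- of the normal derivative of `w`.
  have hbd : ∀ r ∈ ({a, b} : Set ℝ), ∑ i, ∑ j, arcInt r (fun θ => v.trace i (circlePt r θ)
      * (partialD j (w i) (circlePt r θ) * radialVec θ j))
      = arcInt r (fun θ => tangential v.trace r θ * ∑ i, tangentVec θ i *
            ∑ j, radialVec θ j * partialD j (w i) (circlePt r θ)) := fun r hr => by
    have hI : ∀ i j, IntervalIntegrable (fun θ => v.trace i (circlePt r θ)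
        * (partialD j (w i) (circlePt r θ) * radialVec θ j)) volume 0 (2 * Real.pi) := fun i j =>
      v.trace_test_intervalIntegrable ha hab ((hw i).partialD j) i j hr
    calc _ = ∑ i, arcInt r (fun θ => ∑ j, v.trace i (circlePt r θ)
            * (partialD j (w i) (circlePt r θ) * radialVec θ j)) :=
          Finset.sum_congr rfl fun i _ => (arcInt_sum _ _ _ fun j _ => hI i j).symm
      _ = arcInt r (fun θ => ∑ i, ∑ j, v.trace i (circlePt r θ)
            * (partialD j (w i) (circlePt r θ) * radialVec θ j)) := by
          rw [arcInt_sum]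
          intro i _
          simp only [Fin.sum_univ_two]
          exact (hI i 0).add (hI i 1)
      _ = _ := by
          refine arcInt_congr_ae ?_
          filter_upwards [v.trace_eq hr] with θ hθ
          simp only [hθ, Fin.sum_univ_two]
          ring
  simp only [Finset.sum_add_distrib, Finset.sum_sub_distrib] at h
  rw [hlap, zero_add, ← hgrad, hbd a (by simp), hbd b (by simp)] at h
  exact h

end X1

/-! ### Harmonic functions -/

/-- The point of the complex plane with given coordinates. -/
def toC (x : ℝ × ℝ) : ℂ := Complex.equivRealProdCLM.symm x

lemma toC_ne_zero {x : ℝ × ℝ} (hx : x ≠ 0) : toC x ≠ 0 := by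
  unfold toC; simpa using hx

lemma toC_circlePt (r θ : ℝ) : toC (circlePt r θ) = r * Complex.exp (θ * Complex.I) := by
  unfold toC circlePt
  rw [Complex.exp_mul_I]
  apply Complex.ext <;> simp [Complex.cos_ofReal_re, Complex.sin_ofReal_re]

lemma contDiff_toC : ContDiff ℝ ∞ toC := Complex.equivRealProdCLM.symm.contDiff

lemma toC_unitVec_zero : Complex.equivRealProdCLM.symm (unitVec 0) = 1 := by
  apply Complex.ext <;> simp [unitVec]

lemma toC_unitVec_one : Complex.equivRealProdCLM.symm (unitVec 1) = Complex.I := by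
  apply Complex.ext <;> simp [unitVec]

lemma hasFDerivAt_comp_toC {f : ℂ → ℂ} {f' : ℂ} {x : ℝ × ℝ} (h : HasDerivAt f f' (toC x)) :
    HasFDerivAt (fun y => f (toC y))
      (((ContinuousLinearMap.toSpanSingleton ℂ f').restrictScalars ℝ).comp
        (Complex.equivRealProdCLM.symm : ℝ × ℝ →L[ℝ] ℂ)) x :=
  (h.hasFDerivAt.restrictScalars ℝ).comp x Complex.equivRealProdCLM.symm.hasFDerivAt

lemma fderiv_re_comp_toC {f : ℂ → ℂ} {f' : ℂ} {x : ℝ × ℝ} (h : HasDerivAt f f' (toC x))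
    (v : ℝ × ℝ) :
    fderiv ℝ (fun y => (f (toC y)).re) x v = (Complex.equivRealProdCLM.symm v * f').re := by
  have := (Complex.reCLM.hasFDerivAt.comp x (hasFDerivAt_comp_toC h)).fderiv
  rw [show (fun y => (f (toC y)).re) = Complex.reCLM ∘ fun y => f (toC y) from rfl, this]
  simp

lemma fderiv_im_comp_toC {f : ℂ → ℂ} {f' : ℂ} {x : ℝ × ℝ} (h : HasDerivAt f f' (toC x))
    (v : ℝ × ℝ) :
    fderiv ℝ (fun y => (f (toC y)).im) x v = (Complex.equivRealProdCLM.symm v * f').im := by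
  have := (Complex.imCLM.hasFDerivAt.comp x (hasFDerivAt_comp_toC h)).fderiv
  rw [show (fun y => (f (toC y)).im) = Complex.imCLM ∘ fun y => f (toC y) from rfl, this]
  simp

lemma partialD_zero_re {f : ℂ → ℂ} {f' : ℂ} {x : ℝ × ℝ} (h : HasDerivAt f f' (toC x)) :
    partialD 0 (fun y => (f (toC y)).re) x = f'.re := by
  rw [partialD, fderiv_re_comp_toC h, toC_unitVec_zero, one_mul]

lemma partialD_one_re {f : ℂ → ℂ} {f' : ℂ} {x : ℝ × ℝ} (h : HasDerivAt f f' (toC x)) :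
    partialD 1 (fun y => (f (toC y)).re) x = -f'.im := by
  rw [partialD, fderiv_re_comp_toC h, toC_unitVec_one]; simp

lemma partialD_zero_im {f : ℂ → ℂ} {f' : ℂ} {x : ℝ × ℝ} (h : HasDerivAt f f' (toC x)) :
    partialD 0 (fun y => (f (toC y)).im) x = f'.im := by
  rw [partialD, fderiv_im_comp_toC h, toC_unitVec_zero, one_mul]

lemma partialD_one_im {f : ℂ → ℂ} {f' : ℂ} {x : ℝ × ℝ} (h : HasDerivAt f f' (toC x)) :
    partialD 1 (fun y => (f (toC y)).im) x = f'.re := by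
  rw [partialD, fderiv_im_comp_toC h, toC_unitVec_one]; simp

/-- The harmonic polynomial `Re (c z ^ n)`. -/
def harmonicPoly (c : ℂ) (n : ℕ) (x : ℝ × ℝ) : ℝ := (c * toC x ^ n).re

lemma smoothOff_harmonicPoly (c : ℂ) (n : ℕ) : SmoothOff (harmonicPoly c n) :=
  (Complex.reCLM.contDiff.comp (contDiff_const.mul (contDiff_toC.pow n))).contDiffOn

lemma hasDerivAt_mul_pow (c : ℂ) (n : ℕ) (z : ℂ) :
    HasDerivAt (fun z : ℂ => c * z ^ n) (c * (n * z ^ (n - 1))) z :=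
  (hasDerivAt_pow n z).const_mul c

/-- Euler's identity for a homogeneous polynomial, read off from the real part of `z (c zⁿ)' = n c
zⁿ`. -/
lemma harmonicPoly_euler (c : ℂ) (n : ℕ) (x : ℝ × ℝ) :
    ∑ i, coord i x * partialD i (harmonicPoly c n) x = n * harmonicPoly c n x := by
  have h0 : partialD 0 (harmonicPoly c n) x = (c * (n * toC x ^ (n - 1))).re :=
    partialD_zero_re (hasDerivAt_mul_pow c n (toC x))
  have h1 : partialD 1 (harmonicPoly c n) x = -(c * (n * toC x ^ (n - 1))).im :=
    partialD_one_re (hasDerivAt_mul_pow c n (toC x))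
  have hz : toC x * (c * (n * toC x ^ (n - 1))) = n * (c * toC x ^ n) := by
    cases n with
    | zero => simp
    | succ n => simp [pow_succ]; ring
  have hx0 : (toC x).re = x.1 := rfl
  have hx1 : (toC x).im = x.2 := rfl
  have h := congrArg Complex.re hz
  rw [Complex.mul_re, ← Complex.ofReal_natCast, Complex.re_ofReal_mul, Complex.ofReal_natCast,
    hx0, hx1] at h
  rw [Fin.sum_univ_two, h0, h1, coord_zero, coord_one, harmonicPoly, ← h]
  ring

lemma harmonicPoly_laplacian (c : ℂ) (n : ℕ) (x : ℝ × ℝ) :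
    ∑ i, partialD i (partialD i (harmonicPoly c n)) x = 0 := by
  have h0 : partialD 0 (harmonicPoly c n) = fun x => (c * n * toC x ^ (n - 1)).re := by
    funext x
    rw [mul_assoc]
    exact partialD_zero_re (hasDerivAt_mul_pow c n (toC x))
  have h1 : partialD 1 (harmonicPoly c n) = fun x => -(c * n * toC x ^ (n - 1)).im := by
    funext x
    rw [mul_assoc]
    exact partialD_one_re (hasDerivAt_mul_pow c n (toC x))
  rw [Fin.sum_univ_two, h0, h1, partialD_neg,
    partialD_zero_re (hasDerivAt_mul_pow (c * n) (n - 1) (toC x)),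
    partialD_one_im (hasDerivAt_mul_pow (c * n) (n - 1) (toC x))]
  ring

/-- The Laplacian of the product of a radial function and a harmonic polynomial. -/
lemma laplacian_radial_mul {F f f' : ℝ → ℝ} (hFs : ContDiffOn ℝ ∞ F (Ioi 0))
    (hfs : ContDiffOn ℝ ∞ f (Ioi 0)) (hF : ∀ s, 0 < s → HasDerivAt F (f s) s)
    (hf : ∀ s, 0 < s → HasDerivAt f (f' s) s) (c : ℂ) (n : ℕ) {x : ℝ × ℝ} (hx : x ≠ 0) :
    ∑ i, partialD i (partialD i (fun y => F (normSqr y) * harmonicPoly c n y)) x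
      = (4 * normSqr x * f' (normSqr x) + 4 * (n + 1) * f (normSqr x)) * harmonicPoly c n x := by
  have sF := SmoothOff.comp_normSqr hFs
  have sf := SmoothOff.comp_normSqr hfs
  have sP := smoothOff_harmonicPoly c n
  have sc : ∀ i, SmoothOff (coord i) := fun i => (contDiff_coord i).contDiffOn
  have hfirst : ∀ i, EqOn (partialD i (fun y => F (normSqr y) * harmonicPoly c n y))
      (fun y => F (normSqr y) * partialD i (harmonicPoly c n) y
        + 2 * (f (normSqr y) * (coord i y * harmonicPoly c n y))) {0}ᶜ := fun i y hy => by
    rw [partialD_mul i (sF.differentiableAt hy) (sP.differentiableAt hy),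
      partialD_comp_normSqr i (hF _ (normSqr_pos hy))]
    ring
  have hsecond : ∀ i, partialD i (partialD i (fun y => F (normSqr y) * harmonicPoly c n y)) x
      = F (normSqr x) * partialD i (partialD i (harmonicPoly c n)) x
        + 4 * f (normSqr x) * (coord i x * partialD i (harmonicPoly c n) x)
        + 2 * f (normSqr x) * harmonicPoly c n x
        + 4 * f' (normSqr x) * coord i x ^ 2 * harmonicPoly c n x := fun i => by
    have d1 := sF.differentiableAt hx
    have d2 := (sP.partialD i).differentiableAt hx
    have d3 := sf.differentiableAt hx
    have d4 := (sc i).differentiableAt hx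
    have d5 := sP.differentiableAt hx
    rw [partialD_congr (hfirst i) i hx, partialD_add i (d1.fun_mul d2)
      ((d3.fun_mul (d4.fun_mul d5)).const_mul 2), partialD_const_mul i 2 (d3.fun_mul (d4.fun_mul d5)),
      partialD_mul i d1 d2, partialD_mul i d3 (d4.fun_mul d5), partialD_mul i d4 d5,
      partialD_comp_normSqr i (hF _ (normSqr_pos hx)),
      partialD_comp_normSqr i (hf _ (normSqr_pos hx)), partialD_coord, if_pos rfl]
    ring
  have e := harmonicPoly_euler c n x
  have l := harmonicPoly_laplacian c n x
  have hs : normSqr x = coord 0 x ^ 2 + coord 1 x ^ 2 := rfl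
  rw [Fin.sum_univ_two] at e l ⊢
  rw [hsecond, hsecond]
  linear_combination F (normSqr x) * l + 4 * f (normSqr x) * e
    - 4 * f' (normSqr x) * harmonicPoly c n x * hs

/-! ### The fields of a single Fourier mode -/

/-- The angular factor `Re (c exp (i n θ))`. -/
def modeAngular (c : ℂ) (n : ℕ) (θ : ℝ) : ℝ := (c * Complex.exp (n * θ * Complex.I)).re

lemma continuous_modeAngular (c : ℂ) (n : ℕ) : Continuous (modeAngular c n) := by
  unfold modeAngular
  fun_prop

lemma harmonicPoly_circlePt (c : ℂ) (n : ℕ) (r θ : ℝ) :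
    harmonicPoly c n (circlePt r θ) = r ^ n * modeAngular c n θ := by
  rw [harmonicPoly, modeAngular, toC_circlePt, mul_pow, ← Complex.exp_nat_mul, ← mul_assoc,
    mul_comm c, mul_assoc, mul_assoc, ← Complex.ofReal_pow, Complex.re_ofReal_mul]

/-- The integral of an exponential over a period. -/
lemma integral_exp_int_mul (k : ℤ) :
    ∫ θ in (0 : ℝ)..2 * Real.pi, Complex.exp (k * θ * Complex.I)
      = if k = 0 then 2 * (Real.pi : ℂ) else 0 := by
  split_ifs with hk
  · simp [hk]
  · have hk' : (k : ℂ) * Complex.I ≠ 0 := by simp [hk]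
    have h := integral_exp_mul_complex (a := 0) (b := 2 * Real.pi) hk'
    have e : ∀ θ : ℝ, (k : ℂ) * θ * Complex.I = k * Complex.I * θ := fun θ => by ring
    simp only [e]
    rw [h]
    have : Complex.exp ((k : ℂ) * Complex.I * ((2 * Real.pi : ℝ) : ℂ)) = 1 := by
      rw [Complex.exp_eq_one_iff]
      exact ⟨k, by push_cast; ring⟩
    rw [this]
    simp

/-- The `n`-th complex Fourier coefficient. -/
def fourierC (g : ℝ → ℝ) (n : ℤ) : ℂ :=
  1 / (2 * Real.pi) * ∫ θ in (0 : ℝ)..2 * Real.pi, Complex.exp (-(n * θ * Complex.I)) * g θ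

lemma integral_mul_modeAngular {g : ℝ → ℝ} (hg : IntervalIntegrable g volume 0 (2 * Real.pi))
    (c : ℂ) (n : ℕ) :
    ∫ θ in (0 : ℝ)..2 * Real.pi, g θ * modeAngular c n θ
      = 2 * Real.pi * (c * (starRingEnd ℂ) (fourierC g n)).re := by
  have hgC : IntervalIntegrable (fun θ => (g θ : ℂ)) volume 0 (2 * Real.pi) := ⟨hg.1.ofReal, hg.2.ofReal⟩
  have hexp : Continuous fun θ : ℝ => c * Complex.exp (n * θ * Complex.I) := by fun_prop
  have h1 : ∀ θ : ℝ, g θ * modeAngular c n θ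
      = Complex.reCLM (c * Complex.exp (n * θ * Complex.I) * g θ) := fun θ => by
    simp [modeAngular, mul_comm]
  simp only [h1]
  rw [Complex.reCLM.intervalIntegral_comp_comm (hgC.continuousOn_mul hexp.continuousOn)]
  have h2 : (starRingEnd ℂ) (fourierC g n) = 1 / (2 * Real.pi)
      * ∫ θ in (0 : ℝ)..2 * Real.pi, Complex.exp (n * θ * Complex.I) * g θ := by
    rw [fourierC, map_mul, intervalIntegral.integral_of_le (by positivity),
      intervalIntegral.integral_of_le (by positivity), ← integral_conj]
    congr 1
    · simp [Complex.conj_ofNat]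
    · refine integral_congr_ae (Eventually.of_forall fun θ => ?_)
      simp [← Complex.exp_conj]
  have h3 : ∫ θ in (0 : ℝ)..2 * Real.pi, c * Complex.exp (n * θ * Complex.I) * g θ
      = ((2 * Real.pi : ℝ) : ℂ) * (c * (1 / (2 * Real.pi)
        * ∫ θ in (0 : ℝ)..2 * Real.pi, Complex.exp (n * θ * Complex.I) * g θ)) := by
    simp only [mul_assoc c, intervalIntegral.integral_const_mul]
    generalize (∫ θ in (0 : ℝ)..2 * Real.pi, Complex.exp (n * θ * Complex.I) * g θ) = J
    have : (Real.pi : ℂ) ≠ 0 := by exact_mod_cast Real.pi_ne_zero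
    push_cast
    field_simp
  rw [h2, h3, Complex.reCLM_apply, Complex.re_ofReal_mul]

/-- `Re (c exp(imθ))` is half the sum of `c exp(imθ)` and its conjugate. The conjugate has frequency
`-m`, which never meets `n ≥ 0` because `m ≥ 1`; hence the single value `c / 2`. -/
lemma fourierC_modeAngular (c : ℂ) {m : ℕ} (hm : 1 ≤ m) (n : ℕ) :
    fourierC (modeAngular c m) n = if n = m then c / 2 else 0 := by
  have h1 : ∀ θ : ℝ, Complex.exp (-((n : ℤ) * θ * Complex.I)) * modeAngular c m θ
      = c / 2 * Complex.exp (((m - n : ℤ) : ℂ) * θ * Complex.I)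
        + (starRingEnd ℂ) c / 2 * Complex.exp (((-m - n : ℤ) : ℂ) * θ * Complex.I) := fun θ => by
    rw [modeAngular, Complex.re_eq_add_conj, map_mul, ← Complex.exp_conj]
    have e1 : Complex.exp (((m - n : ℤ) : ℂ) * θ * Complex.I)
        = Complex.exp (-((n : ℤ) * θ * Complex.I)) * Complex.exp (m * θ * Complex.I) := by
      rw [← Complex.exp_add]; congr 1; push_cast; ring
    have e2 : Complex.exp (((-m - n : ℤ) : ℂ) * θ * Complex.I)
        = Complex.exp (-((n : ℤ) * θ * Complex.I)) * Complex.exp (-(m * θ * Complex.I)) := by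
      rw [← Complex.exp_add]; congr 1; push_cast; ring
    rw [e1, e2]
    simp only [map_mul, Complex.conj_I, Complex.conj_ofReal, map_natCast, mul_neg]
    ring
  have hc : ∀ (d : ℂ) (k : ℤ), IntervalIntegrable
      (fun θ : ℝ => d * Complex.exp ((k : ℂ) * θ * Complex.I)) volume 0 (2 * Real.pi) :=
    fun d k => Continuous.intervalIntegrable (by fun_prop) _ _
  rw [fourierC]
  simp only [h1]
  rw [intervalIntegral.integral_add (hc _ _) (hc _ _), intervalIntegral.integral_const_mul,
    intervalIntegral.integral_const_mul, integral_exp_int_mul, integral_exp_int_mul,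
    if_neg (by omega : ¬ (-(m : ℤ) - n = 0))]
  by_cases h : n = m
  · rw [if_pos (by omega), if_pos h]
    have : (Real.pi : ℂ) ≠ 0 := by exact_mod_cast Real.pi_ne_zero
    field_simp
    ring
  · rw [if_neg (by omega), if_neg h]; simp

lemma integral_modeAngular (c : ℂ) {n : ℕ} (hn : 1 ≤ n) :
    ∫ θ in (0 : ℝ)..2 * Real.pi, modeAngular c n θ = 0 := by
  -- The mode of order `0` with coefficient `1` is the constant function one.
  have h := integral_mul_modeAngular (g := modeAngular c n)
    ((continuous_modeAngular c n).intervalIntegrable _ _) 1 0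
  rw [fourierC_modeAngular c hn 0, if_neg (by omega)] at h
  simpa [modeAngular] using h

/-- The stream function of a Fourier mode. -/
def modeStream (a b : ℝ) (n : ℕ) (c : ℂ) (x : ℝ × ℝ) : ℝ :=
  modeRadial a b n (normSqr x) * harmonicPoly c n x

lemma smoothOff_modeStream {a : ℝ} (b : ℝ) (ha : 0 < a) (n : ℕ) (c : ℂ) :
    SmoothOff (modeStream a b n c) :=
  (SmoothOff.comp_normSqr (contDiffOn_modeRadial b ha n)).mul (smoothOff_harmonicPoly c n)

lemma modeStream_circlePt (a b : ℝ) (n : ℕ) (c : ℂ) (r θ : ℝ) :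
    modeStream a b n c (circlePt r θ) = profile a b n r * modeAngular c n θ := by
  rw [modeStream, normSqr_circlePt, harmonicPoly_circlePt, profile]
  ring

lemma tangential_modeStream {a : ℝ} (b : ℝ) (ha : 0 < a) (n : ℕ) (c : ℂ) {r : ℝ} (hr : 0 < r)
    (θ : ℝ) :
    tangential (streamVel (modeStream a b n c)) r θ = profileD1 a b n r * modeAngular c n θ := by
  rw [tangential_streamVel]
  have h1 := hasDerivAt_circlePt_radius
    ((smoothOff_modeStream b ha n c).differentiableAt (circlePt_ne_zero hr θ))
  simp only [modeStream_circlePt] at h1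
  exact h1.unique ((hasDerivAt_profile b ha n hr).mul_const _)

/-- The element of `X₁` of a Fourier mode. -/
def modeField {a b : ℝ} (ha : 0 < a) (hab : a < b) {n : ℕ} (hn : 1 ≤ n) (c : ℂ) : X1 a b :=
  ofStream ha hab (modeStream a b n c) (smoothOff_modeStream b ha n c)
    (by
      intro r hr θ
      rw [modeStream_circlePt]
      rcases hr with rfl | hr
      · rw [profile_left, zero_mul]
      · rw [mem_singleton_iff.1 hr, profile_right ha hab, zero_mul])
    (by
      intro r hr
      have h : ∀ θ, tangential (streamVel (modeStream a b n c)) r θ * r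
          = profileD1 a b n r * r * modeAngular c n θ := fun θ => by
        rw [tangential_modeStream b ha n c (ha.trans hr.1)]; ring
      simp only [arcInt, h, intervalIntegral.integral_const_mul, integral_modeAngular c hn,
        mul_zero])

lemma tangential_modeField {a b : ℝ} (ha : 0 < a) (hab : a < b) {n : ℕ} (hn : 1 ≤ n) (c : ℂ)
    {r : ℝ} (hr : 0 < r) (θ : ℝ) :
    tangential (modeField ha hab hn c).trace r θ = profileD1 a b n r * modeAngular c n θ :=
  tangential_modeStream b ha n c hr θ

/-- The holomorphic function whose real part is the vorticity of a Fourier mode. -/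
def modeVorticity (b : ℝ) (n : ℕ) (c z : ℂ) : ℂ :=
  c * z ^ n - (b ^ (2 * n) : ℝ) * (starRingEnd ℂ) c * (z ^ n)⁻¹

lemma differentiableAt_modeVorticity (b : ℝ) (n : ℕ) (c : ℂ) {z : ℂ} (hz : z ≠ 0) :
    DifferentiableAt ℂ (modeVorticity b n c) z := by
  unfold modeVorticity
  have : z ^ n ≠ 0 := pow_ne_zero n hz
  fun_prop (disch := assumption)

lemma contDiffOn_modeVorticity (b : ℝ) (n : ℕ) (c : ℂ) :
    ContDiffOn ℝ ∞ (fun x => modeVorticity b n c (toC x)) {0}ᶜ := by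
  unfold modeVorticity
  have h := contDiff_toC.contDiffOn (s := ({0}ᶜ : Set (ℝ × ℝ)))
  exact (contDiffOn_const.mul (h.pow n)).sub (contDiffOn_const.mul
    ((h.pow n).inv fun x hx => pow_ne_zero n (toC_ne_zero hx)))

lemma normSq_toC (x : ℝ × ℝ) : Complex.normSq (toC x) = normSqr x := by
  rw [Complex.normSq_apply, normSqr, sq, sq]
  rfl

/-- The factor `1 - b ^ (2n) / |z| ^ (2n)` times `Re (c zⁿ)` is the real part of a holomorphic
function, since `conj c · z⁻ⁿ` and `c zⁿ / |z| ^ (2n)` are conjugate. -/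
lemma laplacian_modeStream {a : ℝ} (b : ℝ) (ha : 0 < a) (n : ℕ) (c : ℂ) {x : ℝ × ℝ} (hx : x ≠ 0) :
    ∑ i, partialD i (partialD i (modeStream a b n c)) x = (modeVorticity b n c (toC x)).re := by
  have hs := normSqr_pos hx
  have h := laplacian_radial_mul (contDiffOn_modeRadial b ha n) (contDiffOn_modeSlope a b n)
    (fun s hs => hasDerivAt_modeRadial b ha n hs)
    (fun s hs => hasDerivAt_modeSlope a b n hs.ne') c n hx
  refine h.trans ?_
  rw [modeSlope_ode a b n hs.ne', modeVorticity, Complex.inv_def, Complex.sub_re, harmonicPoly,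
    mul_assoc, Complex.re_ofReal_mul, ← mul_assoc, ← map_mul, mul_comm _ (((_ : ℝ) : ℂ)),
    Complex.re_ofReal_mul, Complex.conj_re, map_pow, normSq_toC]
  ring

/-- The Laplacian commutes with `∇^⊥`, so the left side is `∇^⊥` of the vorticity. By the
Cauchy-Riemann equations this is the gradient of the harmonic conjugate, which plays the role of the
pressure. -/
lemma laplacian_streamVel_modeStream {a : ℝ} (b : ℝ) (ha : 0 < a) (n : ℕ) (c : ℂ) (i : Fin 2)
    {x : ℝ × ℝ} (hx : x ≠ 0) :
    ∑ j, partialD j (partialD j (streamVel (modeStream a b n c) i)) x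
      = partialD i (fun y => (modeVorticity b n c (toC y)).im) x := by
  have hψ := smoothOff_modeStream b ha n c
  have hd := (differentiableAt_modeVorticity b n c (toC_ne_zero hx)).hasDerivAt
  have hcomm : ∀ k : Fin 2, ∑ j, partialD j (partialD j (partialD k (modeStream a b n c))) x
      = partialD k (fun y => (modeVorticity b n c (toC y)).re) x := fun k => by
    have h1 : ∀ j, partialD j (partialD j (partialD k (modeStream a b n c))) x
        = partialD k (partialD j (partialD j (modeStream a b n c))) x := fun j => by
      rw [partialD_congr (fun y hy => partialD_comm hψ j k hy) j hx,
        partialD_comm (hψ.partialD j) j k hx]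
    rw [← partialD_congr (fun y hy => laplacian_modeStream b ha n c hy) k hx]
    simp only [h1, Fin.sum_univ_two]
    rw [partialD_add k (((hψ.partialD 0).partialD 0).differentiableAt hx)
      (((hψ.partialD 1).partialD 1).differentiableAt hx)]
  fin_cases i
  · change ∑ j, partialD j (partialD j (fun x => -partialD 1 (modeStream a b n c) x)) x = _
    have h2 : ∀ j, partialD j (partialD j (fun x => -partialD 1 (modeStream a b n c) x)) x
        = -partialD j (partialD j (partialD 1 (modeStream a b n c))) x := fun j => by
      rw [← partialD_neg]
      congr 1
      funext y
      exact partialD_neg j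
    simp only [h2, Finset.sum_neg_distrib, hcomm]
    rw [partialD_one_re hd, neg_neg]
    exact (partialD_zero_im hd).symm
  · change ∑ j, partialD j (partialD j (partialD 0 (modeStream a b n c))) x = _
    rw [hcomm, partialD_zero_re hd]
    exact (partialD_one_im hd).symm

/-- The eigenvalue of `E₁` with respect to `E₂` of the fields of order `n`. -/
def kappa (a b : ℝ) (n : ℕ) : ℝ := (gammaVal a b n + 1) / a

/-- The fields of a Fourier mode are eigenfunctions of `E₁` with respect to `E₂`. -/
theorem E1_modeField {a b : ℝ} (ha : 0 < a) (hab : a < b) {n : ℕ} (hn : 1 ≤ n) (c : ℂ)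
    (v : X1 a b) :
    E1 v (modeField ha hab hn c) = kappa a b n * E2 v (modeField ha hab hn c) := by
  have hb := ha.trans hab
  have hψ := smoothOff_modeStream b ha n c
  have hw := fun i => hψ.streamVel i
  -- On every circle the tangential component is `Φ'(r)` times the angular factor, and the tangent
  -- vector does not depend on `r`; so its radial derivative carries `Φ''`.
  have hnormal : ∀ r, 0 < r → ∀ θ, ∑ i, tangentVec θ i * ∑ j, radialVec θ j *
      partialD j (streamVel (modeStream a b n c) i) (circlePt r θ)
      = profileD2 a b n r * modeAngular c n θ := fun r hr θ => by
    have h1 : HasDerivAt (fun s => tangential (streamVel (modeStream a b n c)) s θ)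
        (∑ i, (∑ j, radialVec θ j * partialD j (streamVel (modeStream a b n c) i) (circlePt r θ))
          * tangentVec θ i) r := by
      unfold tangential
      exact HasDerivAt.fun_sum fun i _ => (hasDerivAt_circlePt_radius
        ((hw i).differentiableAt (circlePt_ne_zero hr θ))).mul_const _
    have h2 : HasDerivAt (fun s => tangential (streamVel (modeStream a b n c)) s θ)
        (profileD2 a b n r * modeAngular c n θ) r := by
      refine ((hasDerivAt_profileD1 b ha n hr).mul_const _).congr_of_eventuallyEq ?_
      filter_upwards [Ioi_mem_nhds hr] with s hs
      exact tangential_modeStream b ha n c hs θ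
    rw [← h1.unique h2]
    exact Finset.sum_congr rfl fun i _ => mul_comm _ _
  have key := v.integral_grad_mul ha hab hw
    (p := fun y => (modeVorticity b n c (toC y)).im)
    (Complex.imCLM.contDiff.comp_contDiffOn (contDiffOn_modeVorticity b n c))
    fun i x hx => laplacian_streamVel_modeStream b ha n c i hx
  simp only [hnormal b hb, hnormal a ha] at key
  have hpull : ∀ (r k : ℝ), arcInt r (fun θ => tangential v.trace r θ * (k * modeAngular c n θ))
      = k * arcInt r (fun θ => tangential v.trace r θ * modeAngular c n θ) := fun r k => by
    simp only [arcInt]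
    rw [← intervalIntegral.integral_const_mul]
    exact intervalIntegral.integral_congr fun θ _ => by ring
  have hE1 : E1 v (modeField ha hab hn c)
      = (∫ x in annulus a b, ∑ i, ∑ j, v.grad i j x
          * partialD j (streamVel (modeStream a b n c) i) x)
        + 1 / b * arcInt b (fun θ => tangential v.trace b θ
          * tangential (modeField ha hab hn c).trace b θ) := rfl
  have hodeB := profile_ode a b n hb
  have hodeA := profile_ode a b n ha
  rw [profile_right ha hab, radialHarmonic_right hb.ne'] at hodeB
  rw [profile_left] at hodeA
  have hd := profileD1_left_pos hn ha hab
  rw [hE1, key, E2]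
  simp only [tangential_modeField ha hab hn c hb, tangential_modeField ha hab hn c ha, hpull]
  -- At `b` the weight `h` vanishes, and `Φ''(b) = -Φ'(b) / b` cancels the boundary term of `E₁`. At
  -- `a` one gets `-Φ''(a) = (γₙ + 1) / a · Φ'(a)`, which is where `kappa` comes from.
  have hB : profileD2 a b n b = -(1 / b * profileD1 a b n b) := by linarith
  have hA : profileD2 a b n a = radialHarmonic b n a - 1 / a * profileD1 a b n a := by linarith
  rw [hB, hA, kappa, gammaVal_eq hn ha hab]
  field_simp
  ring

/-! ### Testing the boundary values with radially constant fields -/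

/-- The Cauchy-Schwarz inequality for finite families of functions. -/
lemma sq_sum_integral_mul_le {X ι : Type*} [MeasurableSpace X] {μ : Measure X} (s : Finset ι)
    {f g : ι → X → ℝ} (hf : ∀ i ∈ s, MemLp (f i) 2 μ) (hg : ∀ i ∈ s, MemLp (g i) 2 μ) :
    (∑ i ∈ s, ∫ x, f i x * g i x ∂μ) ^ 2
      ≤ (∑ i ∈ s, ∫ x, f i x ^ 2 ∂μ) * ∑ i ∈ s, ∫ x, g i x ^ 2 ∂μ := by
  have hA : ∀ i, 0 ≤ ∫ x, f i x ^ 2 ∂μ := fun i => integral_nonneg fun x => sq_nonneg _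
  have hB : ∀ i, 0 ≤ ∫ x, g i x ^ 2 ∂μ := fun i => integral_nonneg fun x => sq_nonneg _
  have h1 : |∑ i ∈ s, ∫ x, f i x * g i x ∂μ|
      ≤ ∑ i ∈ s, √(∫ x, f i x ^ 2 ∂μ) * √(∫ x, g i x ^ 2 ∂μ) := by
    refine (Finset.abs_sum_le_sum_abs _ _).trans (Finset.sum_le_sum fun i hi => ?_)
    rw [← Real.sqrt_mul (hA i)]
    exact Real.abs_le_sqrt (sq_integral_mul_le (hf i hi) (hg i hi))
  have h2 := Finset.sum_mul_sq_le_sq_mul_sq s (fun i => √(∫ x, f i x ^ 2 ∂μ))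
    fun i => √(∫ x, g i x ^ 2 ∂μ)
  simp only [Real.sq_sqrt (hA _), Real.sq_sqrt (hB _)] at h2
  refine le_trans ?_ h2
  rw [← sq_abs]
  exact pow_le_pow_left₀ (abs_nonneg _) h1 2

lemma sum_radialVec_mul_self (θ : ℝ) : ∑ j, radialVec θ j * radialVec θ j = 1 := by
  rw [Fin.sum_univ_two]
  simp only [radialVec, Matrix.cons_val_zero, Matrix.cons_val_one]
  nlinarith [Real.sin_sq_add_cos_sq θ]

lemma sum_tangentVec_mul_self (θ : ℝ) : ∑ j, tangentVec θ j * tangentVec θ j = 1 := by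
  rw [Fin.sum_univ_two]
  simp only [tangentVec, Matrix.cons_val_zero, Matrix.cons_val_one]
  nlinarith [Real.sin_sq_add_cos_sq θ]

lemma exists_circlePt {x : ℝ × ℝ} (hx : x ≠ 0) : ∃ r θ, 0 < r ∧ x = circlePt r θ := by
  refine ⟨‖toC x‖, (toC x).arg, norm_pos_iff.2 (toC_ne_zero hx), ?_⟩
  have h1 : toC x = toC (circlePt ‖toC x‖ (toC x).arg) := by
    rw [toC_circlePt, Complex.norm_mul_exp_arg_mul_I]
  exact Complex.equivRealProdCLM.symm.injective h1

/-- Functions that are constant on rays satisfy Euler's equation. -/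
lemma euler_of_radially_constant {φ : ℝ × ℝ → ℝ} (hφ : SmoothOff φ) {f : ℝ → ℝ}
    (hf : ∀ r θ, 0 < r → φ (circlePt r θ) = f θ) {x : ℝ × ℝ} (hx : x ≠ 0) :
    ∑ j, coord j x * partialD j φ x = 0 := by
  obtain ⟨r, θ, hr, rfl⟩ := exists_circlePt hx
  have h1 := hasDerivAt_circlePt_radius (hφ.differentiableAt hx)
  have h2 : HasDerivAt (fun s => φ (circlePt s θ)) 0 r := by
    refine (hasDerivAt_const r (f θ)).congr_of_eventuallyEq ?_
    filter_upwards [Ioi_mem_nhds hr] with s hs using hf s θ hs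
  have h3 := h1.unique h2
  simp only [coord_circlePt, mul_assoc, ← Finset.mul_sum, h3, mul_zero]

/-- The integral of the product of a radial function and a radially constant one. -/
lemma integral_radial_mul {a b : ℝ} (ha : 0 < a) (hab : a < b) {F : ℝ → ℝ} {Y : ℝ × ℝ → ℝ}
    {f : ℝ → ℝ} (hF : ContDiffOn ℝ ∞ F (Ioi 0)) (hY : SmoothOff Y)
    (hf : ∀ r θ, 0 < r → Y (circlePt r θ) = f θ) :
    ∫ x in annulus a b, F (normSqr x) * Y x
      = (∫ r in a..b, F (r ^ 2) * r) * ∫ θ in (0 : ℝ)..2 * Real.pi, f θ := by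
  rw [integral_annulus ha hab (integrable_of_continuousOn ha
    ((SmoothOff.comp_normSqr hF).mul hY).continuousOn), ← integral_Ioc_eq_integral_Ioo,
    ← intervalIntegral.integral_of_le hab.le, ← intervalIntegral.integral_mul_const]
  refine intervalIntegral.integral_congr fun r hr => ?_
  have hr0 : 0 < r := uIcc_subset_Ioi ha hab hr
  simp only [arcInt, normSqr_circlePt, hf r _ hr0]
  rw [← intervalIntegral.integral_const_mul]
  exact intervalIntegral.integral_congr fun θ _ => by ring

/-- A smooth family `G` that is the tangential field `f τ` on every circle. -/
structure IsTangentialField (G : Fin 2 → ℝ × ℝ → ℝ) (f : ℝ → ℝ) : Prop where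
  smooth : ∀ i, SmoothOff (G i)
  eq : ∀ i r θ, 0 < r → G i (circlePt r θ) = tangentVec θ i * f θ

namespace IsTangentialField

variable {a b : ℝ} {G : Fin 2 → ℝ × ℝ → ℝ} {f : ℝ → ℝ}

lemma integral_sq (hG : IsTangentialField G f) (ha : 0 < a) (hab : a < b) {F : ℝ → ℝ}
    (hF : ContDiffOn ℝ ∞ F (Ioi 0)) :
    ∑ i, ∫ x in annulus a b, (G i x * F (normSqr x)) ^ 2
      = (∫ r in a..b, F (r ^ 2) ^ 2 * r) * ∫ θ in (0 : ℝ)..2 * Real.pi, f θ ^ 2 := by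
  have sF := SmoothOff.comp_normSqr hF
  have hI : ∀ i, Integrable (fun x => (G i x * F (normSqr x)) ^ 2)
      (volume.restrict (annulus a b)) := fun i =>
    (memLp_of_continuousOn ha ((hG.smooth i).mul sF).continuousOn 2).integrable_sq
  rw [← integral_finsetSum _ fun i _ => hI i]
  have h1 : ∀ x, ∑ i, (G i x * F (normSqr x)) ^ 2
      = F (normSqr x) ^ 2 * ∑ i, G i x * G i x := fun x => by
    rw [Finset.mul_sum]; exact Finset.sum_congr rfl fun i _ => by ring
  simp only [h1]
  refine integral_radial_mul ha hab (F := fun s => F s ^ 2) (f := fun θ => f θ ^ 2) (hF.pow 2)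
    (ContDiffOn.sum fun i _ => (hG.smooth i).mul (hG.smooth i)) fun r θ hr => ?_
  simp only [hG.eq _ r θ hr]
  have h := sum_tangentVec_mul_self θ
  rw [Fin.sum_univ_two] at h ⊢
  linear_combination f θ ^ 2 * h

/-- The components of `G` are constant on rays, so `x · ∇Gᵢ = 0` and the divergence of `x Gᵢ
η(|x|²)` only sees `x` and `η`. -/
lemma sum_partialD (hG : IsTangentialField G f) {η η' : ℝ → ℝ} (hη : ContDiffOn ℝ ∞ η (Ioi 0))
    (hη' : ∀ s, 0 < s → HasDerivAt η (η' s) s) (i : Fin 2) {x : ℝ × ℝ} (hx : x ≠ 0) :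
    ∑ j, partialD j (fun y => coord j y * (G i y * η (normSqr y))) x
      = G i x * (2 * η (normSqr x) + 2 * normSqr x * η' (normSqr x)) := by
  have sη := SmoothOff.comp_normSqr hη
  have sc : ∀ i, SmoothOff (coord i) := fun i => (contDiff_coord i).contDiffOn
  have d1 := (hG.smooth i).differentiableAt hx
  have d2 := sη.differentiableAt hx
  have h1 : ∀ j, partialD j (fun y => coord j y * (G i y * η (normSqr y))) x
      = η (normSqr x) * (coord j x * partialD j (G i) x)
        + G i x * η (normSqr x)
        + 2 * G i x * η' (normSqr x) * coord j x ^ 2 := fun j => by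
    rw [partialD_mul j ((sc j).differentiableAt hx) (d1.fun_mul d2), partialD_mul j d1 d2,
      partialD_comp_normSqr j (hη' _ (normSqr_pos hx)), partialD_coord, if_pos rfl]
    ring
  have e := euler_of_radially_constant (hG.smooth i) (f := fun θ => tangentVec θ i * f θ)
    (hG.eq i) hx
  have hs : normSqr x = coord 0 x ^ 2 + coord 1 x ^ 2 := rfl
  rw [Fin.sum_univ_two] at e ⊢
  rw [h1, h1]
  linear_combination η (normSqr x) * e - 2 * G i x * η' (normSqr x) * hs

/-- The value on the inner circle in terms of integrals over the annulus. -/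
lemma boundary_formula (hG : IsTangentialField G f) (ha : 0 < a) (hab : a < b) (v : X1 a b)
    {η η' : ℝ → ℝ} (hη : ContDiffOn ℝ ∞ η (Ioi 0))
    (hη' : ∀ s, 0 < s → HasDerivAt η (η' s) s) (hηa : η (a ^ 2) = 1) (hηb : η (b ^ 2) = 0) :
    (∑ i, ∫ x in annulus a b,
        v.vel i x * (G i x * (2 * η (normSqr x) + 2 * normSqr x * η' (normSqr x))))
      + ∑ i, ∑ j, ∫ x in annulus a b, v.grad i j x * (coord j x * (G i x * η (normSqr x)))
      = -(a ^ 2 * ∫ θ in (0 : ℝ)..2 * Real.pi, tangential v.trace a θ * f θ) := by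
  have sη := SmoothOff.comp_normSqr hη
  -- The test functions are `xⱼ Gᵢ η(|x|²)`. On the inner circle `x = a n` and the arc length
  -- element `a dθ` together give the factor `a²`; the outer circle is removed by `η(b²) = 0`.
  have sφ : ∀ i j, SmoothOff (fun y => coord j y * (G i y * η (normSqr y))) := fun i j =>
    (contDiff_coord j).contDiffOn.mul ((hG.smooth i).mul sη)
  have h := Finset.sum_congr (rfl : (Finset.univ : Finset (Fin 2)) = _) fun i _ =>
    Finset.sum_congr (rfl : (Finset.univ : Finset (Fin 2)) = _) fun j _ =>
      v.trace_formula ha hab (sφ i j) i j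
  have h1 : ∀ i, ∑ j, ∫ x in annulus a b,
      v.vel i x * partialD j (fun y => coord j y * (G i y * η (normSqr y))) x
      = ∫ x in annulus a b,
        v.vel i x * (G i x * (2 * η (normSqr x) + 2 * normSqr x * η' (normSqr x))) := fun i => by
    rw [← integral_finsetSum _ fun j _ => integrable_mul_of_continuousOn ha (v.vel_memLp i)
      ((sφ i j).partialD j).continuousOn]
    refine setIntegral_congr_fun (measurableSet_annulus a b) fun x hx => ?_
    have hx0 : x ≠ 0 := closedAnnulus_subset ha (annulus_subset_closedAnnulus a b hx)
    simp only [← Finset.mul_sum, hG.sum_partialD hη hη' i hx0]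
  have hb : ∀ i j, arcInt b (fun θ => v.trace i (circlePt b θ)
      * (coord j (circlePt b θ) * (G i (circlePt b θ) * η (normSqr (circlePt b θ)))
        * radialVec θ j)) = 0 := fun i j => by
    simp [normSqr_circlePt, hηb, arcInt]
  have hA : ∑ i, ∑ j, arcInt a (fun θ => v.trace i (circlePt a θ)
      * (coord j (circlePt a θ) * (G i (circlePt a θ) * η (normSqr (circlePt a θ)))
        * radialVec θ j))
      = a ^ 2 * ∫ θ in (0 : ℝ)..2 * Real.pi, tangential v.trace a θ * f θ := by
    have hI : ∀ i j, IntervalIntegrable (fun θ => v.trace i (circlePt a θ)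
        * (coord j (circlePt a θ) * (G i (circlePt a θ) * η (normSqr (circlePt a θ)))
        * radialVec θ j)) volume 0 (2 * Real.pi) := fun i j =>
      v.trace_test_intervalIntegrable ha hab (sφ i j) i j (by simp)
    calc _ = ∑ i, arcInt a (fun θ => ∑ j, v.trace i (circlePt a θ)
      * (coord j (circlePt a θ) * (G i (circlePt a θ) * η (normSqr (circlePt a θ)))
        * radialVec θ j)) :=
          Finset.sum_congr rfl fun i _ => (arcInt_sum _ _ _ fun j _ => hI i j).symm
      _ = arcInt a (fun θ => ∑ i, ∑ j, v.trace i (circlePt a θ)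
      * (coord j (circlePt a θ) * (G i (circlePt a θ) * η (normSqr (circlePt a θ)))
        * radialVec θ j)) := by
          rw [arcInt_sum]
          intro i _
          simp only [Fin.sum_univ_two]
          exact (hI i 0).add (hI i 1)
      _ = _ := by
          rw [arcInt, ← intervalIntegral.integral_const_mul]
          refine intervalIntegral.integral_congr fun θ _ => ?_
          have hr := sum_radialVec_mul_self θ
          simp only [coord_circlePt, hG.eq _ a θ ha, normSqr_circlePt, hηa, tangential,
            Fin.sum_univ_two] at hr ⊢
          linear_combination a ^ 2 * f θ * (v.trace 0 (circlePt a θ) * tangentVec θ 0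
            + v.trace 1 (circlePt a θ) * tangentVec θ 1) * hr
  simp only [Finset.sum_add_distrib, Finset.sum_sub_distrib, h1, hb, hA] at h
  simpa using h

lemma grad_bound (hG : IsTangentialField G f) (ha : 0 < a) (hab : a < b) (v : X1 a b)
    {η : ℝ → ℝ} (hη : ContDiffOn ℝ ∞ η (Ioi 0)) :
    (∑ i, ∑ j, ∫ x in annulus a b, v.grad i j x * (coord j x * (G i x * η (normSqr x)))) ^ 2
      ≤ E1 v v * ((∫ r in a..b, (r * η (r ^ 2)) ^ 2 * r)
        * ∫ θ in (0 : ℝ)..2 * Real.pi, f θ ^ 2) := by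
  have sη := SmoothOff.comp_normSqr hη
  have sφ : ∀ i j, SmoothOff (fun y => coord j y * (G i y * η (normSqr y))) := fun i j =>
    (contDiff_coord j).contDiffOn.mul ((hG.smooth i).mul sη)
  have hCS := sq_sum_integral_mul_le (μ := volume.restrict (annulus a b))
    (Finset.univ ×ˢ Finset.univ : Finset (Fin 2 × Fin 2))
    (f := fun k => v.grad k.1 k.2) (g := fun k x => coord k.2 x * (G k.1 x * η (normSqr x)))
    (fun k _ => v.grad_memLp k.1 k.2)
    fun k _ => memLp_of_continuousOn ha (sφ k.1 k.2).continuousOn 2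
  simp only [Finset.sum_product] at hCS
  refine hCS.trans (mul_le_mul ?_ ?_ ?_ (v.E1_nonneg (ha.trans hab)))
  · refine le_trans (le_of_eq ?_) (v.integral_grad_le_E1 (ha.trans hab))
    rw [integral_finsetSum _ fun i _ => integrable_finsetSum _ fun j _ =>
      integrable_mul_of_memLp (v.grad_memLp i j) (v.grad_memLp i j)]
    refine Finset.sum_congr rfl fun i _ => ?_
    rw [integral_finsetSum _ fun j _ =>
      integrable_mul_of_memLp (v.grad_memLp i j) (v.grad_memLp i j)]
    simp only [sq]
  · have h1 : ∀ s ∈ Ioi (0 : ℝ), √s ^ 2 = s := fun s hs => Real.sq_sqrt (le_of_lt hs)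
    -- Summing over `j` produces `|x|²`, which is absorbed in the radial factor as `(√s η(s))²`.
    have h2 := hG.integral_sq ha hab (F := fun s => √s * η s)
      ((contDiffOn_id.sqrt fun s hs => ne_of_gt hs).mul hη)
    have h3 : ∫ r in a..b, (√(r ^ 2) * η (r ^ 2)) ^ 2 * r = ∫ r in a..b, (r * η (r ^ 2)) ^ 2 * r :=
      intervalIntegral.integral_congr fun r hr => by
        have hr0 : 0 < r := uIcc_subset_Ioi ha hab hr
        simp only [Real.sqrt_sq hr0.le]
    rw [h3] at h2
    rw [← h2]
    refine le_of_eq (Finset.sum_congr rfl fun i _ => ?_)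
    have hI : ∀ j, Integrable (fun x => (coord j x * (G i x * η (normSqr x))) ^ 2)
        (volume.restrict (annulus a b)) := fun j =>
      (memLp_of_continuousOn ha (sφ i j).continuousOn 2).integrable_sq
    rw [← integral_finsetSum _ fun j _ => hI j]
    refine setIntegral_congr_fun (measurableSet_annulus a b) fun x hx => ?_
    have hx0 : x ≠ 0 := closedAnnulus_subset ha (annulus_subset_closedAnnulus a b hx)
    have hs : normSqr x = coord 0 x ^ 2 + coord 1 x ^ 2 := rfl
    have h4 := h1 (normSqr x) (normSqr_pos hx0)
    simp only [Fin.sum_univ_two]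
    linear_combination -(G i x * η (normSqr x)) ^ 2 * (h4 + hs)
  · exact Finset.sum_nonneg fun i _ => Finset.sum_nonneg fun j _ =>
      integral_nonneg fun x => sq_nonneg _

lemma vel_bound (hG : IsTangentialField G f) (ha : 0 < a) (hab : a < b) (v : X1 a b)
    {ζ : ℝ → ℝ} (hζ : ContDiffOn ℝ ∞ ζ (Ioi 0)) :
    (∑ i, ∫ x in annulus a b, v.vel i x * (G i x * ζ (normSqr x))) ^ 2
      ≤ E3 v v * ((∫ r in a..b, ζ (r ^ 2) ^ 2 * r) * ∫ θ in (0 : ℝ)..2 * Real.pi, f θ ^ 2) := by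
  have sφ : ∀ i, SmoothOff (fun y => G i y * ζ (normSqr y)) := fun i =>
    (hG.smooth i).mul (SmoothOff.comp_normSqr hζ)
  have hCS := sq_sum_integral_mul_le (μ := volume.restrict (annulus a b)) Finset.univ
    (f := fun i => v.vel i) (g := fun i x => G i x * ζ (normSqr x))
    (fun i _ => v.vel_memLp i) fun i _ => memLp_of_continuousOn ha (sφ i).continuousOn 2
  rw [hG.integral_sq ha hab hζ] at hCS
  refine hCS.trans (le_of_eq ?_)
  congr 1
  rw [E3, integral_finsetSum _ fun i _ => integrable_mul_of_memLp (v.vel_memLp i) (v.vel_memLp i)]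
  simp only [sq]

end IsTangentialField

/-! ### Cutoffs concentrating at the inner circle -/

/-- The cutoff `((b² - s) / (b² - a²)) ^ m`. -/
def cutoff (a b : ℝ) (m : ℕ) (s : ℝ) : ℝ := ((b ^ 2 - s) / (b ^ 2 - a ^ 2)) ^ m

/-- The derivative of `cutoff`. -/
def cutoffDeriv (a b : ℝ) (m : ℕ) (s : ℝ) : ℝ :=
  m * ((b ^ 2 - s) / (b ^ 2 - a ^ 2)) ^ (m - 1) * (-1 / (b ^ 2 - a ^ 2))

lemma contDiff_cutoff (a b : ℝ) (m : ℕ) : ContDiff ℝ ∞ (cutoff a b m) := by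
  unfold cutoff; fun_prop

lemma contDiff_cutoffDeriv (a b : ℝ) (m : ℕ) : ContDiff ℝ ∞ (cutoffDeriv a b m) := by
  unfold cutoffDeriv; fun_prop

lemma hasDerivAt_cutoff (a b : ℝ) (m : ℕ) (s : ℝ) :
    HasDerivAt (cutoff a b m) (cutoffDeriv a b m s) s :=
  (((hasDerivAt_id' s).const_sub (b ^ 2)).div_const (b ^ 2 - a ^ 2)).fun_pow m

/-- For `r > a` the base of the power is less than one, so dominated convergence applies. This
integral multiplies `E₁` in `grad_bound`; hence the gradient term in the boundary formula can be
made as small as desired. -/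
lemma tendsto_integral_cutoff {a b : ℝ} (ha : 0 < a) (hab : a < b) :
    Tendsto (fun m => ∫ r in a..b, (r * cutoff a b m (r ^ 2)) ^ 2 * r) atTop (𝓝 0) := by
  have hd : 0 < b ^ 2 - a ^ 2 := by nlinarith
  have hq : ∀ r ∈ Ioc a b, 0 ≤ (b ^ 2 - r ^ 2) / (b ^ 2 - a ^ 2)
      ∧ (b ^ 2 - r ^ 2) / (b ^ 2 - a ^ 2) < 1 := fun r hr => by
    have h1 : a ^ 2 < r ^ 2 := by nlinarith [hr.1]
    have h2 : r ^ 2 ≤ b ^ 2 := by nlinarith [hr.2, ha.trans hr.1]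
    exact ⟨div_nonneg (by linarith) hd.le, (div_lt_one hd).2 (by linarith)⟩
  have h0 : (0 : ℝ) = ∫ r in a..b, (0 : ℝ) := by simp
  rw [h0]
  refine intervalIntegral.tendsto_integral_filter_of_dominated_convergence (fun _ => b ^ 3)
    (Eventually.of_forall fun m => ?_) (Eventually.of_forall fun m => ?_) (by simp) ?_
  · have hc := (contDiff_cutoff a b m).continuous
    exact Continuous.aestronglyMeasurable (by fun_prop)
  · refine Eventually.of_forall fun r hr => ?_
    rw [uIoc_of_le hab.le] at hr
    obtain ⟨h1, h2⟩ := hq r hr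
    have hr0 := ha.trans hr.1
    have h3 : cutoff a b m (r ^ 2) ≤ 1 := pow_le_one₀ h1 h2.le
    have h4 : 0 ≤ cutoff a b m (r ^ 2) := pow_nonneg h1 m
    rw [Real.norm_of_nonneg (by positivity)]
    have h5 : r * cutoff a b m (r ^ 2) ≤ b := by nlinarith [hr.2]
    have h6 : (r * cutoff a b m (r ^ 2)) ^ 2 ≤ b ^ 2 := pow_le_pow_left₀ (by positivity) h5 2
    calc _ ≤ b ^ 2 * b := mul_le_mul h6 hr.2 hr0.le (by positivity)
      _ = b ^ 3 := by ring
  · refine Eventually.of_forall fun r hr => ?_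
    rw [uIoc_of_le hab.le] at hr
    obtain ⟨h1, h2⟩ := hq r hr
    have h3 : Tendsto (fun m => cutoff a b m (r ^ 2)) atTop (𝓝 0) :=
      tendsto_pow_atTop_nhds_zero_of_lt_one h1 h2
    have h4 := ((h3.const_mul r).pow 2).mul_const r
    simpa using h4

/-! ### Fourier series of the boundary values -/

/-- The function `∑ₖ Re (cₖ (z / |z|) ^ (k + 1))`, shifted to start at order one. -/
def rayTrig (c : ℕ → ℂ) (N : ℕ) (x : ℝ × ℝ) : ℝ :=
  ∑ k ∈ Finset.range N, harmonicPoly (c (k + 1)) (k + 1) x / √(normSqr x) ^ (k + 1)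

/-- The trigonometric polynomial `∑ₖ Re (cₖ exp (i (k + 1) θ))`. -/
def trigPoly (c : ℕ → ℂ) (N : ℕ) (θ : ℝ) : ℝ :=
  ∑ k ∈ Finset.range N, modeAngular (c (k + 1)) (k + 1) θ

lemma smoothOff_sqrt : SmoothOff (fun x => √(normSqr x)) :=
  SmoothOff.comp_normSqr (contDiffOn_id.sqrt fun _ hs => ne_of_gt hs)

lemma sqrt_normSqr_ne_zero {x : ℝ × ℝ} (hx : x ≠ 0) : √(normSqr x) ≠ 0 :=
  (Real.sqrt_pos.2 (normSqr_pos hx)).ne'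

lemma smoothOff_rayTrig (c : ℕ → ℂ) (N : ℕ) : SmoothOff (rayTrig c N) :=
  ContDiffOn.sum fun _ _ => (smoothOff_harmonicPoly _ _).div (smoothOff_sqrt.pow _)
    fun _ hx => pow_ne_zero _ (sqrt_normSqr_ne_zero hx)

lemma rayTrig_circlePt (c : ℕ → ℂ) (N : ℕ) {r : ℝ} (hr : 0 < r) (θ : ℝ) :
    rayTrig c N (circlePt r θ) = trigPoly c N θ := by
  refine Finset.sum_congr rfl fun k _ => ?_
  rw [harmonicPoly_circlePt, normSqr_circlePt, Real.sqrt_sq hr.le]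
  field_simp

/-- The rotation of the position vector. -/
def rotCoord : Fin 2 → ℝ × ℝ → ℝ := ![fun x => -x.2, fun x => x.1]

lemma smoothOff_rotCoord (i : Fin 2) : SmoothOff (rotCoord i) := by
  fin_cases i
  · exact contDiff_snd.neg.contDiffOn
  · exact contDiff_fst.contDiffOn

lemma rotCoord_circlePt (i : Fin 2) (r θ : ℝ) :
    rotCoord i (circlePt r θ) = r * tangentVec θ i := by
  fin_cases i <;> simp [rotCoord, circlePt, tangentVec]

lemma IsTangentialField.of_ray {Y : ℝ × ℝ → ℝ} {f : ℝ → ℝ} (hY : SmoothOff Y)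
    (hf : ∀ r θ, 0 < r → Y (circlePt r θ) = f θ) :
    IsTangentialField (fun i x => rotCoord i x / √(normSqr x) * Y x) f where
  smooth i := ((smoothOff_rotCoord i).div smoothOff_sqrt fun _ hx => sqrt_normSqr_ne_zero hx).mul hY
  eq i r θ hr := by
    rw [hf r θ hr, rotCoord_circlePt, normSqr_circlePt, Real.sqrt_sq hr.le]
    field_simp

/-- The fields of `X₁` have no circulation along the inner circle. -/
lemma X1.integral_tangential_eq_zero {a b : ℝ} (ha : 0 < a) (hab : a < b) (v : X1 a b) :
    ∫ θ in (0 : ℝ)..2 * Real.pi, tangential v.trace a θ = 0 := by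
  have hd : b ^ 2 - a ^ 2 ≠ 0 := by nlinarith
  have hG := IsTangentialField.of_ray (Y := fun _ => 1) (f := fun _ => 1) contDiffOn_const
    fun _ _ _ => rfl
  set G : Fin 2 → ℝ × ℝ → ℝ := fun i x => rotCoord i x / √(normSqr x) * 1 with hGdef
  -- For `f = 1` the velocity term is, circle by circle, a multiple of the circulation, so it
  -- vanishes for every cutoff.
  have hvel : ∀ m, ∑ i, ∫ x in annulus a b, v.vel i x *
      (G i x * (2 * cutoff a b m (normSqr x) + 2 * normSqr x * cutoffDeriv a b m (normSqr x)))
      = 0 := fun m => by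
    set ζ : ℝ → ℝ := fun s => 2 * cutoff a b m s + 2 * s * cutoffDeriv a b m s with hζ
    have sζ : ContDiffOn ℝ ∞ ζ (Ioi 0) :=
      ((contDiff_const.mul (contDiff_cutoff a b m)).add
        ((contDiff_const.mul contDiff_id).mul (contDiff_cutoffDeriv a b m))).contDiffOn
    have hI : ∀ i, Integrable (fun x => v.vel i x * (G i x * ζ (normSqr x)))
        (volume.restrict (annulus a b)) := fun i =>
      integrable_mul_of_continuousOn ha (v.vel_memLp i)
        ((hG.smooth i).mul (SmoothOff.comp_normSqr sζ)).continuousOn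
    change ∑ i, ∫ x in annulus a b, v.vel i x * (G i x * ζ (normSqr x)) = 0
    rw [← integral_finsetSum _ fun i _ => hI i,
      integral_annulus ha hab (integrable_finsetSum _ fun i _ => hI i)]
    refine (integral_congr_ae (g := fun _ => (0 : ℝ)) ?_).trans (by simp)
    filter_upwards [v.average_eq_zero, ae_restrict_mem measurableSet_Ioo] with r hr hmem
    have h1 : ∀ θ, (∑ i, v.vel i (circlePt r θ)
        * (G i (circlePt r θ) * ζ (normSqr (circlePt r θ)))) * r
        = ζ (r ^ 2) * (tangential v.vel r θ * r) := fun θ => by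
      simp only [hG.eq _ r θ (ha.trans hmem.1), normSqr_circlePt, tangential, Fin.sum_univ_two]
      ring
    unfold arcInt at hr ⊢
    simp only [h1, intervalIntegral.integral_const_mul, hr, mul_zero]
  -- The exponent is `m + 1` because the cutoff of exponent zero is identically one and does not
  -- vanish at `b`.
  have hbound : ∀ m, (a ^ 2 * ∫ θ in (0 : ℝ)..2 * Real.pi, tangential v.trace a θ) ^ 2
      ≤ E1 v v * ((∫ r in a..b, (r * cutoff a b (m + 1) (r ^ 2)) ^ 2 * r) * (2 * Real.pi)) :=
    fun m => by
    have h1 := hG.boundary_formula ha hab v (η := cutoff a b (m + 1))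
      (η' := cutoffDeriv a b (m + 1)) (contDiff_cutoff a b (m + 1)).contDiffOn
      (fun s _ => hasDerivAt_cutoff a b (m + 1) s) (by simp [cutoff, div_self hd])
      (by simp [cutoff])
    have h2 := hG.grad_bound ha hab v (contDiff_cutoff a b (m + 1)).contDiffOn
    rw [hvel (m + 1), zero_add] at h1
    rw [h1] at h2
    simpa using h2
  have hlim := ((((tendsto_integral_cutoff ha hab).comp (tendsto_add_atTop_nat 1)).mul_const
    (2 * Real.pi)).const_mul (E1 v v))
  rw [zero_mul, mul_zero] at hlim
  have h0 := ge_of_tendsto' hlim hbound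
  have h1 : a ^ 2 * ∫ θ in (0 : ℝ)..2 * Real.pi, tangential v.trace a θ = 0 :=
    pow_eq_zero_iff (two_ne_zero) |>.1 (le_antisymm h0 (sq_nonneg _))
  exact (mul_eq_zero.1 h1).resolve_left (by positivity)

/-- The Fourier coefficients of the tangential component on the inner circle. -/
def X1.coeff {a b : ℝ} (v : X1 a b) (n : ℕ) : ℂ := fourierC (fun θ => tangential v.trace a θ) n

lemma X1.tangential_intervalIntegrable {a b : ℝ} (v : X1 a b) :
    IntervalIntegrable (fun θ => tangential v.trace a θ) volume 0 (2 * Real.pi) := by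
  rw [intervalIntegrable_iff_integrableOn_Ioc_of_le (by positivity)]
  exact (v.tangential_memLp (by simp)).integrable (by norm_num)

lemma X1.coeff_zero {a b : ℝ} (ha : 0 < a) (hab : a < b) (v : X1 a b) : v.coeff 0 = 0 := by
  have h := v.integral_tangential_eq_zero ha hab
  have h1 : ∫ θ in (0 : ℝ)..2 * Real.pi, (tangential v.trace a θ : ℂ) = 0 := by
    rw [intervalIntegral.integral_ofReal, h]; simp
  simp [X1.coeff, fourierC, h1]

lemma fourierCoeffOn_eq_fourierC (g : ℝ → ℝ) (n : ℤ) :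
    fourierCoeffOn (a := 0) (b := 2 * Real.pi) (by positivity) (fun θ => (g θ : ℂ)) n
      = fourierC g n := by
  rw [fourierCoeffOn_eq_integral, fourierC, sub_zero, Complex.real_smul]
  congr 1
  · push_cast; ring
  · refine intervalIntegral.integral_congr fun θ _ => ?_
    simp only [fourier_coe_apply, smul_eq_mul]
    congr 2
    have : (Real.pi : ℂ) ≠ 0 := by exact_mod_cast Real.pi_ne_zero
    push_cast
    field_simp

/-- For a real function the coefficients of opposite order are conjugate. -/
lemma norm_fourierC_neg (g : ℝ → ℝ) (n : ℤ) : ‖fourierC g (-n)‖ = ‖fourierC g n‖ := by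
  have h : fourierC g (-n) = (starRingEnd ℂ) (fourierC g n) := by
    rw [fourierC, fourierC, map_mul, intervalIntegral.integral_of_le (by positivity),
      intervalIntegral.integral_of_le (by positivity), ← integral_conj]
    congr 1
    · simp [Complex.conj_ofNat]
    · refine integral_congr_ae (Eventually.of_forall fun θ => ?_)
      simp [← Complex.exp_conj]
  rw [h, Complex.norm_conj]

/-- Parseval's identity for the boundary values. -/
theorem X1.hasSum_coeff {a b : ℝ} (ha : 0 < a) (hab : a < b) (v : X1 a b) :
    HasSum (fun k : ℕ => 4 * Real.pi * a * ‖v.coeff (k + 1)‖ ^ 2) (E2 v v) := by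
  set g : ℝ → ℝ := fun θ => tangential v.trace a θ with hg
  have hL : MemLp (fun θ => (g θ : ℂ)) 2 (volume.restrict (Ioc 0 (2 * Real.pi))) :=
    (v.tangential_memLp (by simp)).ofReal
  have h := hasSum_sq_fourierCoeffOn (a := 0) (b := 2 * Real.pi) (by positivity) hL
  simp only [fourierCoeffOn_eq_fourierC, Complex.norm_real, Real.norm_eq_abs, sq_abs, sub_zero,
    smul_eq_mul] at h
  -- Folding the sum over `ℤ` onto `ℕ` pairs `n` with `-n` and counts order zero twice; that
  -- coefficient is zero because there is no circulation. The pairing accounts for `4π` instead of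
  -- `2π`.
  have h1 := h.nat_add_neg
  have h0 : fourierC g 0 = 0 := v.coeff_zero ha hab
  simp only [norm_fourierC_neg, h0, norm_zero] at h1
  have h2 := (hasSum_nat_add_iff' 1).2 h1
  simp only [Finset.range_one, Finset.sum_singleton, Nat.cast_zero, h0, norm_zero] at h2
  have h3 := h2.mul_left (2 * Real.pi * a)
  have hE : E2 v v = 2 * Real.pi * a
      * ((2 * Real.pi)⁻¹ * ∫ θ in (0 : ℝ)..2 * Real.pi, g θ ^ 2) := by
    rw [E2, arcInt, intervalIntegral.integral_mul_const]
    field_simp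
    simp only [sq]
    rfl
  have hfun : (fun k : ℕ => 4 * Real.pi * a * ‖v.coeff (k + 1)‖ ^ 2) = fun k : ℕ =>
      2 * Real.pi * a * (‖fourierC g ↑(k + 1)‖ ^ 2 + ‖fourierC g ↑(k + 1)‖ ^ 2) := by
    funext k
    change 4 * Real.pi * a * ‖fourierC g ↑(k + 1)‖ ^ 2 = _
    ring
  rw [hE, hfun]
  simpa using! h3

/-- The sum of the squares of the coefficients as a boundary integral. -/
lemma X1.integral_mul_trigPoly {a b : ℝ} (v : X1 a b) (N : ℕ) :
    ∫ θ in (0 : ℝ)..2 * Real.pi, tangential v.trace a θ * trigPoly (fun n => 2 * v.coeff n) N θ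
      = ∑ k ∈ Finset.range N, 4 * Real.pi * ‖v.coeff (k + 1)‖ ^ 2 := by
  simp only [trigPoly, Finset.mul_sum]
  rw [intervalIntegral.integral_finsetSum fun k _ =>
    v.tangential_intervalIntegrable.mul_continuousOn (continuous_modeAngular _ _).continuousOn]
  refine Finset.sum_congr rfl fun k _ => ?_
  rw [integral_mul_modeAngular v.tangential_intervalIntegrable]
  change 2 * Real.pi * (2 * v.coeff (k + 1) * (starRingEnd ℂ) (v.coeff (k + 1))).re = _
  rw [mul_assoc (2 : ℂ), Complex.mul_conj, Complex.normSq_eq_norm_sq]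
  have : (2 * ((‖v.coeff (k + 1)‖ ^ 2 : ℝ) : ℂ)).re = 2 * ‖v.coeff (k + 1)‖ ^ 2 := by
    rw [show (2 : ℂ) = ((2 : ℝ) : ℂ) by norm_num, ← Complex.ofReal_mul, Complex.ofReal_re]
  rw [this]
  ring

lemma integral_trigPoly_sq (c : ℕ → ℂ) (N : ℕ) :
    ∫ θ in (0 : ℝ)..2 * Real.pi, trigPoly c N θ ^ 2
      = ∑ k ∈ Finset.range N, Real.pi * ‖c (k + 1)‖ ^ 2 := by
  have hi : ∀ k m, IntervalIntegrable (fun θ => modeAngular (c (k + 1)) (k + 1) θ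
      * modeAngular (c (m + 1)) (m + 1) θ) volume 0 (2 * Real.pi) := fun k m =>
    ((continuous_modeAngular _ _).mul (continuous_modeAngular _ _)).intervalIntegrable _ _
  have h1 : ∀ θ, trigPoly c N θ ^ 2 = ∑ k ∈ Finset.range N, ∑ m ∈ Finset.range N,
      modeAngular (c (k + 1)) (k + 1) θ * modeAngular (c (m + 1)) (m + 1) θ := fun θ => by
    rw [trigPoly, sq, Finset.sum_mul_sum]
  simp only [h1]
  have h0 : ∀ k, IntervalIntegrable (fun θ => ∑ m ∈ Finset.range N,
      modeAngular (c (k + 1)) (k + 1) θ * modeAngular (c (m + 1)) (m + 1) θ) volume 0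
      (2 * Real.pi) := fun k => (continuous_finsetSum _ fun m _ =>
    (continuous_modeAngular _ _).mul (continuous_modeAngular _ _)).intervalIntegrable _ _
  rw [intervalIntegral.integral_finsetSum fun k _ => h0 k]
  refine Finset.sum_congr rfl fun k hk => ?_
  rw [intervalIntegral.integral_finsetSum fun m _ => hi k m]
  have h2 : ∀ m, ∫ θ in (0 : ℝ)..2 * Real.pi, modeAngular (c (k + 1)) (k + 1) θ
      * modeAngular (c (m + 1)) (m + 1) θ = if m = k then Real.pi * ‖c (k + 1)‖ ^ 2 else 0 :=
    fun m => by
      rw [integral_mul_modeAngular ((continuous_modeAngular _ _).intervalIntegrable _ _),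
        fourierC_modeAngular _ (by omega)]
      by_cases h : m = k
      · subst h
        rw [if_pos rfl, if_pos rfl, map_div₀, mul_div_assoc', Complex.mul_conj,
          Complex.normSq_eq_norm_sq, Complex.conj_ofNat]
        rw [show (2 : ℂ) = ((2 : ℝ) : ℂ) by norm_num, ← Complex.ofReal_div, Complex.ofReal_re]
        ring
      · rw [if_neg (by omega), if_neg h]; simp
  simp only [h2, Finset.sum_ite_eq', hk, if_true]

/-- The trace inequality on the inner circle. -/
theorem trace_inequality {a b : ℝ} (ha : 0 < a) (hab : a < b) {ε : ℝ} (hε : 0 < ε) :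
    ∃ C, 0 ≤ C ∧ ∀ v : X1 a b, E2 v v ≤ ε * E1 v v + C * E3 v v := by
  have hd : b ^ 2 - a ^ 2 ≠ 0 := by nlinarith
  have hδ : 0 < ε * a ^ 3 / 2 := by positivity
  -- The bound `ε a³ / 2` is what remains of `ε` after `(P + Q)² ≤ 2 P² + 2 Q²` and division by
  -- `a³`; the condition `m ≥ 1` makes the cutoff vanish at `b`.
  obtain ⟨m, hm, hm0⟩ := (((tendsto_integral_cutoff ha hab).eventually (gt_mem_nhds hδ)).and
    (eventually_ge_atTop 1)).exists
  set η := cutoff a b m with hη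
  set ζ : ℝ → ℝ := fun s => 2 * η s + 2 * s * cutoffDeriv a b m s with hζ
  have sζ : ContDiffOn ℝ ∞ ζ (Ioi 0) :=
    ((contDiff_const.mul (contDiff_cutoff a b m)).add
      ((contDiff_const.mul contDiff_id).mul (contDiff_cutoffDeriv a b m))).contDiffOn
  set K := ∫ r in a..b, ζ (r ^ 2) ^ 2 * r with hK
  have hK0 : 0 ≤ K := intervalIntegral.integral_nonneg hab.le fun r hr =>
    mul_nonneg (sq_nonneg _) (ha.le.trans hr.1)
  refine ⟨2 * K / a ^ 3, by positivity, fun v => ?_⟩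
  have hE1 := v.E1_nonneg (ha.trans hab)
  have hE3 := v.E3_nonneg
  -- It suffices to bound the partial sums of Parseval's series, uniformly in `N`. The boundary
  -- formula is tested with the truncated Fourier series of the trace itself, whose squared norm is
  -- again the partial sum `S`.
  refine le_of_tendsto' (v.hasSum_coeff ha hab).tendsto_sum_nat fun N => ?_
  set S := ∑ k ∈ Finset.range N, 4 * Real.pi * ‖v.coeff (k + 1)‖ ^ 2 with hS
  have hS0 : 0 ≤ S := Finset.sum_nonneg fun k _ => by positivity
  have hsum : ∑ k ∈ Finset.range N, 4 * Real.pi * a * ‖v.coeff (k + 1)‖ ^ 2 = a * S := by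
    rw [hS, Finset.mul_sum]; exact Finset.sum_congr rfl fun k _ => by ring
  have hG := IsTangentialField.of_ray (smoothOff_rayTrig (fun n => 2 * v.coeff n) N)
    (f := trigPoly (fun n => 2 * v.coeff n) N) fun r θ hr => rayTrig_circlePt _ N hr θ
  have hN : ∫ θ in (0 : ℝ)..2 * Real.pi, trigPoly (fun n => 2 * v.coeff n) N θ ^ 2 = S := by
    rw [integral_trigPoly_sq, hS]
    refine Finset.sum_congr rfl fun k _ => ?_
    rw [norm_mul]
    norm_num
    ring
  have h1 := hG.boundary_formula ha hab v (η := η) (η' := cutoffDeriv a b m)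
    (contDiff_cutoff a b m).contDiffOn (fun s _ => hasDerivAt_cutoff a b m s)
    (by simp [hη, cutoff, div_self hd]) (by simp [hη, cutoff]; omega)
  have h2 := hG.grad_bound ha hab v (η := η) (contDiff_cutoff a b m).contDiffOn
  have h3 := hG.vel_bound ha hab v sζ
  rw [hN] at h2 h3
  rw [v.integral_mul_trigPoly, ← hS] at h1
  rw [hsum]
  set P := ∑ i, ∫ x in annulus a b, v.vel i x * (rotCoord i x / √(normSqr x)
    * rayTrig (fun n => 2 * v.coeff n) N x * ζ (normSqr x)) with hP
  set Q := ∑ i, ∑ j, ∫ x in annulus a b, v.grad i j x * (coord j x * (rotCoord i x / √(normSqr x)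
    * rayTrig (fun n => 2 * v.coeff n) N x * η (normSqr x))) with hQ
  have h1' : P + Q = -(a ^ 2 * S) := h1
  set L := ∫ r in a..b, (r * η (r ^ 2)) ^ 2 * r with hLd
  have h4 : (a ^ 2 * S) ^ 2 ≤ 2 * (E3 v v * (K * S)) + 2 * (E1 v v * (L * S)) := by
    have : a ^ 2 * S = -(P + Q) := by linarith
    rw [this]
    nlinarith [sq_nonneg (P - Q)]
  have hL : L ≤ ε * a ^ 3 / 2 := hm.le
  -- The estimate is quadratic in `S` on the left and linear on the right, so one factor `S` can be
  -- cancelled when it is positive.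
  rcases hS0.eq_or_lt with h0 | hSpos
  · rw [← h0, mul_zero]
    positivity
  · have h5 : a ^ 4 * S ≤ 2 * (E3 v v * K) + 2 * (E1 v v * L) := by
      have : (a ^ 4 * S) * S ≤ (2 * (E3 v v * K) + 2 * (E1 v v * L)) * S := by
        calc _ = (a ^ 2 * S) ^ 2 := by ring
          _ ≤ _ := h4
          _ = _ := by ring
      exact le_of_mul_le_mul_right this hSpos
    have h6 : E1 v v * L ≤ E1 v v * (ε * a ^ 3 / 2) := mul_le_mul_of_nonneg_left hL hE1
    have ha3 : 0 < a ^ 3 := by positivity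
    refine le_of_mul_le_mul_left ?_ ha3
    calc a ^ 3 * (a * S) = a ^ 4 * S := by ring
      _ ≤ 2 * (E3 v v * K) + 2 * (E1 v v * (ε * a ^ 3 / 2)) := by linarith
      _ = a ^ 3 * (ε * E1 v v + 2 * K / a ^ 3 * E3 v v) := by field_simp; ring

/-! ### Spectral inequalities for `E₁` with respect to `E₂` -/

lemma X1.coeff_combo {a b : ℝ} (ha : 0 < a) (u w : X1 a b) (c : ℝ) (n : ℕ) :
    (u.combo ha c w).coeff n = u.coeff n + c * w.coeff n := by
  have hi : ∀ v : X1 a b, IntervalIntegrable (fun θ : ℝ =>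
      Complex.exp (-((n : ℤ) * θ * Complex.I)) * (tangential v.trace a θ : ℂ)) volume 0
      (2 * Real.pi) := fun v => by
    have h := v.tangential_intervalIntegrable
    have h' : IntervalIntegrable (fun θ => (tangential v.trace a θ : ℂ)) volume 0 (2 * Real.pi) :=
      ⟨h.1.ofReal, h.2.ofReal⟩
    exact h'.continuousOn_mul (Continuous.continuousOn (by fun_prop))
  have h1 : ∀ θ : ℝ, Complex.exp (-((n : ℤ) * θ * Complex.I))
      * (tangential (u.combo ha c w).trace a θ : ℂ)
      = Complex.exp (-((n : ℤ) * θ * Complex.I)) * (tangential u.trace a θ : ℂ)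
        + c * (Complex.exp (-((n : ℤ) * θ * Complex.I)) * (tangential w.trace a θ : ℂ)) :=
    fun θ => by
    rw [X1.tangential_combo]
    push_cast
    ring
  simp only [X1.coeff, fourierC, h1]
  rw [intervalIntegral.integral_add (hi u) ((hi w).const_mul _),
    intervalIntegral.integral_const_mul]
  ring

lemma coeff_modeField {a b : ℝ} (ha : 0 < a) (hab : a < b) {n : ℕ} (hn : 1 ≤ n) (c : ℂ) (m : ℕ) :
    (modeField ha hab hn c).coeff m = if m = n then profileD1 a b n a * c / 2 else 0 := by
  have h : ∀ θ, tangential (modeField ha hab hn c).trace a θ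
      = modeAngular (profileD1 a b n a * c) n θ := fun θ => by
    rw [tangential_modeField ha hab hn c ha, modeAngular, modeAngular, ← Complex.re_ofReal_mul,
      ← mul_assoc]
  simp only [X1.coeff, h]
  exact fourierC_modeAngular _ hn m

lemma E2_modeField {a b : ℝ} (ha : 0 < a) (hab : a < b) {n : ℕ} (hn : 1 ≤ n) (c : ℂ) (v : X1 a b) :
    E2 v (modeField ha hab hn c)
      = 2 * Real.pi * a * profileD1 a b n a * (c * (starRingEnd ℂ) (v.coeff n)).re := by
  have h : ∀ θ, tangential v.trace a θ * tangential (modeField ha hab hn c).trace a θ * a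
      = a * profileD1 a b n a * (tangential v.trace a θ * modeAngular c n θ) := fun θ => by
    rw [tangential_modeField ha hab hn c ha]
    ring
  simp only [E2, arcInt, h]
  rw [intervalIntegral.integral_const_mul, integral_mul_modeAngular v.tangential_intervalIntegrable]
  change _ * (_ * (c * (starRingEnd ℂ) (v.coeff n)).re) = _
  ring

/-- The part of order `n` of the boundary values, extended by the fields of the Fourier mode. -/
def modePart {a b : ℝ} (ha : 0 < a) (hab : a < b) {n : ℕ} (hn : 1 ≤ n) (v : X1 a b) : X1 a b :=
  modeField ha hab hn (2 * v.coeff n / profileD1 a b n a)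

/-- A mode field with constant `c` has coefficient `Φ'(a) c / 2` on the inner circle, so the
constant `2 vₙ / Φ'(a)` in `modePart` reproduces the coefficient `vₙ` of `v`. -/
lemma coeff_modePart {a b : ℝ} (ha : 0 < a) (hab : a < b) {n : ℕ} (hn : 1 ≤ n) (v : X1 a b)
    (m : ℕ) : (modePart ha hab hn v).coeff m = if m = n then v.coeff n else 0 := by
  have hd : (profileD1 a b n a : ℂ) ≠ 0 := by exact_mod_cast (profileD1_left_pos hn ha hab).ne'
  rw [modePart, coeff_modeField]
  congr 1
  field_simp

lemma E2_modePart {a b : ℝ} (ha : 0 < a) (hab : a < b) {n : ℕ} (hn : 1 ≤ n) (u v : X1 a b) :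
    E2 u (modePart ha hab hn v)
      = 4 * Real.pi * a * (v.coeff n * (starRingEnd ℂ) (u.coeff n)).re := by
  have hd := (profileD1_left_pos hn ha hab).ne'
  rw [modePart, E2_modeField]
  have h : 2 * v.coeff n / profileD1 a b n a * (starRingEnd ℂ) (u.coeff n)
      = ((2 / profileD1 a b n a : ℝ) : ℂ) * (v.coeff n * (starRingEnd ℂ) (u.coeff n)) := by
    push_cast; ring
  rw [h, Complex.re_ofReal_mul]
  field_simp
  ring

lemma E2_modePart_self {a b : ℝ} (ha : 0 < a) (hab : a < b) {n : ℕ} (hn : 1 ≤ n) (v : X1 a b) :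
    E2 v (modePart ha hab hn v) = 4 * Real.pi * a * ‖v.coeff n‖ ^ 2 := by
  rw [E2_modePart, Complex.mul_conj, Complex.normSq_eq_norm_sq, Complex.ofReal_re]

lemma E2_modePart_modePart {a b : ℝ} (ha : 0 < a) (hab : a < b) {n : ℕ} (hn : 1 ≤ n)
    (v : X1 a b) : E2 (modePart ha hab hn v) (modePart ha hab hn v)
      = 4 * Real.pi * a * ‖v.coeff n‖ ^ 2 := by
  rw [E2_modePart, coeff_modePart, if_pos rfl, Complex.mul_conj, Complex.normSq_eq_norm_sq,
    Complex.ofReal_re]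

lemma E1_modePart {a b : ℝ} (ha : 0 < a) (hab : a < b) {n : ℕ} (hn : 1 ≤ n) (u v : X1 a b) :
    E1 u (modePart ha hab hn v) = kappa a b n * E2 u (modePart ha hab hn v) :=
  E1_modeField ha hab hn _ u

/-- The remainder after removing a Fourier mode. -/
def modeRest {a b : ℝ} (ha : 0 < a) (hab : a < b) {n : ℕ} (hn : 1 ≤ n) (v : X1 a b) : X1 a b :=
  v.combo ha (-1) (modePart ha hab hn v)

lemma coeff_modeRest {a b : ℝ} (ha : 0 < a) (hab : a < b) {n : ℕ} (hn : 1 ≤ n) (v : X1 a b)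
    (m : ℕ) : (modeRest ha hab hn v).coeff m = if m = n then 0 else v.coeff m := by
  rw [modeRest, X1.coeff_combo, coeff_modePart]
  split_ifs with h
  · subst h; push_cast; ring
  · push_cast; ring

/-- Since `E₁` against a mode field is `κₙ E₂`, which sees only the coefficient of order `n`,
removing the mode is an orthogonal projection for `E₁` too. -/
lemma E1_modeRest {a b : ℝ} (ha : 0 < a) (hab : a < b) {n : ℕ} (hn : 1 ≤ n) (v : X1 a b) :
    E1 (modeRest ha hab hn v) (modeRest ha hab hn v)
      = E1 v v - kappa a b n * (4 * Real.pi * a * ‖v.coeff n‖ ^ 2) := by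
  rw [modeRest, X1.E1_combo_self, E1_modePart, E1_modePart, E2_modePart_self,
    E2_modePart_modePart]
  ring

/-- Bessel's inequality for the modes. -/
theorem sum_kappa_mul_le_E1 {a b : ℝ} (ha : 0 < a) (hab : a < b) (N : ℕ) (v : X1 a b) :
    ∑ k ∈ Finset.range N, kappa a b (k + 1) * (4 * Real.pi * a * ‖v.coeff (k + 1)‖ ^ 2)
      ≤ E1 v v := by
  induction N generalizing v with
  | zero => simpa using v.E1_nonneg (ha.trans hab)
  | succ N ih =>
    -- The highest mode, of order `N + 1`, is removed; the lower coefficients are unchanged and the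
    -- induction hypothesis applies to the remainder.
    have h := ih (modeRest ha hab (Nat.le_add_left 1 N) v)
    rw [E1_modeRest] at h
    rw [Finset.sum_range_succ]
    have hs : ∑ k ∈ Finset.range N, kappa a b (k + 1)
        * (4 * Real.pi * a * ‖(modeRest ha hab (Nat.le_add_left 1 N) v).coeff (k + 1)‖ ^ 2)
        = ∑ k ∈ Finset.range N, kappa a b (k + 1) * (4 * Real.pi * a * ‖v.coeff (k + 1)‖ ^ 2) :=
      Finset.sum_congr rfl fun k hk => by
        have := Finset.mem_range.1 hk
        rw [coeff_modeRest, if_neg (by omega)]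
    linarith

lemma kappa_lt {a b : ℝ} (ha : 0 < a) (hab : a < b) {n : ℕ} (hn : 1 ≤ n) :
    kappa a b n < kappa a b (n + 1) :=
  div_lt_div_of_pos_right (by linarith [gammaVal_lt hn ha hab]) ha

lemma kappa_pos {a b : ℝ} (ha : 0 < a) (hab : a < b) {n : ℕ} (hn : 1 ≤ n) : 0 < kappa a b n :=
  div_pos (by linarith [gammaVal_pos hn ha hab]) ha

lemma kappa_le {a b : ℝ} (ha : 0 < a) (hab : a < b) {m n : ℕ} (hm : 1 ≤ m) (hmn : m ≤ n) :
    kappa a b m ≤ kappa a b n := by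
  induction n, hmn using Nat.le_induction with
  | base => exact le_rfl
  | succ n h ih => exact ih.trans (kappa_lt ha hab (hm.trans h)).le

/-- If the Fourier coefficients of order less than `m` of the boundary values vanish, then
`E₁ ≥ κₘ E₂`. -/
theorem kappa_mul_E2_le_E1 {a b : ℝ} (ha : 0 < a) (hab : a < b) {m : ℕ} (hm : 1 ≤ m)
    (v : X1 a b) (hv : ∀ n, 1 ≤ n → n < m → v.coeff n = 0) : kappa a b m * E2 v v ≤ E1 v v := by
  refine le_of_tendsto' ((v.hasSum_coeff ha hab).tendsto_sum_nat.const_mul _) fun N => ?_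
  -- Parseval and Bessel are compared term by term: terms of order below `m` vanish, and for the
  -- others `kappa` is monotone.
  refine le_trans ?_ (sum_kappa_mul_le_E1 ha hab N v)
  rw [Finset.mul_sum]
  refine Finset.sum_le_sum fun k _ => ?_
  rcases lt_or_ge (k + 1) m with h | h
  · rw [hv (k + 1) (by omega) h]; simp
  · exact mul_le_mul_of_nonneg_right (kappa_le ha hab hm h) (by positivity)

lemma E2_modeField_one_pos {a b : ℝ} (ha : 0 < a) (hab : a < b) :
    0 < E2 (modeField ha hab le_rfl 1) (modeField ha hab le_rfl 1) := by
  have hd := profileD1_left_pos le_rfl ha hab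
  rw [E2_modeField, coeff_modeField, if_pos rfl, one_mul, mul_one, Complex.conj_re,
    show (profileD1 a b 1 a : ℂ) / 2 = ((profileD1 a b 1 a / 2 : ℝ) : ℂ) by push_cast; ring,
    Complex.ofReal_re]
  positivity

/-- The infimum of `E₁ / E₂` is attained by the first mode. -/
theorem isLeast_boundaryQuotients {a b : ℝ} (ha : 0 < a) (hab : a < b) :
    IsLeast (boundaryQuotients a b) (kappa a b 1) := by
  have hp := E2_modeField_one_pos ha hab
  refine ⟨⟨modeField ha hab le_rfl 1, hp.ne', ?_⟩, ?_⟩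
  · rw [E1_modeField, mul_div_assoc, div_self hp.ne', mul_one]
  · rintro _ ⟨u, hu, rfl⟩
    rw [le_div_iff₀ ((u.E2_nonneg ha).lt_of_ne' hu)]
    exact kappa_mul_E2_le_E1 ha hab le_rfl u fun n h1 h2 => by omega

theorem mul_gammaInf {a b : ℝ} (ha : 0 < a) (hab : a < b) :
    a * gammaInf a b = gammaMode a b 1 + 1 := by
  rw [gammaInf, (isLeast_boundaryQuotients ha hab).csInf_eq, gammaMode_eq le_rfl ha hab, kappa]
  field_simp

/-! ### The Poincaré inequality -/

/-- `ξ` vanishes on the outer circle and solves `2 ξ + x · ∇ξ = φ`. -/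
structure IsRadialPrimitive (b : ℝ) (φ ξ : ℝ × ℝ → ℝ) : Prop where
  smooth : SmoothOff ξ
  right : ∀ θ, ξ (circlePt b θ) = 0
  euler : ∀ x, x ≠ 0 → 2 * ξ x + ∑ j, coord j x * partialD j ξ x = φ x

lemma sum_coord_mul_partialD_circlePt {ξ : ℝ × ℝ → ℝ} (hξ : SmoothOff ξ) {r θ d : ℝ} (hr : 0 < r)
    (h : HasDerivAt (fun s => ξ (circlePt s θ)) d r) :
    ∑ j, coord j (circlePt r θ) * partialD j ξ (circlePt r θ) = r * d := by
  rw [h.unique (hasDerivAt_circlePt_radius (hξ.differentiableAt (circlePt_ne_zero hr θ))),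
    Finset.mul_sum]
  exact Finset.sum_congr rfl fun j _ => by rw [coord_circlePt]; ring

/-- On functions homogeneous of degree `k` the operator `2 + x · ∇` is multiplication by `k + 2`.
Functions of degree `-2` lie in its kernel, and the multiple of `φ / |x| ^ (k + 2)` subtracted here
makes the result vanish on `|x| = b`. -/
lemma IsRadialPrimitive.of_homogeneous {b : ℝ} (hb : 0 < b) {φ : ℝ × ℝ → ℝ} (hφ : SmoothOff φ)
    {f : ℝ → ℝ} (k : ℕ) (hf : ∀ r θ, 0 < r → φ (circlePt r θ) = r ^ k * f θ) :
    IsRadialPrimitive b φ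
      fun x => (φ x - b ^ (k + 2) * (φ x / √(normSqr x) ^ (k + 2))) / (k + 2) := by
  have hk : (k : ℝ) + 2 ≠ 0 := by positivity
  have hs : SmoothOff fun x => (φ x - b ^ (k + 2) * (φ x / √(normSqr x) ^ (k + 2))) / (k + 2) :=
    (hφ.sub (contDiffOn_const.mul (hφ.div (smoothOff_sqrt.pow _)
      fun _ hx => pow_ne_zero _ (sqrt_normSqr_ne_zero hx)))).div_const _
  have hval : ∀ r θ, 0 < r → (φ (circlePt r θ) - b ^ (k + 2)
      * (φ (circlePt r θ) / √(normSqr (circlePt r θ)) ^ (k + 2))) / (k + 2)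
      = (r ^ k - b ^ (k + 2) * (r ^ 2)⁻¹) * f θ / (k + 2) := fun r θ hr => by
    rw [hf r θ hr, normSqr_circlePt, Real.sqrt_sq hr.le]
    field_simp
    ring
  refine ⟨hs, fun θ => ?_, fun x hx => ?_⟩
  · rw [hval b θ hb]
    field_simp
    ring
  · obtain ⟨r, θ, hr, rfl⟩ := exists_circlePt hx
    have h1 : HasDerivAt (fun r => (r ^ k - b ^ (k + 2) * (r ^ 2)⁻¹) * f θ / (k + 2))
        ((k * r ^ (k - 1) - b ^ (k + 2) * (-(2 * r) / (r ^ 2) ^ 2)) * f θ / (k + 2)) r := by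
      have h2 : HasDerivAt (fun r : ℝ => (r ^ 2)⁻¹) (-(2 * r) / (r ^ 2) ^ 2) r := by
        simpa using! (hasDerivAt_pow 2 r).inv (by positivity)
      exact (((hasDerivAt_pow k r).sub (h2.const_mul _)).mul_const _).div_const _
    have h3 := h1.congr_of_eventuallyEq
      (f₁ := fun r => (φ (circlePt r θ) - b ^ (k + 2)
        * (φ (circlePt r θ) / √(normSqr (circlePt r θ)) ^ (k + 2))) / (k + 2)) (by
        filter_upwards [Ioi_mem_nhds hr] with s hs using hval s θ hs)
    rw [sum_coord_mul_partialD_circlePt hs hr h3, hval r θ hr, hf r θ hr]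
    have hpow : (k : ℝ) * r ^ (k - 1) * r = k * r ^ k := by
      rcases Nat.eq_zero_or_pos k with rfl | h
      · simp
      · rw [mul_assoc, pow_sub_one_mul h.ne']
    have e : r * ((k * r ^ (k - 1) - b ^ (k + 2) * (-(2 * r) / (r ^ 2) ^ 2)) * f θ / (k + 2))
        = (k * r ^ (k - 1) * r + 2 * b ^ (k + 2) * (r ^ 2)⁻¹) * f θ / (k + 2) := by
      field_simp
      ring
    rw [e, hpow]
    field_simp
    ring

lemma IsRadialPrimitive.add {b : ℝ} {φ ψ ξ ζ : ℝ × ℝ → ℝ} (h : IsRadialPrimitive b φ ξ)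
    (h' : IsRadialPrimitive b ψ ζ) :
    IsRadialPrimitive b (fun x => φ x + ψ x) fun x => ξ x + ζ x where
  smooth := h.smooth.add h'.smooth
  right θ := by rw [h.right, h'.right, add_zero]
  euler x hx := by
    rw [← h.euler x hx, ← h'.euler x hx]
    simp only [partialD_add _ (h.smooth.differentiableAt hx) (h'.smooth.differentiableAt hx),
      Fin.sum_univ_two]
    ring

lemma IsRadialPrimitive.const_mul {b : ℝ} {φ ξ : ℝ × ℝ → ℝ} (c : ℝ)
    (h : IsRadialPrimitive b φ ξ) :
    IsRadialPrimitive b (fun x => c * φ x) fun x => c * ξ x where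
  smooth := contDiffOn_const.mul h.smooth
  right θ := by rw [h.right, mul_zero]
  euler x hx := by
    rw [← h.euler x hx]
    simp only [partialD_const_mul _ _ (h.smooth.differentiableAt hx), Fin.sum_univ_two]
    ring

/-- The algebra of polynomial functions on the plane. -/
def planePolynomials : Subalgebra ℝ C(ℝ × ℝ, ℝ) :=
  Algebra.adjoin ℝ {ContinuousMap.fst, ContinuousMap.snd}

lemma separatesPoints_planePolynomials : planePolynomials.SeparatesPoints := by
  intro x y hxy
  by_cases h : x.1 = y.1
  · exact ⟨Prod.snd, ⟨ContinuousMap.snd, Algebra.subset_adjoin (by simp), rfl⟩,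
      fun h2 => hxy (Prod.ext h h2)⟩
  · exact ⟨Prod.fst, ⟨ContinuousMap.fst, Algebra.subset_adjoin (by simp), rfl⟩, h⟩

/-- Polynomials are spanned by monomials, which are homogeneous, and the equation is linear. -/
lemma exists_isRadialPrimitive {b : ℝ} (hb : 0 < b) {p : C(ℝ × ℝ, ℝ)}
    (hp : p ∈ planePolynomials) : SmoothOff p ∧ ∃ ξ, IsRadialPrimitive b p ξ := by
  rw [planePolynomials, ← Subalgebra.mem_toSubmodule, Algebra.adjoin_eq_span] at hp
  induction hp using Submodule.span_induction with
  | mem p hp =>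
    obtain ⟨m, n, rfl⟩ := (Submonoid.mem_closure_pair _ _ _).1 hp
    have hs : SmoothOff (ContinuousMap.fst ^ m * ContinuousMap.snd ^ n : C(ℝ × ℝ, ℝ)) :=
      ((contDiff_fst.pow m).mul (contDiff_snd.pow n)).contDiffOn
    refine ⟨hs, _, IsRadialPrimitive.of_homogeneous hb hs (m + n)
      (f := fun θ => Real.cos θ ^ m * Real.sin θ ^ n) fun r θ _ => ?_⟩
    simp [circlePt]
    ring
  | zero =>
    refine ⟨contDiffOn_const, fun _ => 0, contDiffOn_const, fun _ => rfl, fun x _ => ?_⟩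
    simp [partialD]
  | add p q _ _ hp hq =>
    obtain ⟨hp, ξ, hξ⟩ := hp
    obtain ⟨hq, ζ, hζ⟩ := hq
    exact ⟨hp.add hq, _, hξ.add hζ⟩
  | smul c p _ hp =>
    obtain ⟨hp, ξ, hξ⟩ := hp
    exact ⟨contDiffOn_const.mul hp, _, hξ.const_mul c⟩

lemma partialD_coord_mul {ξ : ℝ × ℝ → ℝ} (hξ : SmoothOff ξ) {x : ℝ × ℝ} (hx : x ≠ 0) (j : Fin 2) :
    partialD j (fun y => coord j y * ξ y) x = ξ x + coord j x * partialD j ξ x := by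
  rw [partialD_mul j ((contDiff_coord j).differentiable (by simp) x) (hξ.differentiableAt hx),
    partialD_coord, if_pos rfl]
  ring

/-- The divergence theorem for the field `f x`. -/
lemma integral_euler {a b : ℝ} (ha : 0 < a) (hab : a < b) {f : ℝ × ℝ → ℝ} (hf : SmoothOff f) :
    ∫ x in annulus a b, (2 * f x + ∑ j, coord j x * partialD j f x)
      = b ^ 2 * (∫ θ in (0 : ℝ)..2 * Real.pi, f (circlePt b θ))
        - a ^ 2 * ∫ θ in (0 : ℝ)..2 * Real.pi, f (circlePt a θ) := by
  have hb := ha.trans hab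
  have sφ : ∀ j, SmoothOff (fun y => coord j y * f y) := fun j =>
    (contDiff_coord j).contDiffOn.mul hf
  have h := Finset.sum_congr (rfl : (Finset.univ : Finset (Fin 2)) = _) fun j _ =>
    integral_partialD ha hab (sφ j) j
  have hbd : ∀ r, 0 < r → ∑ j, arcInt r (fun θ => coord j (circlePt r θ) * f (circlePt r θ)
      * radialVec θ j) = r ^ 2 * ∫ θ in (0 : ℝ)..2 * Real.pi, f (circlePt r θ) := fun r hr => by
    have hi : ∀ j, IntervalIntegrable (fun θ => coord j (circlePt r θ) * f (circlePt r θ)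
        * radialVec θ j) volume 0 (2 * Real.pi) := fun j =>
      (((sφ j).continuous_circle hr).mul (continuous_radialVec j)).intervalIntegrable _ _
    rw [← arcInt_sum _ _ _ fun j _ => hi j, arcInt,
      ← intervalIntegral.integral_const_mul]
    refine intervalIntegral.integral_congr fun θ _ => ?_
    have := sum_radialVec_mul_self θ
    simp only [coord_circlePt, Fin.sum_univ_two] at this ⊢
    linear_combination r ^ 2 * f (circlePt r θ) * this
  rw [← integral_finsetSum _ fun j _ => integrable_of_continuousOn ha
    ((sφ j).partialD j).continuousOn, Finset.sum_sub_distrib, hbd b hb, hbd a ha] at h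
  rw [← h]
  refine setIntegral_congr_fun (measurableSet_annulus a b) fun x hx => ?_
  have hx0 : x ≠ 0 := closedAnnulus_subset ha (annulus_subset_closedAnnulus a b hx)
  simp only [partialD_coord_mul hf hx0, Fin.sum_univ_two]
  ring

/-- The Gauss-Green formula for the components of a field of `X₁`, in the direction of `x`. -/
lemma X1.integral_euler {a b : ℝ} (ha : 0 < a) (hab : a < b) (v : X1 a b) {φ ξ : ℝ × ℝ → ℝ}
    (h : IsRadialPrimitive b φ ξ) (i : Fin 2) :
    ∫ x in annulus a b, v.vel i x * φ x
      = -(a ^ 2 * ∫ θ in (0 : ℝ)..2 * Real.pi, v.trace i (circlePt a θ) * ξ (circlePt a θ))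
        - ∑ j, ∫ x in annulus a b, v.grad i j x * (coord j x * ξ x) := by
  have sφ : ∀ j, SmoothOff (fun y => coord j y * ξ y) := fun j =>
    (contDiff_coord j).contDiffOn.mul h.smooth
  have key := Finset.sum_congr (rfl : (Finset.univ : Finset (Fin 2)) = _) fun j _ =>
    v.trace_formula ha hab (sφ j) i j
  have hbd : ∑ j, arcInt a (fun θ => v.trace i (circlePt a θ)
      * (coord j (circlePt a θ) * ξ (circlePt a θ) * radialVec θ j))
      = a ^ 2 * ∫ θ in (0 : ℝ)..2 * Real.pi, v.trace i (circlePt a θ) * ξ (circlePt a θ) := by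
    rw [← arcInt_sum _ _ _ fun j _ => v.trace_test_intervalIntegrable ha hab (sφ j) i j (by simp),
      arcInt, ← intervalIntegral.integral_const_mul]
    refine intervalIntegral.integral_congr fun θ _ => ?_
    have := sum_radialVec_mul_self θ
    simp only [coord_circlePt, Fin.sum_univ_two] at this ⊢
    linear_combination a ^ 2 * v.trace i (circlePt a θ) * ξ (circlePt a θ) * this
  have hbd' : ∑ j, arcInt b (fun θ => v.trace i (circlePt b θ)
      * (coord j (circlePt b θ) * ξ (circlePt b θ) * radialVec θ j)) = 0 := by
    simp [h.right, arcInt]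
  rw [Finset.sum_add_distrib, Finset.sum_sub_distrib, hbd, hbd',
    ← integral_finsetSum _ fun j _ => integrable_mul_of_continuousOn ha (v.vel_memLp i)
      ((sφ j).partialD j).continuousOn] at key
  have e : ∫ x in annulus a b, v.vel i x * φ x = ∫ x in annulus a b,
      ∑ j, v.vel i x * partialD j (fun y => coord j y * ξ y) x := by
    refine setIntegral_congr_fun (measurableSet_annulus a b) fun x hx => ?_
    have hx0 : x ≠ 0 := closedAnnulus_subset ha (annulus_subset_closedAnnulus a b hx)
    simp only [partialD_coord_mul h.smooth hx0, ← h.euler x hx0, Fin.sum_univ_two]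
    ring
  rw [e]
  linarith

/-- The weighted estimate for the radial primitive. -/
lemma IsRadialPrimitive.bound {a b : ℝ} (ha : 0 < a) (hab : a < b) {φ ξ : ℝ × ℝ → ℝ}
    (hφ : SmoothOff φ) (h : IsRadialPrimitive b φ ξ) :
    (∫ x in annulus a b, (normSqr x * ξ x) ^ 2)
        + a ^ 6 * (∫ θ in (0 : ℝ)..2 * Real.pi, ξ (circlePt a θ) ^ 2)
      ≤ ∫ x in annulus a b, (normSqr x * φ x) ^ 2 := by
  have sn : SmoothOff normSqr := contDiff_normSqr.contDiffOn
  -- With the weight `|x|⁴` the divergence theorem gives `2 ∫ |x|⁴ ξ² + 2 ∫ |x|⁴ ξ φ = -a⁶ ∫ ξ(a,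
  -- θ)² dθ`. The weight makes the quadratic term and the inner boundary term cooperate; without it
  -- they have opposite signs. Expanding `∫ |x|⁴ (ξ + φ)² ≥ 0` concludes.
  have sf : SmoothOff fun x => normSqr x ^ 2 * ξ x ^ 2 := (sn.pow 2).mul (h.smooth.pow 2)
  have key := integral_euler ha hab sf
  have e : ∫ x in annulus a b, (2 * (normSqr x ^ 2 * ξ x ^ 2)
      + ∑ j, coord j x * partialD j (fun x => normSqr x ^ 2 * ξ x ^ 2) x)
      = ∫ x in annulus a b, (2 * (normSqr x * ξ x) ^ 2 + 2 * (normSqr x ^ 2 * ξ x * φ x)) := by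
    refine setIntegral_congr_fun (measurableSet_annulus a b) fun x hx => ?_
    have hx0 : x ≠ 0 := closedAnnulus_subset ha (annulus_subset_closedAnnulus a b hx)
    have d1 := sn.differentiableAt hx0
    have d2 := h.smooth.differentiableAt hx0
    have hp : ∀ j, partialD j (fun x => normSqr x ^ 2 * ξ x ^ 2) x
        = normSqr x ^ 2 * (2 * ξ x * partialD j ξ x)
          + (2 * normSqr x * (2 * coord j x)) * ξ x ^ 2 := fun j => by
      have e2 : (fun x => normSqr x ^ 2 * ξ x ^ 2)
          = fun x => (normSqr x * normSqr x) * (ξ x * ξ x) := by funext y; ring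
      rw [e2, partialD_mul j (d1.fun_mul d1) (d2.fun_mul d2), partialD_mul j d1 d1,
        partialD_mul j d2 d2, partialD_normSqr]
      ring
    have hs : normSqr x = coord 0 x ^ 2 + coord 1 x ^ 2 := rfl
    have he := h.euler x hx0
    simp only [hp, Fin.sum_univ_two] at he ⊢
    linear_combination 2 * normSqr x ^ 2 * ξ x * he - 4 * normSqr x * ξ x ^ 2 * hs
  have i1 : Integrable (fun x => (normSqr x * ξ x) ^ 2) (volume.restrict (annulus a b)) :=
    integrable_of_continuousOn ha ((sn.mul h.smooth).pow 2).continuousOn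
  have i2 : Integrable (fun x => normSqr x ^ 2 * ξ x * φ x) (volume.restrict (annulus a b)) :=
    integrable_of_continuousOn ha (((sn.pow 2).mul h.smooth).mul hφ).continuousOn
  have i3 : Integrable (fun x => (normSqr x * φ x) ^ 2) (volume.restrict (annulus a b)) :=
    integrable_of_continuousOn ha ((sn.mul hφ).pow 2).continuousOn
  have hpos : 0 ≤ ∫ x in annulus a b, (normSqr x * (ξ x + φ x)) ^ 2 :=
    integral_nonneg fun x => sq_nonneg _
  have hexp : ∀ x, (normSqr x * (ξ x + φ x)) ^ 2
      = (normSqr x * ξ x) ^ 2 + 2 * (normSqr x ^ 2 * ξ x * φ x) + (normSqr x * φ x) ^ 2 :=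
    fun x => by ring
  have i4 : Integrable (fun x => (normSqr x * ξ x) ^ 2 + 2 * (normSqr x ^ 2 * ξ x * φ x))
    (volume.restrict (annulus a b)) := i1.add (i2.const_mul 2)
  simp only [hexp] at hpos
  rw [integral_add i4 i3, integral_add i1 (i2.const_mul 2), integral_const_mul] at hpos
  rw [e, integral_add (i1.const_mul 2) (i2.const_mul 2), integral_const_mul,
    integral_const_mul] at key
  simp only [h.right, normSqr_circlePt, intervalIntegral.integral_const_mul] at key
  have hz : ∫ _ in (0 : ℝ)..2 * Real.pi, (0 : ℝ) ^ 2 = 0 := by simp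
  rw [hz] at key
  nlinarith

/-- Estimate of the moments of the components of a field of `X₁`. -/
lemma X1.sq_integral_vel_mul_le {a b : ℝ} (ha : 0 < a) (hab : a < b) (v : X1 a b)
    {φ ξ : ℝ × ℝ → ℝ} (hφ : SmoothOff φ) (h : IsRadialPrimitive b φ ξ) (i : Fin 2) :
    (∫ x in annulus a b, v.vel i x * φ x) ^ 2
      ≤ 2 * b ^ 4 / a ^ 2 * ((∫ θ in (0 : ℝ)..2 * Real.pi, v.trace i (circlePt a θ) ^ 2)
        + ∑ j, ∫ x in annulus a b, v.grad i j x ^ 2) * ∫ x in annulus a b, φ x ^ 2 := by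
  have hb := ha.trans hab
  have sn : SmoothOff normSqr := contDiff_normSqr.contDiffOn
  have hbound := h.bound ha hab hφ
  have hnorm : ∀ x ∈ annulus a b, a ^ 2 ≤ normSqr x ∧ normSqr x ≤ b ^ 2 := fun x hx =>
    ⟨hx.1.le, hx.2.le⟩
  set F := ∫ x in annulus a b, φ x ^ 2 with hF
  set J := ∫ θ in (0 : ℝ)..2 * Real.pi, ξ (circlePt a θ) ^ 2 with hJ
  set T := ∫ θ in (0 : ℝ)..2 * Real.pi, v.trace i (circlePt a θ) ^ 2 with hT
  set G := ∑ j, ∫ x in annulus a b, v.grad i j x ^ 2 with hG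
  have hJ0 : 0 ≤ J := intervalIntegral.integral_nonneg (by positivity) fun _ _ => sq_nonneg _
  have hT0 : 0 ≤ T := intervalIntegral.integral_nonneg (by positivity) fun _ _ => sq_nonneg _
  have hG0 : 0 ≤ G := Finset.sum_nonneg fun _ _ => integral_nonneg fun _ => sq_nonneg _
  have i1 : Integrable (fun x => (normSqr x * ξ x) ^ 2) (volume.restrict (annulus a b)) :=
    integrable_of_continuousOn ha ((sn.mul h.smooth).pow 2).continuousOn
  have i3 : Integrable (fun x => (normSqr x * φ x) ^ 2) (volume.restrict (annulus a b)) :=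
    integrable_of_continuousOn ha ((sn.mul hφ).pow 2).continuousOn
  have hF1 : ∫ x in annulus a b, (normSqr x * φ x) ^ 2 ≤ b ^ 4 * F := by
    rw [hF, ← integral_const_mul]
    refine setIntegral_mono_on i3 ((integrable_of_continuousOn ha
      (hφ.pow 2).continuousOn).const_mul _) (measurableSet_annulus a b) fun x hx => ?_
    have h1 := hnorm x hx
    rw [mul_pow, show b ^ 4 = (b ^ 2) ^ 2 by ring]
    exact mul_le_mul_of_nonneg_right
      (pow_le_pow_left₀ ((sq_nonneg a).trans h1.1) h1.2 2) (sq_nonneg _)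
  have hX : a ^ 2 * ∑ j, ∫ x in annulus a b, (coord j x * ξ x) ^ 2
      ≤ ∫ x in annulus a b, (normSqr x * ξ x) ^ 2 := by
    have ij : ∀ j, Integrable (fun x => (coord j x * ξ x) ^ 2) (volume.restrict (annulus a b)) :=
      fun j => integrable_of_continuousOn ha
        (((contDiff_coord j).contDiffOn.mul h.smooth).pow 2).continuousOn
    rw [← integral_finsetSum _ fun j _ => ij j, ← integral_const_mul]
    refine setIntegral_mono_on ((integrable_finsetSum _ fun j _ => ij j).const_mul _) i1
      (measurableSet_annulus a b) fun x hx => ?_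
    have h1 := hnorm x hx
    have hs : normSqr x = coord 0 x ^ 2 + coord 1 x ^ 2 := rfl
    rw [Fin.sum_univ_two]
    have e1 : (coord 0 x * ξ x) ^ 2 + (coord 1 x * ξ x) ^ 2 = normSqr x * ξ x ^ 2 := by
      rw [hs]; ring
    rw [e1, show (normSqr x * ξ x) ^ 2 = normSqr x * (normSqr x * ξ x ^ 2) by ring]
    exact mul_le_mul_of_nonneg_right h1.1
      (mul_nonneg ((sq_nonneg a).trans h1.1) (sq_nonneg _))
  have hC : (∑ j, ∫ x in annulus a b, v.grad i j x * (coord j x * ξ x)) ^ 2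
      ≤ G * ∑ j, ∫ x in annulus a b, (coord j x * ξ x) ^ 2 :=
    sq_sum_integral_mul_le _ (fun j _ => v.grad_memLp i j) fun j _ =>
      memLp_of_continuousOn ha ((contDiff_coord j).contDiffOn.mul h.smooth).continuousOn 2
  have hB : (∫ θ in (0 : ℝ)..2 * Real.pi, v.trace i (circlePt a θ) * ξ (circlePt a θ)) ^ 2
      ≤ T * J := by
    rw [hT, hJ, intervalIntegral.integral_of_le (by positivity), intervalIntegral.integral_of_le
      (by positivity), intervalIntegral.integral_of_le (by positivity)]
    exact sq_integral_mul_le (v.trace_memLp i a (by simp))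
      (memLp_Ioc_of_continuous (h.smooth.continuous_circle ha) _ _ 2)
  rw [v.integral_euler ha hab h i]
  set X := ∑ j, ∫ x in annulus a b, (coord j x * ξ x) ^ 2 with hXd
  set P := ∫ θ in (0 : ℝ)..2 * Real.pi, v.trace i (circlePt a θ) * ξ (circlePt a θ) with hP
  set Q := ∑ j, ∫ x in annulus a b, v.grad i j x * (coord j x * ξ x) with hQ
  have hX0 : 0 ≤ X := Finset.sum_nonneg fun _ _ => integral_nonneg fun _ => sq_nonneg _
  have hW0 : 0 ≤ ∫ x in annulus a b, (normSqr x * ξ x) ^ 2 := integral_nonneg fun _ => sq_nonneg _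
  -- The weighted estimate controls both the interior and the boundary norm of `ξ`; each bound
  -- follows by dropping the other nonnegative term.
  have hJF : a ^ 6 * J ≤ b ^ 4 * F := by linarith
  have hXF : a ^ 2 * X ≤ b ^ 4 * F := by
    have : 0 ≤ a ^ 6 * J := by positivity
    linarith
  have ha2 : 0 < a ^ 2 := by positivity
  refine le_of_mul_le_mul_left ?_ ha2
  calc a ^ 2 * (-(a ^ 2 * P) - Q) ^ 2 ≤ 2 * (a ^ 6 * P ^ 2) + 2 * (a ^ 2 * Q ^ 2) := by
        nlinarith [mul_nonneg ha2.le (sq_nonneg (a ^ 2 * P - Q))]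
    _ ≤ 2 * (a ^ 6 * (T * J)) + 2 * (a ^ 2 * (G * X)) := by gcongr
    _ = 2 * (T * (a ^ 6 * J)) + 2 * (G * (a ^ 2 * X)) := by ring
    _ ≤ 2 * (T * (b ^ 4 * F)) + 2 * (G * (b ^ 4 * F)) := by gcongr
    _ = a ^ 2 * (2 * b ^ 4 / a ^ 2 * (T + G) * F) := by field_simp

/-- Polynomials are dense in the square integrable functions on the annulus. -/
lemma exists_planePolynomial_integral_sub_sq_le {a b : ℝ} {u : ℝ × ℝ → ℝ}
    (hu : MemLp u 2 (volume.restrict (annulus a b))) (ha : 0 < a) {δ : ℝ} (hδ : 0 < δ) :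
    ∃ p ∈ planePolynomials, ∫ x in annulus a b, (u x - p x) ^ 2 ≤ δ := by
  have hu' : MemLp u (ENNReal.ofReal 2) (volume.restrict (annulus a b)) := by simpa using hu
  obtain ⟨g, -, hg, hgc, -⟩ := hu'.exists_hasCompactSupport_integral_rpow_sub_le (p := 2)
    (by norm_num) (ε := δ / 4) (by positivity)
  set m := volume.real (annulus a b) with hm
  have hm0 : 0 ≤ m := measureReal_nonneg
  -- Stone-Weierstrass on the closed annulus. The uniform error is scaled by the measure `m` of the
  -- annulus, with `m + 1` keeping the denominator positive.
  obtain ⟨p, hp, hpg⟩ :=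
    ContinuousMap.exists_mem_subalgebra_near_continuous_of_isCompact_of_separatesPoints
      separatesPoints_planePolynomials ⟨g, hgc⟩ (isCompact_closedAnnulus a b)
      (ε := √(δ / (4 * (m + 1)))) (by positivity)
  refine ⟨p, hp, ?_⟩
  have hgL : MemLp g 2 (volume.restrict (annulus a b)) := memLp_of_continuousOn ha hgc.continuousOn 2
  have hpL : MemLp p 2 (volume.restrict (annulus a b)) :=
    memLp_of_continuousOn ha p.continuous.continuousOn 2
  have i1 : Integrable (fun x => (u x - g x) ^ 2) (volume.restrict (annulus a b)) :=
    (hu.sub hgL).integrable_sq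
  have i2 : Integrable (fun x => (u x - p x) ^ 2) (volume.restrict (annulus a b)) :=
    (hu.sub hpL).integrable_sq
  have hbd : ∀ x ∈ annulus a b, (p x - g x) ^ 2 ≤ δ / (4 * (m + 1)) := fun x hx => by
    have h1 := (hpg x (annulus_subset_closedAnnulus a b hx)).le
    have h2 := pow_le_pow_left₀ (norm_nonneg _) h1 2
    rwa [Real.sq_sqrt (by positivity), Real.norm_eq_abs, sq_abs] at h2
  have hg' : ∫ x in annulus a b, (u x - g x) ^ 2 ≤ δ / 4 := by
    refine le_trans (le_of_eq (integral_congr_ae (Eventually.of_forall fun x => ?_))) hg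
    simp
  have i3 : Integrable (fun _ : ℝ × ℝ => 2 * (δ / (4 * (m + 1)))) (volume.restrict (annulus a b)) :=
    integrable_const _
  calc ∫ x in annulus a b, (u x - p x) ^ 2
      ≤ ∫ x in annulus a b, (2 * (u x - g x) ^ 2 + 2 * (δ / (4 * (m + 1)))) := by
        refine setIntegral_mono_on i2 ((i1.const_mul 2).add i3) (measurableSet_annulus a b)
          fun x hx => ?_
        nlinarith [hbd x hx, sq_nonneg (u x - g x + (p x - g x))]
    _ = 2 * (∫ x in annulus a b, (u x - g x) ^ 2) + m * (2 * (δ / (4 * (m + 1)))) := by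
        rw [integral_add (i1.const_mul 2) i3, integral_const_mul, setIntegral_const, smul_eq_mul]
    _ ≤ 2 * (δ / 4) + (m + 1) * (2 * (δ / (4 * (m + 1)))) := by gcongr; linarith
    _ = δ := by field_simp; ring

/-- A duality criterion for bounds of the `L²` norm. -/
lemma integral_sq_le_of_polynomials {a b : ℝ} (ha : 0 < a) {u : ℝ × ℝ → ℝ}
    (hu : MemLp u 2 (volume.restrict (annulus a b))) {K : ℝ}
    (h : ∀ p ∈ planePolynomials, (∫ x in annulus a b, u x * p x) ^ 2
      ≤ K * ∫ x in annulus a b, p x ^ 2) : ∫ x in annulus a b, u x ^ 2 ≤ max K 0 := by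
  refine le_of_forall_pos_le_add fun δ hδ => ?_
  obtain ⟨p, hp, hpu⟩ := exists_planePolynomial_integral_sub_sq_le hu ha hδ
  have hpL : MemLp p 2 (volume.restrict (annulus a b)) :=
    memLp_of_continuousOn ha p.continuous.continuousOn 2
  have e : ∀ x, (u x - p x) ^ 2 = u x ^ 2 + -2 * (u x * p x) + p x ^ 2 := fun x => by ring
  have i1 : Integrable (fun x => u x ^ 2 + -2 * (u x * p x)) (volume.restrict (annulus a b)) :=
    hu.integrable_sq.add ((integrable_mul_of_memLp hu hpL).const_mul _)
  simp only [e] at hpu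
  rw [integral_add i1 hpL.integrable_sq, integral_add hu.integrable_sq
    ((integrable_mul_of_memLp hu hpL).const_mul _), integral_const_mul] at hpu
  have h1 := h p hp
  have hF : 0 ≤ ∫ x in annulus a b, p x ^ 2 := integral_nonneg fun x => sq_nonneg _
  set U := ∫ x in annulus a b, u x ^ 2
  set P := ∫ x in annulus a b, u x * p x
  set F := ∫ x in annulus a b, p x ^ 2
  have h2 : P ^ 2 ≤ max K 0 * F := h1.trans (mul_le_mul_of_nonneg_right (le_max_left _ _) hF)
  have hK : 0 ≤ max K 0 := le_max_right _ _
  -- From `∫ (u - p)² ≤ δ` one has `U ≤ δ + 2 P - F`; the hypothesis and the arithmetic-geometric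
  -- mean inequality give `2 P ≤ K⁺ + F`, so the unknown `F` cancels.
  have h3 : 2 * P ≤ max K 0 + F := by
    refine le_trans (le_abs_self _) (abs_le_of_sq_le_sq ?_ (by positivity))
    nlinarith [sq_nonneg (max K 0 - F)]
  linarith

/-- The Poincaré inequality on `X₁`. -/
theorem poincare_inequality {a b : ℝ} (ha : 0 < a) (hab : a < b) :
    ∃ C, 0 < C ∧ ∀ v : X1 a b, E3 v v ≤ C * (E1 v v + E2 v v / a) := by
  have hb := ha.trans hab
  refine ⟨2 * b ^ 4 / a ^ 2, by positivity, fun v => ?_⟩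
  set T : Fin 2 → ℝ := fun i => ∫ θ in (0 : ℝ)..2 * Real.pi, v.trace i (circlePt a θ) ^ 2 with hT
  set G : Fin 2 → ℝ := fun i => ∑ j, ∫ x in annulus a b, v.grad i j x ^ 2 with hG
  have hT0 : ∀ i, 0 ≤ T i := fun i =>
    intervalIntegral.integral_nonneg (by positivity) fun _ _ => sq_nonneg _
  have hG0 : ∀ i, 0 ≤ G i := fun i => Finset.sum_nonneg fun _ _ =>
    integral_nonneg fun _ => sq_nonneg _
  have hvel : ∀ i, ∫ x in annulus a b, v.vel i x ^ 2 ≤ 2 * b ^ 4 / a ^ 2 * (T i + G i) :=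
    fun i => by
    have h := integral_sq_le_of_polynomials ha (v.vel_memLp i)
      (K := 2 * b ^ 4 / a ^ 2 * (T i + G i)) fun p hp => by
        obtain ⟨hs, ξ, hξ⟩ := exists_isRadialPrimitive hb hp
        exact v.sq_integral_vel_mul_le ha hab hs hξ i
    have h0 : 0 ≤ 2 * b ^ 4 / a ^ 2 * (T i + G i) :=
      mul_nonneg (by positivity) (add_nonneg (hT0 i) (hG0 i))
    rwa [max_eq_left h0] at h
  have hE3 : E3 v v = ∑ i, ∫ x in annulus a b, v.vel i x ^ 2 := by
    simp only [E3, ← sq]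
    exact integral_finsetSum _ fun i _ => (v.vel_memLp i).integrable_sq
  have hE1 : ∑ i, G i ≤ E1 v v := by
    refine le_trans (le_of_eq ?_) (v.integral_grad_le_E1 hb)
    simp only [← sq]
    rw [integral_finsetSum _ fun i _ => integrable_finsetSum _ fun j _ =>
      (v.grad_memLp i j).integrable_sq]
    exact Finset.sum_congr rfl fun i _ =>
      (integral_finsetSum _ fun j _ => (v.grad_memLp i j).integrable_sq).symm
  -- `T` integrates with respect to `dθ` and `E₂` with respect to arc length `a dθ`; the trace is
  -- tangential, so its length is that of its tangential component.
  have hE2 : ∑ i, T i = E2 v v / a := by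
    have hi : ∀ i, IntervalIntegrable (fun θ => v.trace i (circlePt a θ) ^ 2) volume 0
        (2 * Real.pi) := fun i => by
      rw [intervalIntegrable_iff_integrableOn_Ioc_of_le (by positivity)]
      exact (v.trace_memLp i a (by simp)).integrable_sq
    have h1 : E2 v v = arcInt a (fun θ => ∑ i, v.trace i (circlePt a θ) ^ 2) := by
      refine arcInt_congr_ae ?_
      filter_upwards [v.trace_eq (r := a) (by simp)] with θ hθ
      have := sum_tangentVec_mul_self θ
      simp only [hθ, Fin.sum_univ_two] at this ⊢
      linear_combination -(tangential v.trace a θ) ^ 2 * this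
    rw [h1, arcInt, intervalIntegral.integral_mul_const,
      intervalIntegral.integral_finsetSum fun i _ => hi i]
    field_simp
    rfl
  calc E3 v v = ∑ i, ∫ x in annulus a b, v.vel i x ^ 2 := hE3
    _ ≤ ∑ i, 2 * b ^ 4 / a ^ 2 * (T i + G i) := Finset.sum_le_sum fun i _ => hvel i
    _ = 2 * b ^ 4 / a ^ 2 * (∑ i, G i + ∑ i, T i) := by
      rw [← Finset.mul_sum, Finset.sum_add_distrib, add_comm (∑ i, T i)]
    _ ≤ _ := by rw [hE2]; gcongr

/-! ### The first eigenvalue -/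

lemma integral_modeAngular_sq (c : ℂ) {n : ℕ} (hn : 1 ≤ n) :
    ∫ θ in (0 : ℝ)..2 * Real.pi, modeAngular c n θ ^ 2 = Real.pi * ‖c‖ ^ 2 := by
  simp only [sq (modeAngular c n _)]
  rw [integral_mul_modeAngular ((continuous_modeAngular c n).intervalIntegrable _ _),
    fourierC_modeAngular c hn, if_pos rfl, map_div₀, mul_div_assoc', Complex.mul_conj,
    Complex.normSq_eq_norm_sq, Complex.conj_ofNat, show (2 : ℂ) = ((2 : ℝ) : ℂ) by norm_num,
    ← Complex.ofReal_div, Complex.ofReal_re]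
  ring

lemma hasDerivAt_modeAngular (c : ℂ) (n : ℕ) (θ : ℝ) :
    HasDerivAt (modeAngular c n) (modeAngular (c * (n * Complex.I)) n θ) θ := by
  have h1 : HasDerivAt (fun t : ℝ => (n : ℂ) * t * Complex.I) ((n : ℂ) * 1 * Complex.I) θ :=
    ((Complex.ofRealCLM.hasDerivAt (x := θ)).const_mul (n : ℂ)).mul_const Complex.I
  have h2 := Complex.reCLM.hasFDerivAt.comp_hasDerivAt θ (h1.cexp.const_mul c)
  refine h2.congr_deriv ?_
  rw [Complex.reCLM_apply, modeAngular]
  congr 1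
  ring

lemma radial_modeField {a b : ℝ} (ha : 0 < a) (hab : a < b) {n : ℕ} (hn : 1 ≤ n) (c : ℂ)
    {r : ℝ} (hr : 0 < r) (θ : ℝ) :
    radial (modeField ha hab hn c).vel r θ
      = -(profile a b n r / r * modeAngular (c * (n * Complex.I)) n θ) := by
  have hψ := smoothOff_modeStream b ha n c
  have h1 := hasDerivAt_circlePt_angle (hψ.differentiableAt (circlePt_ne_zero hr θ))
  simp only [modeStream_circlePt] at h1
  have h2 := h1.unique ((hasDerivAt_modeAngular c n θ).const_mul (profile a b n r))
  change radial (streamVel (modeStream a b n c)) r θ = _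
  rw [radial_streamVel, neg_inj, div_mul_eq_mul_div, ← h2, mul_div_cancel_left₀ _ hr.ne']

lemma sum_sq_eq_tangential_radial (u : Fin 2 → ℝ × ℝ → ℝ) (r θ : ℝ) :
    ∑ i, u i (circlePt r θ) * u i (circlePt r θ) = tangential u r θ ^ 2 + radial u r θ ^ 2 := by
  have := Real.sin_sq_add_cos_sq θ
  simp only [radial, tangential, Fin.sum_univ_two, radialVec, tangentVec,
    Matrix.cons_val_zero, Matrix.cons_val_one]
  linear_combination -(u 0 (circlePt r θ) ^ 2 + u 1 (circlePt r θ) ^ 2) * this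

/-- The energy of the fields of a Fourier mode is isotropic. -/
lemma E3_modeField {a b : ℝ} (ha : 0 < a) (hab : a < b) {n : ℕ} (hn : 1 ≤ n) (c : ℂ) :
    E3 (modeField ha hab hn c) (modeField ha hab hn c)
      = ‖c‖ ^ 2 * ∫ r in Ioo a b, Real.pi * (profileD1 a b n r ^ 2
        + n ^ 2 * (profile a b n r / r) ^ 2) * r := by
  rw [E3, integral_annulus ha hab (X1.vel_mul_integrable _ _), ← integral_const_mul]
  refine setIntegral_congr_fun measurableSet_Ioo fun r hr => ?_
  have hr0 : 0 < r := ha.trans hr.1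
  have h1 : ∀ θ, (∑ i, (modeField ha hab hn c).vel i (circlePt r θ)
      * (modeField ha hab hn c).vel i (circlePt r θ)) * r
      = profileD1 a b n r ^ 2 * r * modeAngular c n θ ^ 2
        + (profile a b n r / r) ^ 2 * r * modeAngular (c * (n * Complex.I)) n θ ^ 2 := fun θ => by
    rw [sum_sq_eq_tangential_radial, radial_modeField ha hab hn c hr0]
    have h2 : tangential (modeField ha hab hn c).vel r θ = profileD1 a b n r * modeAngular c n θ :=
      tangential_modeField ha hab hn c hr0 θ
    rw [h2]
    ring
  have hi : ∀ (k : ℝ) (d : ℂ), IntervalIntegrable (fun θ => k * modeAngular d n θ ^ 2) volume 0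
      (2 * Real.pi) := fun k d =>
    (((continuous_modeAngular d n).pow 2).const_mul k).intervalIntegrable _ _
  simp only [arcInt, h1]
  rw [intervalIntegral.integral_add (hi _ _) (hi _ _), intervalIntegral.integral_const_mul,
    intervalIntegral.integral_const_mul, integral_modeAngular_sq _ hn, integral_modeAngular_sq _ hn,
    norm_mul, norm_mul, Complex.norm_I, Complex.norm_natCast]
  ring

/-! ### The slip energy and the critical viscosity -/

/-- The bilinear form `E₁ + E₂ / a`. -/
def slipForm {a b : ℝ} (u w : X1 a b) : ℝ := E1 u w + E2 u w / a

/-- The eigenvalue of `E₁ + E₂ / a` with respect to `E₂` of the fields of order `n`. -/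
def slipConst (a b : ℝ) (n : ℕ) : ℝ := kappa a b n + 1 / a

/-- The energy at viscosity `μ`. -/
def slipEnergy {a b : ℝ} (α μ : ℝ) (u w : X1 a b) : ℝ := μ * E1 u w - (α - μ / a) * E2 u w

lemma slipEnergy_eq {a b : ℝ} (α μ : ℝ) (u w : X1 a b) :
    slipEnergy α μ u w = μ * slipForm u w - α * E2 u w := by
  unfold slipEnergy slipForm; ring

lemma slipConst_pos {a b : ℝ} (ha : 0 < a) (hab : a < b) {n : ℕ} (hn : 1 ≤ n) :
    0 < slipConst a b n := add_pos (kappa_pos ha hab hn) (by positivity)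

lemma slipConst_lt {a b : ℝ} (ha : 0 < a) (hab : a < b) {n : ℕ} (hn : 1 ≤ n) :
    slipConst a b n < slipConst a b (n + 1) := add_lt_add_left (kappa_lt ha hab hn) _

lemma slipForm_nonneg {a b : ℝ} (ha : 0 < a) (hab : a < b) (u : X1 a b) : 0 ≤ slipForm u u :=
  add_nonneg (u.E1_nonneg (ha.trans hab)) (div_nonneg (u.E2_nonneg ha) ha.le)

lemma slipForm_modeField {a b : ℝ} (ha : 0 < a) (hab : a < b) {n : ℕ} (hn : 1 ≤ n) (c : ℂ)
    (v : X1 a b) :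
    slipForm v (modeField ha hab hn c) = slipConst a b n * E2 v (modeField ha hab hn c) := by
  rw [slipForm, E1_modeField, slipConst]; ring

lemma slipConst_mul_E2_le {a b : ℝ} (ha : 0 < a) (hab : a < b) {m : ℕ} (hm : 1 ≤ m)
    (v : X1 a b) (hv : ∀ n, 1 ≤ n → n < m → v.coeff n = 0) :
    slipConst a b m * E2 v v ≤ slipForm v v := by
  have := kappa_mul_E2_le_E1 ha hab hm v hv
  rw [slipConst, slipForm, add_mul, one_div_mul_eq_div]
  linarith

lemma muC_eq_div {a b : ℝ} (α : ℝ) (ha : 0 < a) (hab : a < b) :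
    muC a b α = α / slipConst a b 1 := by
  have h := kappa_pos ha hab le_rfl
  rw [muC, gammaInf, (isLeast_boundaryQuotients ha hab).csInf_eq, slipConst]
  field_simp

lemma muC_pos {a b α : ℝ} (ha : 0 < a) (hab : a < b) (hα : 0 < α) : 0 < muC a b α := by
  rw [muC_eq_div α ha hab]
  exact div_pos hα (slipConst_pos ha hab le_rfl)

/-- At the critical viscosity, the fields of order one are in the kernel of the energy. -/
lemma slipEnergy_muC_modeField {a b : ℝ} (α : ℝ) (ha : 0 < a) (hab : a < b) (c : ℂ) (v : X1 a b) :
    slipEnergy α (muC a b α) v (modeField ha hab le_rfl c) = 0 := by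
  have := (slipConst_pos ha hab le_rfl).ne'
  rw [slipEnergy_eq, slipForm_modeField, muC_eq_div α ha hab]
  field_simp
  ring

/-- The trace inequality with `ε = 1 / (2K)` absorbs half of `E₂` and leaves `E₂ / 2 ≤ C E₃`. It
shows that the first mode is admissible in the energy quotients. -/
lemma E3_pos_of_E1_le {a b : ℝ} (ha : 0 < a) (hab : a < b) {K : ℝ} (hK : 0 < K) {v : X1 a b}
    (h : E1 v v ≤ K * E2 v v) (h2 : 0 < E2 v v) : 0 < E3 v v := by
  obtain ⟨C, hC, hv⟩ := trace_inequality ha hab (ε := 1 / (2 * K)) (by positivity)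
  have h3 : 1 / (2 * K) * E1 v v ≤ E2 v v / 2 := by
    calc _ ≤ 1 / (2 * K) * (K * E2 v v) := by gcongr
      _ = _ := by field_simp
  have h4 : 0 < C * E3 v v := by linarith [hv v]
  exact pos_of_mul_pos_right h4 hC

lemma E3_modeField_one_pos {a b : ℝ} (ha : 0 < a) (hab : a < b) :
    0 < E3 (modeField ha hab le_rfl 1) (modeField ha hab le_rfl 1) :=
  E3_pos_of_E1_le ha hab (kappa_pos ha hab le_rfl) (E1_modeField ha hab le_rfl 1 _).le
    (E2_modeField_one_pos ha hab)

lemma mem_energyQuotients {a b : ℝ} (α μ : ℝ) {u : X1 a b} (hu : 0 < E3 u u) :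
    slipEnergy α μ u u / E3 u u ∈ energyQuotients a b α μ := ⟨u, hu.ne', rfl⟩

lemma le_of_mem_energyQuotients {a b α μ K : ℝ} (h : ∀ u : X1 a b, K * E3 u u ≤ slipEnergy α μ u u) :
    K ∈ lowerBounds (energyQuotients a b α μ) := by
  rintro _ ⟨u, hu, rfl⟩
  rw [le_div_iff₀ (u.E3_nonneg.lt_of_ne' hu)]
  exact h u

lemma energyQuotients_nonempty {a b : ℝ} (α μ : ℝ) (ha : 0 < a) (hab : a < b) :
    (energyQuotients a b α μ).Nonempty :=
  ⟨_, mem_energyQuotients α μ (E3_modeField_one_pos ha hab)⟩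

/-- In the trace inequality `ε = μ / α` is the value for which `α E₂` is absorbed by `μ E₁`, at the
price of a multiple of `E₃`. -/
lemma bddBelow_energyQuotients {a b α μ : ℝ} (ha : 0 < a) (hab : a < b) (hα : 0 < α)
    (hμ : 0 < μ) : BddBelow (energyQuotients a b α μ) := by
  obtain ⟨C, hC, hv⟩ := trace_inequality ha hab (ε := μ / α) (by positivity)
  refine ⟨-(α * C), le_of_mem_energyQuotients fun u => ?_⟩
  have h1 := mul_le_mul_of_nonneg_left (hv u) hα.le
  have h2 : α * (μ / α * E1 u u + C * E3 u u) = μ * E1 u u + α * C * E3 u u := by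
    field_simp
  have h3 : 0 ≤ μ * (E2 u u / a) := mul_nonneg hμ.le (div_nonneg (u.E2_nonneg ha) ha.le)
  rw [slipEnergy_eq, slipForm]
  linarith

/-- Lower bound of the energy in terms of the distance to the critical viscosity. -/
lemma sub_mul_slipForm_le {a b α : ℝ} (ha : 0 < a) (hab : a < b) (hα : 0 < α) (μ : ℝ) {m : ℕ}
    (hm : 1 ≤ m) (u : X1 a b) (hu : ∀ n, 1 ≤ n → n < m → u.coeff n = 0) :
    (μ - α / slipConst a b m) * slipForm u u ≤ slipEnergy α μ u u := by
  have hk := slipConst_pos ha hab hm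
  have h := mul_le_mul_of_nonneg_left (slipConst_mul_E2_le ha hab hm u hu)
    (div_nonneg hα.le hk.le)
  have e : α / slipConst a b m * (slipConst a b m * E2 u u) = α * E2 u u := by field_simp
  rw [slipEnergy_eq]
  linarith

/-- For `m = 1` the coefficient `μ - α / slipConst a b 1` is zero at the critical viscosity. -/
lemma slipEnergy_muC_nonneg {a b α : ℝ} (ha : 0 < a) (hab : a < b) (hα : 0 < α) (u : X1 a b) :
    0 ≤ slipEnergy α (muC a b α) u u := by
  have h := sub_mul_slipForm_le ha hab hα (muC a b α) le_rfl u fun n h1 h2 => by omega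
  rwa [muC_eq_div α ha hab, sub_self, zero_mul, ← muC_eq_div α ha hab] at h

lemma isLeast_energyQuotients_muC {a b α : ℝ} (ha : 0 < a) (hab : a < b) (hα : 0 < α) :
    IsLeast (energyQuotients a b α (muC a b α)) 0 := by
  refine ⟨?_, le_of_mem_energyQuotients fun u => ?_⟩
  · have h := mem_energyQuotients α (muC a b α) (E3_modeField_one_pos ha hab)
    rwa [slipEnergy_muC_modeField, zero_div] at h
  · rw [zero_mul]
    exact slipEnergy_muC_nonneg ha hab hα u

lemma lambda1_muC {a b α : ℝ} (ha : 0 < a) (hab : a < b) (hα : 0 < α) :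
    lambda1 a b α (muC a b α) = 0 := by
  rw [lambda1, (isLeast_energyQuotients_muC ha hab hα).csInf_eq, neg_zero]

lemma slipEnergy_sub {a b : ℝ} (α μ ν : ℝ) (u w : X1 a b) :
    slipEnergy α μ u w = slipEnergy α ν u w + (μ - ν) * slipForm u w := by
  rw [slipEnergy_eq, slipEnergy_eq]; ring

/-- The negative of the derivative of the first eigenvalue at the critical viscosity. -/
def slipRate {a b : ℝ} (ha : 0 < a) (hab : a < b) : ℝ :=
  slipForm (modeField ha hab le_rfl 1) (modeField ha hab le_rfl 1)
    / E3 (modeField ha hab le_rfl 1) (modeField ha hab le_rfl 1)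

lemma slipRate_pos {a b : ℝ} (ha : 0 < a) (hab : a < b) : 0 < slipRate ha hab := by
  refine div_pos ?_ (E3_modeField_one_pos ha hab)
  rw [slipForm_modeField]
  exact mul_pos (slipConst_pos ha hab le_rfl) (E2_modeField_one_pos ha hab)

/-- The first mode is a trial field whose energy is affine in `μ` and vanishes at the critical
viscosity. -/
lemma sInf_energyQuotients_le {a b α μ : ℝ} (ha : 0 < a) (hab : a < b) (hα : 0 < α)
    (hμ : 0 < μ) :
    sInf (energyQuotients a b α μ) ≤ slipRate ha hab * (μ - muC a b α) := by
  refine (csInf_le (bddBelow_energyQuotients ha hab hα hμ)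
    (mem_energyQuotients α μ (E3_modeField_one_pos ha hab))).trans (le_of_eq ?_)
  rw [slipEnergy_sub α μ (muC a b α), slipEnergy_muC_modeField, slipRate]
  ring

/-- If the infimum is zero, the trial bound forces `μ ≥ μ_c`. Conversely the energy is at least `(μ
- μ_c) slipForm`, and the Poincaré inequality turns this into a lower bound `(μ - μ_c) / C` for the
infimum, which forces `μ ≤ μ_c`. -/
theorem lambda1_eq_zero_iff {a b α μ : ℝ} (ha : 0 < a) (hab : a < b) (hα : 0 < α) (hμ : 0 < μ) :
    lambda1 a b α μ = 0 ↔ μ = muC a b α := by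
  refine ⟨fun h => ?_, fun h => h ▸ lambda1_muC ha hab hα⟩
  rw [lambda1, neg_eq_zero] at h
  have h1 := sInf_energyQuotients_le ha hab hα hμ
  rw [h] at h1
  have h2 : 0 ≤ μ - muC a b α := nonneg_of_mul_nonneg_right h1 (slipRate_pos ha hab)
  obtain ⟨C, hC, hp⟩ := poincare_inequality ha hab
  have h3 : (μ - muC a b α) / C ≤ sInf (energyQuotients a b α μ) := by
    refine le_csInf (energyQuotients_nonempty α μ ha hab) (le_of_mem_energyQuotients fun u => ?_)
    have h4 := sub_mul_slipForm_le ha hab hα μ le_rfl u fun n h1 h2 => by omega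
    rw [← muC_eq_div α ha hab] at h4
    refine le_trans ?_ h4
    calc (μ - muC a b α) / C * E3 u u ≤ (μ - muC a b α) / C * (C * slipForm u u) :=
          mul_le_mul_of_nonneg_left (hp u) (by positivity)
      _ = _ := by field_simp
  rw [h] at h3
  have h5 : μ - muC a b α ≤ 0 := by
    have := mul_nonpos_of_nonpos_of_nonneg h3 hC.le
    rwa [div_mul_cancel₀ _ hC.ne'] at this
  linarith

/-- The first mode is in the kernel of the energy form, which makes zero an eigenvalue. Testing the
equation of any eigenfield with itself and using that the energy is nonnegative gives `lam ≤ 0`. -/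
theorem isGreatest_stokesEigenvalue {a b α : ℝ} (ha : 0 < a) (hab : a < b) (hα : 0 < α) :
    IsGreatest {lam : ℝ | IsStokesEigenvalue a b α (muC a b α) lam}
      (lambda1 a b α (muC a b α)) := by
  rw [lambda1_muC ha hab hα]
  refine ⟨⟨modeField ha hab le_rfl 1, (E3_modeField_one_pos ha hab).ne', fun w => ?_⟩, ?_⟩
  · rw [X1.E1_comm, X1.E2_comm, neg_zero, zero_mul]
    exact slipEnergy_muC_modeField α ha hab 1 w
  · rintro lam ⟨u, hu, h⟩
    have h1 : slipEnergy α (muC a b α) u u = -lam * E3 u u := h u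
    have h2 := slipEnergy_muC_nonneg ha hab hα u
    rw [h1] at h2
    have := nonneg_of_mul_nonneg_left h2 (u.E3_nonneg.lt_of_ne' hu)
    linarith

/-- On the fields of order one, `E₁ + E₂ / a` is a multiple of `E₃`. -/
lemma slipForm_modeField_one {a b : ℝ} (ha : 0 < a) (hab : a < b) (c : ℂ) :
    slipForm (modeField ha hab le_rfl c) (modeField ha hab le_rfl c)
      = slipRate ha hab * E3 (modeField ha hab le_rfl c) (modeField ha hab le_rfl c) := by
  have hpos := E3_modeField_one_pos ha hab
  have hE2 : ∀ d : ℂ, E2 (modeField ha hab le_rfl d) (modeField ha hab le_rfl d)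
      = ‖d‖ ^ 2 * (Real.pi * a * profileD1 a b 1 a ^ 2) := fun d => by
    rw [E2_modeField, coeff_modeField, if_pos rfl,
      show (profileD1 a b 1 a : ℂ) * d / 2 = ((profileD1 a b 1 a / 2 : ℝ) : ℂ) * d by
        push_cast; ring, map_mul, Complex.conj_ofReal, mul_left_comm, Complex.re_ofReal_mul,
      Complex.mul_conj, Complex.normSq_eq_norm_sq, Complex.ofReal_re]
    ring
  rw [slipRate, slipForm_modeField, slipForm_modeField, hE2, hE2]
  rw [E3_modeField ha hab le_rfl 1] at hpos ⊢
  rw [E3_modeField ha hab le_rfl c]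
  simp only [norm_one, one_pow, one_mul] at hpos ⊢
  generalize (∫ r in Ioo a b, _ : ℝ) = I at hpos ⊢
  field_simp

lemma slipForm_combo_self {a b : ℝ} (ha : 0 < a) (u w : X1 a b) (c : ℝ) :
    slipForm (u.combo ha c w) (u.combo ha c w)
      = slipForm u u + 2 * c * slipForm u w + c ^ 2 * slipForm w w := by
  simp only [slipForm, X1.E1_combo_self, X1.E2_combo_self]
  ring

/-- Pythagoras: the first mode and the remainder are orthogonal for `slipForm`. They need not be
orthogonal for `E₃`. -/
lemma slipForm_modeRest {a b : ℝ} (ha : 0 < a) (hab : a < b) (u : X1 a b) :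
    slipForm (modeRest ha hab le_rfl u) (modeRest ha hab le_rfl u)
      = slipForm u u - slipForm (modePart ha hab le_rfl u) (modePart ha hab le_rfl u) := by
  have h : slipForm u (modePart ha hab le_rfl u)
      = slipForm (modePart ha hab le_rfl u) (modePart ha hab le_rfl u) := by
    rw [modePart, slipForm_modeField, slipForm_modeField, ← modePart, E2_modePart_self,
      E2_modePart_modePart]
  rw [modeRest, slipForm_combo_self, h]
  ring

/-- The removed part lies in the kernel of the energy form at the critical viscosity. -/
lemma slipEnergy_muC_modeRest {a b : ℝ} (α : ℝ) (ha : 0 < a) (hab : a < b) (u : X1 a b) :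
    slipEnergy α (muC a b α) (modeRest ha hab le_rfl u) (modeRest ha hab le_rfl u)
      = slipEnergy α (muC a b α) u u := by
  have h1 := slipEnergy_muC_modeField α ha hab (2 * u.coeff 1 / profileD1 a b 1 a) u
  have h2 := slipEnergy_muC_modeField α ha hab (2 * u.coeff 1 / profileD1 a b 1 a)
    (modePart ha hab le_rfl u)
  unfold slipEnergy at h1 h2 ⊢
  rw [modeRest, X1.E1_combo_self, X1.E2_combo_self]
  unfold modePart at h2 ⊢
  linear_combination -2 * h1 + h2

/-- The energy near the critical viscosity. -/
lemma exists_slipEnergy_ge {a b α : ℝ} (ha : 0 < a) (hab : a < b) (hα : 0 < α) :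
    ∃ C δ₀, 0 < C ∧ 0 < δ₀ ∧ ∀ δ, |δ| ≤ δ₀ → ∀ u : X1 a b,
      (slipRate ha hab * δ - C * δ ^ 2) * E3 u u ≤ slipEnergy α (muC a b α + δ) u u := by
  obtain ⟨Cp, hCp, hp⟩ := poincare_inequality ha hab
  set s := slipRate ha hab with hs
  have hs0 : 0 < s := slipRate_pos ha hab
  -- The spectral gap between orders one and two: at the critical viscosity the energy of a field
  -- without first mode is at least `g` times `slipForm`.
  set g := muC a b α - α / slipConst a b 2 with hg
  have hg0 : 0 < g := by
    rw [hg, muC_eq_div α ha hab, sub_pos]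
    exact div_lt_div_of_pos_left hα (slipConst_pos ha hab le_rfl) (slipConst_lt ha hab le_rfl)
  -- Half of the gap is left to absorb the perturbation `δ slipForm`; by the Poincaré inequality the
  -- other half covers `2 η E₃ v v`, one `η` for the cross term and one for `δ s E₃ v v`.
  set η := g / (4 * Cp) with hη
  have hη0 : 0 < η := by positivity
  refine ⟨s ^ 2 / η, min (g / 2) (η / s), by positivity, by positivity, fun δ hδ u => ?_⟩
  have hδ1 : |δ| ≤ g / 2 := hδ.trans (min_le_left _ _)
  have hδ2 : |δ| * s ≤ η := by
    rw [← le_div_iff₀ hs0]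
    exact hδ.trans (min_le_right _ _)
  set k := modePart ha hab le_rfl u with hk
  set v := modeRest ha hab le_rfl u with hv
  have hv0 : ∀ n, 1 ≤ n → n < 2 → v.coeff n = 0 := fun n h1 h2 => by
    rw [hv, coeff_modeRest, if_pos (by omega)]
  have hQ : g * slipForm v v ≤ slipEnergy α (muC a b α) u u := by
    rw [← slipEnergy_muC_modeRest α ha hab u]
    exact sub_mul_slipForm_le ha hab hα (muC a b α) one_le_two v hv0
  -- All fields of order one have the same ratio `s` of `slipForm` to `E₃`, whatever their complex
  -- amplitude. This is what makes `s` the exact first-order coefficient.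
  have hA : slipForm u u = slipForm v v + s * E3 k k := by
    have h1 := slipForm_modeRest ha hab u
    have h2 : slipForm k k = s * E3 k k := slipForm_modeField_one ha hab _
    rw [← h2]
    linarith
  have hE : E3 k k = E3 u u - 2 * E3 u v + E3 v v := by
    have h1 : E3 v v = E3 u u + 2 * (-1) * E3 u k + (-1) ^ 2 * E3 k k :=
      X1.E3_combo_self ha u k (-1)
    have h2 : E3 v u = E3 u u + (-1) * E3 k u := X1.E3_combo ha u k u (-1)
    rw [X1.E3_comm v u, X1.E3_comm k u] at h2
    linarith
  -- Since `u = k + v` is not `E₃`-orthogonal, passing from `E₃ k k` to `E₃ u u` leaves a cross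
  -- term. Completing the square in `v - (δ s / η) u` bounds it, and its cost `s² δ² / η` is the
  -- quadratic error.
  have hcross : 0 ≤ η * E3 v v - 2 * (δ * s) * E3 u v + s ^ 2 / η * δ ^ 2 * E3 u u := by
    have h1 := mul_nonneg hη0.le (v.combo ha (-(δ * s / η)) u).E3_nonneg
    rw [X1.E3_combo_self, X1.E3_comm v u] at h1
    refine h1.trans (le_of_eq ?_)
    field_simp
    ring
  have hvp : E3 v v ≤ Cp * slipForm v v := hp v
  have hA0 := slipForm_nonneg ha hab v
  have hE0 := v.E3_nonneg
  have h1 : 2 * (η * E3 v v) ≤ g / 2 * slipForm v v := by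
    calc 2 * (η * E3 v v) ≤ 2 * (η * (Cp * slipForm v v)) := by gcongr
      _ = _ := by rw [hη]; field_simp; ring
  have h2 : -(η * E3 v v) ≤ δ * s * E3 v v := by
    have : -η ≤ δ * s := by
      have := mul_le_mul_of_nonneg_right (neg_abs_le δ) hs0.le
      linarith
    have := mul_le_mul_of_nonneg_right this hE0
    linarith
  have h3 : -(g / 2 * slipForm v v) ≤ δ * slipForm v v := by
    have := mul_le_mul_of_nonneg_right ((neg_le_neg hδ1).trans (neg_abs_le δ)) hA0
    linarith
  rw [slipEnergy_sub α _ (muC a b α), add_sub_cancel_left, hA, hE]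
  linarith

/-- The derivative of the first eigenvalue at the critical viscosity. -/
theorem hasDerivAt_lambda1 {a b α : ℝ} (ha : 0 < a) (hab : a < b) (hα : 0 < α) :
    HasDerivAt (fun μ => lambda1 a b α μ) (-slipRate ha hab) (muC a b α) := by
  obtain ⟨C, δ₀, hC, hδ₀, h⟩ := exists_slipEnergy_ge ha hab hα
  have hc := muC_pos ha hab hα
  rw [hasDerivAt_iff_isLittleO_nhds_zero]
  -- The upper and lower bounds for the infimum differ by `C δ²`, so the remainder is `o(δ)`. The
  -- neighbourhood is also small enough that `μ_c + δ` stays positive.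
  refine (Asymptotics.IsBigO.of_bound C ?_).trans_isLittleO
    (Asymptotics.isLittleO_pow_id one_lt_two)
  have hnear : ∀ᶠ δ in 𝓝 (0 : ℝ), |δ| < min δ₀ (muC a b α) :=
    (continuous_abs.tendsto' 0 0 abs_zero).eventually (gt_mem_nhds (lt_min hδ₀ hc))
  filter_upwards [hnear] with δ hδ
  have hδ1 := (hδ.trans_le (min_le_left _ _)).le
  have hμ : 0 < muC a b α + δ := by
    have := neg_abs_le δ
    have := hδ.trans_le (min_le_right _ _)
    linarith
  have h1 := sInf_energyQuotients_le ha hab hα hμ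
  rw [add_sub_cancel_left] at h1
  have h2 : slipRate ha hab * δ - C * δ ^ 2 ≤ sInf (energyQuotients a b α (muC a b α + δ)) :=
    le_csInf (energyQuotients_nonempty _ _ ha hab) (le_of_mem_energyQuotients (h δ hδ1))
  rw [lambda1_muC ha hab hα, lambda1, smul_eq_mul, Real.norm_eq_abs, Real.norm_eq_abs,
    abs_of_nonneg (sq_nonneg δ), abs_le]
  have := mul_nonneg hC.le (sq_nonneg δ)
  constructor <;> linarith

/-! ### The critical viscosity in closed form -/

lemma harmonicNorm_one {a b : ℝ} (ha : 0 < a) (hab : a < b) :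
    4 * harmonicNorm a b 1 = -(a ^ 4 + 3 * b ^ 4 - 4 * a ^ 2 * b ^ 2
      - 4 * b ^ 4 * (Real.log b - Real.log a)) := by
  have hsub : ∀ r ∈ uIcc a b, 0 < r := fun r hr => uIcc_subset_Ioi ha hab hr
  have hd : ∀ r ∈ uIcc a b, HasDerivAt
      (fun r => r ^ 4 / 4 - b ^ 2 * r ^ 2 + b ^ 4 * Real.log r) (r * radialHarmonic b 1 r ^ 2) r :=
    fun r hr => by
    have hr0 := (hsub r hr).ne'
    have h := (((hasDerivAt_pow 4 r).div_const 4).sub ((hasDerivAt_pow 2 r).const_mul (b ^ 2))).add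
      ((Real.hasDerivAt_log hr0).const_mul (b ^ 4))
    refine h.congr_deriv ?_
    rw [radialHarmonic]
    push_cast
    field_simp
    ring
  have hc : ContinuousOn (fun r => r * radialHarmonic b 1 r ^ 2) (uIcc a b) :=
    continuousOn_id.mul (((continuousOn_radialHarmonic b 1).mono fun r hr => hsub r hr).pow 2)
  rw [harmonicNorm, intervalIntegral.integral_eq_sub_of_hasDerivAt hd hc.intervalIntegrable]
  ring

/-- With `N = ∫ r h²` for `n = 1` and `a h(a) = a² - b²` one gets `γ₁ = (a² - b²)² / N`. The closed
form of `N` contains the logarithm, and the denominator is `-2 ((a² - b²)² + 2 N)`, hence nonzero.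
-/
lemma muC_closed {a b : ℝ} (α : ℝ) (ha : 0 < a) (hab : a < b) :
    b ^ 4 - a ^ 4 - 4 * b ^ 4 * (Real.log b - Real.log a) ≠ 0 ∧
    muC a b α * (2 * (b ^ 4 - a ^ 4 - 4 * b ^ 4 * (Real.log b - Real.log a)))
      = a * α * (a ^ 4 + 3 * b ^ 4 - 4 * a ^ 2 * b ^ 2
        - 4 * b ^ 4 * (Real.log b - Real.log a)) := by
  have hN := harmonicNorm_pos le_rfl ha hab
  have h1 := harmonicNorm_one ha hab
  have hX : b ^ 4 - a ^ 4 - 4 * b ^ 4 * (Real.log b - Real.log a)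
      = -(2 * ((a ^ 2 - b ^ 2) ^ 2 + 2 * harmonicNorm a b 1)) := by linarith
  have hpos : 0 < (a ^ 2 - b ^ 2) ^ 2 + 2 * harmonicNorm a b 1 := by positivity
  refine ⟨by rw [hX]; exact neg_ne_zero.2 (by positivity), ?_⟩
  have hg : gammaVal a b 1 + 2
      = ((a ^ 2 - b ^ 2) ^ 2 + 2 * harmonicNorm a b 1) / harmonicNorm a b 1 := by
    rw [gammaVal, radialHarmonic]
    field_simp
  have hm : muC a b α = a * α / (gammaVal a b 1 + 2) := by
    rw [muC, mul_gammaInf ha hab, gammaMode_eq le_rfl ha hab, add_assoc]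
    norm_num
  rw [hm, hg, hX]
  field_simp
  linear_combination -α * h1

lemma det_boundaryMatrix (a b α μ : ℝ) :
    (boundaryMatrix a b α μ).det = 4 * a ^ 2 * b ^ 2
      * (μ * (2 * (b ^ 4 - a ^ 4 - 4 * b ^ 4 * (Real.log b - Real.log a)))
        - a * α * (a ^ 4 + 3 * b ^ 4 - 4 * a ^ 2 * b ^ 2
          - 4 * b ^ 4 * (Real.log b - Real.log a))) := by
  rw [boundaryMatrix, Matrix.det_succ_row_zero]
  simp [Fin.sum_univ_succ, Matrix.det_fin_three, Fin.succAbove]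
  ring

theorem det_boundaryMatrix_eq_zero_iff {a b : ℝ} (α μ : ℝ) (ha : 0 < a) (hab : a < b) :
    (boundaryMatrix a b α μ).det = 0 ↔ μ = muC a b α := by
  obtain ⟨hX, h⟩ := muC_closed α ha hab
  have hb := ha.trans hab
  rw [det_boundaryMatrix, mul_eq_zero, or_iff_right (by positivity), ← h, ← sub_mul, mul_eq_zero,
    or_iff_left (mul_ne_zero two_ne_zero hX), sub_eq_zero]

theorem muC_eq {a b : ℝ} (α : ℝ) (ha : 0 < a) (hab : a < b) :
    muC a b α =
      a * α * (1 + 3 * (b / a) ^ 4 - 4 * (b / a) ^ 2 - 4 * (b / a) ^ 4 * Real.log (b / a)) /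
        (2 * ((b / a) ^ 4 - 1 - 4 * (b / a) ^ 4 * Real.log (b / a))) := by
  obtain ⟨hX, h⟩ := muC_closed α ha hab
  have ha4 : a ^ 4 ≠ 0 := by positivity
  rw [← Real.log_div (ha.trans hab).ne' ha.ne'] at hX h
  set D := Real.log (b / a) with hD
  have e1 : (b / a) ^ 4 - 1 - 4 * (b / a) ^ 4 * D = (b ^ 4 - a ^ 4 - 4 * b ^ 4 * D) / a ^ 4 := by
    field_simp
  have e2 : 1 + 3 * (b / a) ^ 4 - 4 * (b / a) ^ 2 - 4 * (b / a) ^ 4 * D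
      = (a ^ 4 + 3 * b ^ 4 - 4 * a ^ 2 * b ^ 2 - 4 * b ^ 4 * D) / a ^ 4 := by
    field_simp
  rw [e1, e2, eq_div_iff (by positivity)]
  field_simp
  linarith

/-! ### The ordinary differential equation -/

lemma D1_eq_of_hasDerivAt {a b : ℝ} (hab : a < b) {f : ℝ → ℝ} {f' r : ℝ} (hr : r ∈ Icc a b)
    (h : HasDerivAt f f' r) : D1 a b f r = f' :=
  h.hasDerivWithinAt.derivWithin (uniqueDiffOn_Icc hab r hr)

lemma D1_eqOn_deriv {a b : ℝ} (f : ℝ → ℝ) : EqOn (D1 a b f) (deriv f) (Ioo a b) := fun _ hr =>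
  derivWithin_of_mem_nhds (Icc_mem_nhds hr.1 hr.2)

lemma D1_congr_Icc {a b : ℝ} {f g : ℝ → ℝ} (h : EqOn f g (Icc a b)) :
    EqOn (D1 a b f) (D1 a b g) (Icc a b) := fun _ hr => derivWithin_congr h (h hr)

lemma D2_congr_Icc {a b : ℝ} {f g : ℝ → ℝ} (h : EqOn f g (Icc a b)) :
    EqOn (D2 a b f) (D2 a b g) (Icc a b) := D1_congr_Icc (D1_congr_Icc h)

lemma D1_congr_Ioo {a b : ℝ} {f g : ℝ → ℝ} (h : EqOn f g (Ioo a b)) :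
    EqOn (D1 a b f) (D1 a b g) (Ioo a b) := fun r hr => by
  rw [D1_eqOn_deriv f hr, D1_eqOn_deriv g hr]
  exact (h.eventuallyEq_of_mem (Ioo_mem_nhds hr.1 hr.2)).deriv_eq

lemma modeLaplacian_congr {a b : ℝ} (n : ℕ) {f g : ℝ → ℝ} (h : EqOn f g (Ioo a b)) :
    EqOn (modeLaplacian a b n f) (modeLaplacian a b n g) (Ioo a b) := fun r hr => by
  rw [modeLaplacian, modeLaplacian, D2, D2, D1_congr_Ioo (D1_congr_Ioo h) hr, D1_congr_Ioo h hr,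
    h hr]

lemma ContDiffOn.D1_Ioo {a b : ℝ} {f : ℝ → ℝ} {m n : WithTop ℕ∞}
    (h : ContDiffOn ℝ n f (Ioo a b)) (hmn : m + 1 ≤ n) : ContDiffOn ℝ m (D1 a b f) (Ioo a b) :=
  (h.deriv_of_isOpen isOpen_Ioo hmn).congr (D1_eqOn_deriv f)

lemma ContDiffOn.hasDerivAt_D1 {a b : ℝ} {f : ℝ → ℝ} (h : ContDiffOn ℝ 1 f (Ioo a b)) {r : ℝ}
    (hr : r ∈ Ioo a b) : HasDerivAt f (D1 a b f r) r := by
  rw [D1_eqOn_deriv f hr]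
  exact ((h.contDiffAt (Ioo_mem_nhds hr.1 hr.2)).differentiableAt one_ne_zero).hasDerivAt

lemma exists_const_of_hasDerivAt_zero {a b : ℝ} {f : ℝ → ℝ}
    (h : ∀ r ∈ Ioo a b, HasDerivAt f 0 r) : ∃ c, ∀ r ∈ Ioo a b, f r = c :=
  isOpen_Ioo.exists_is_const_of_deriv_eq_zero isPreconnected_Ioo
    (fun r hr => (h r hr).differentiableAt.differentiableWithinAt) fun r hr => (h r hr).deriv

/-- The kernel of `Δ₁`. -/
lemma exists_of_modeLaplacian_one_eq_zero {a b : ℝ} (ha : 0 < a) {f : ℝ → ℝ}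
    (hf : ContDiffOn ℝ 2 f (Ioo a b)) (h : ∀ r ∈ Ioo a b, modeLaplacian a b 1 f r = 0) :
    ∃ c d : ℝ, ∀ r ∈ Ioo a b, f r = c * r + d / r := by
  have h1 : ∀ r ∈ Ioo a b, HasDerivAt f (D1 a b f r) r := fun r hr =>
    ContDiffOn.hasDerivAt_D1 (hf.of_le one_le_two) hr
  have h2 : ∀ r ∈ Ioo a b, HasDerivAt (D1 a b f) (D2 a b f r) r := fun r hr =>
    ContDiffOn.hasDerivAt_D1 (ContDiffOn.D1_Ioo hf (by norm_num)) hr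
  have hne : ∀ r ∈ Ioo a b, r ≠ 0 := fun r hr => (ha.trans hr.1).ne'
  -- First integral: `Δ₁ f = (f' + f / r)'`.
  obtain ⟨c, hc⟩ := exists_const_of_hasDerivAt_zero (f := fun r => D1 a b f r + f r / r)
    fun r hr => by
      have hr0 := hne r hr
      refine ((h2 r hr).add ((h1 r hr).div (hasDerivAt_id' r) hr0)).congr_deriv ?_
      rw [← h r hr, modeLaplacian]
      push_cast
      field_simp
      ring
  -- Second integral: `f' + f / r = c` means `(r f)' = c r`.
  obtain ⟨d, hd⟩ := exists_const_of_hasDerivAt_zero (f := fun r => r * f r - c / 2 * r ^ 2)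
    fun r hr => by
      have hr0 := hne r hr
      refine (((hasDerivAt_id' r).mul (h1 r hr)).sub
        ((hasDerivAt_pow 2 r).const_mul (c / 2))).congr_deriv ?_
      have := hc r hr
      field_simp at this
      push_cast
      linarith
  refine ⟨c / 2, d, fun r hr => ?_⟩
  have hr0 := hne r hr
  rw [← hd r hr]
  field_simp
  ring

lemma modeLaplacian_of_hasDerivAt {a b : ℝ} (hab : a < b) {f f₁ : ℝ → ℝ} {f₂ r : ℝ} (n : ℕ)
    (hr : r ∈ Ioo a b) (h1 : ∀ s ∈ Ioo a b, HasDerivAt f (f₁ s) s) (h2 : HasDerivAt f₁ f₂ r) :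
    modeLaplacian a b n f r = f₂ + 1 / r * f₁ r - (n : ℝ) ^ 2 / r ^ 2 * f r := by
  have e1 : EqOn (D1 a b f) f₁ (Ioo a b) := fun s hs =>
    D1_eq_of_hasDerivAt hab (Ioo_subset_Icc_self hs) (h1 s hs)
  rw [modeLaplacian, D2, D1_congr_Ioo e1 hr, e1 hr,
    D1_eq_of_hasDerivAt hab (Ioo_subset_Icc_self hr) h2]

/-- The general solution of `Δ₁² Ψ = 0`. -/
def bihMode (c : Fin 4 → ℝ) (r : ℝ) : ℝ :=
  c 0 * r + c 1 * (r * Real.log r) + c 2 / r + c 3 * r ^ 3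

/-- The first derivative of the general solution. -/
def bihModeD1 (c : Fin 4 → ℝ) (r : ℝ) : ℝ :=
  c 0 + c 1 * (Real.log r + 1) - c 2 / r ^ 2 + 3 * c 3 * r ^ 2

/-- The second derivative of the general solution. -/
def bihModeD2 (c : Fin 4 → ℝ) (r : ℝ) : ℝ :=
  c 1 / r + 2 * c 2 / r ^ 3 + 6 * c 3 * r

lemma hasDerivAt_bihMode (c : Fin 4 → ℝ) {r : ℝ} (hr : 0 < r) :
    HasDerivAt (bihMode c) (bihModeD1 c r) r := by
  have h := ((((hasDerivAt_id' r).const_mul (c 0)).add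
    (((hasDerivAt_id' r).mul (Real.hasDerivAt_log hr.ne')).const_mul (c 1))).add
    ((hasDerivAt_inv hr.ne').const_mul (c 2))).add ((hasDerivAt_pow 3 r).const_mul (c 3))
  refine h.congr_deriv ?_
  rw [bihModeD1]
  push_cast
  field_simp
  ring

lemma hasDerivAt_bihModeD1 (c : Fin 4 → ℝ) {r : ℝ} (hr : 0 < r) :
    HasDerivAt (bihModeD1 c) (bihModeD2 c r) r := by
  have h := ((((Real.hasDerivAt_log hr.ne').add_const 1).const_mul (c 1)).const_add (c 0)).sub
    (((hasDerivAt_pow 2 r).inv (pow_ne_zero 2 hr.ne')).const_mul (c 2)) |>.add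
    ((hasDerivAt_pow 2 r).const_mul (3 * c 3))
  refine h.congr_deriv ?_
  rw [bihModeD2]
  push_cast
  field_simp
  ring

lemma contDiffOn_bihMode (c : Fin 4 → ℝ) (n : WithTop ℕ∞) :
    ContDiffOn ℝ n (bihMode c) (Ioi 0) := by
  have hid : ContDiffOn ℝ n (fun r : ℝ => r) (Ioi 0) := contDiffOn_id
  have hne : ∀ r ∈ Ioi (0 : ℝ), r ≠ 0 := fun r hr => ne_of_gt hr
  exact (((contDiffOn_const.mul hid).add (contDiffOn_const.mul (hid.mul (hid.log hne)))).add
    (contDiffOn_const.div hid hne)).add (contDiffOn_const.mul (hid.pow 3))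

lemma modeLaplacian_bihMode {a b : ℝ} (ha : 0 < a) (hab : a < b) (c : Fin 4 → ℝ) {r : ℝ}
    (hr : r ∈ Ioo a b) :
    modeLaplacian a b 1 (bihMode c) r = 8 * c 3 * r + 2 * c 1 / r := by
  have hr0 : 0 < r := ha.trans hr.1
  rw [modeLaplacian_of_hasDerivAt hab 1 hr
    (fun s hs => hasDerivAt_bihMode c (ha.trans hs.1)) (hasDerivAt_bihModeD1 c hr0),
    bihMode, bihModeD1, bihModeD2]
  push_cast
  field_simp
  ring

lemma modeLaplacian_modeLaplacian_bihMode {a b : ℝ} (ha : 0 < a) (hab : a < b) (c : Fin 4 → ℝ)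
    {r : ℝ} (hr : r ∈ Ioo a b) :
    modeLaplacian a b 1 (modeLaplacian a b 1 (bihMode c)) r = 0 := by
  have e : EqOn (modeLaplacian a b 1 (bihMode c)) (bihMode ![8 * c 3, 0, 2 * c 1, 0])
      (Ioo a b) := fun s hs => by
    rw [modeLaplacian_bihMode ha hab c hs]
    simp [bihMode]
  rw [modeLaplacian_congr 1 e hr, modeLaplacian_bihMode ha hab _ hr]
  simp

lemma modeLaplacian_sub {a b : ℝ} (n : ℕ) {f g : ℝ → ℝ} (hf : ContDiffOn ℝ 2 f (Ioo a b))
    (hg : ContDiffOn ℝ 2 g (Ioo a b)) {r : ℝ} (hr : r ∈ Ioo a b) :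
    modeLaplacian a b n (fun s => f s - g s) r
      = modeLaplacian a b n f r - modeLaplacian a b n g r := by
  have h1 : ∀ {f : ℝ → ℝ}, ContDiffOn ℝ 2 f (Ioo a b) → ∀ r ∈ Ioo a b,
      HasDerivAt f (D1 a b f r) r := fun hf r hr =>
    ContDiffOn.hasDerivAt_D1 (hf.of_le one_le_two) hr
  have h2 : ∀ {f : ℝ → ℝ}, ContDiffOn ℝ 2 f (Ioo a b) →
      HasDerivAt (D1 a b f) (D2 a b f r) r := fun hf =>
    ContDiffOn.hasDerivAt_D1 (ContDiffOn.D1_Ioo hf (by norm_num)) hr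
  rw [modeLaplacian_of_hasDerivAt (hr.1.trans hr.2) n hr
    (fun s hs => (h1 hf s hs).fun_sub (h1 hg s hs)) ((h2 hf).fun_sub (h2 hg)), modeLaplacian,
    modeLaplacian]
  ring

theorem biharmonic_mode_iff {a b : ℝ} (ha : 0 < a) (hab : a < b) {Ψ : ℝ → ℝ}
    (hΨ : ContDiffOn ℝ 4 Ψ (Ioo a b)) :
    (∀ r ∈ Ioo a b, modeLaplacian a b 1 (modeLaplacian a b 1 Ψ) r = 0) ↔
      ∃ c, EqOn Ψ (bihMode c) (Ioo a b) := by
  constructor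
  · intro h
    have hne : ∀ r ∈ Ioo a b, r ≠ 0 := fun r hr => (ha.trans hr.1).ne'
    have hid : ContDiffOn ℝ 2 (fun r : ℝ => r) (Ioo a b) := contDiffOn_id
    have h3 := ContDiffOn.D1_Ioo (m := 3) hΨ (by norm_num)
    have h2 : ContDiffOn ℝ 2 (D2 a b Ψ) (Ioo a b) := ContDiffOn.D1_Ioo h3 (by norm_num)
    have hL : ContDiffOn ℝ 2 (modeLaplacian a b 1 Ψ) (Ioo a b) :=
      (h2.add ((contDiffOn_const.div hid hne).mul (h3.of_le (by norm_num)))).sub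
        ((contDiffOn_const.div (hid.pow 2) fun r hr => pow_ne_zero 2 (hne r hr)).mul
          (hΨ.of_le (by norm_num)))
    obtain ⟨A, B, hAB⟩ := exists_of_modeLaplacian_one_eq_zero ha hL h
    have hΨ2 : ContDiffOn ℝ 2 Ψ (Ioo a b) := hΨ.of_le (by norm_num)
    -- Since `Δ₁ Ψ = A r + B / r`, the coefficients `B / 2` and `A / 8` give a particular solution
    -- with the same Laplacian; the difference is in the kernel of `Δ₁`.
    have hp : ContDiffOn ℝ 2 (bihMode ![0, B / 2, 0, A / 8]) (Ioo a b) :=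
      (contDiffOn_bihMode _ 2).mono fun r hr => ha.trans hr.1
    obtain ⟨c, d, hcd⟩ := exists_of_modeLaplacian_one_eq_zero ha (hΨ2.sub hp) fun r hr => by
      refine (modeLaplacian_sub 1 hΨ2 hp hr).trans ?_
      rw [hAB r hr, modeLaplacian_bihMode ha hab _ hr]
      simp
      ring
    refine ⟨![c, B / 2, d, A / 8], fun r hr => ?_⟩
    have h0 : Ψ r - bihMode ![0, B / 2, 0, A / 8] r = c * r + d / r := hcd r hr
    rw [sub_eq_iff_eq_add.1 h0]
    simp [bihMode]
    ring
  · rintro ⟨c, hc⟩ r hr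
    rw [modeLaplacian_congr 1 (modeLaplacian_congr 1 hc) hr]
    exact modeLaplacian_modeLaplacian_bihMode ha hab c hr

/-! ### The boundary value problem -/

lemma eq_zero_of_mul_add_div_eq_zero {a b c d : ℝ} (ha : 0 < a) (hab : a < b)
    (h : ∀ r ∈ Ioo a b, c * r + d / r = 0) : c = 0 ∧ d = 0 := by
  obtain ⟨r, hr⟩ := exists_between hab
  obtain ⟨s, hs⟩ := exists_between hr.2
  have hr0 : 0 < r := ha.trans hr.1
  have hs0 : 0 < s := hr0.trans hs.1
  have h1 := h r hr
  have h2 := h s ⟨hr.1.trans hs.1, hs.2⟩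
  field_simp at h1 h2
  have h3 : c * (s ^ 2 - r ^ 2) = 0 := by linarith
  have h4 : s ^ 2 - r ^ 2 ≠ 0 := by nlinarith [hs.1]
  have hc : c = 0 := (mul_eq_zero.1 h3).resolve_right h4
  refine ⟨hc, ?_⟩
  rw [hc] at h1
  linarith

/-- The functions `r`, `r log r`, `1 / r`, `r³` are linearly independent. -/
lemma eq_zero_of_bihMode_eq_zero {a b : ℝ} (ha : 0 < a) (hab : a < b) {c : Fin 4 → ℝ}
    (h : EqOn (bihMode c) 0 (Ioo a b)) : c = 0 := by
  -- Applying `Δ₁` annihilates `r` and `1 / r`, so the other two coefficients can be read off first.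
  have h1 := eq_zero_of_mul_add_div_eq_zero ha hab (c := 8 * c 3) (d := 2 * c 1) fun r hr => by
    have e : EqOn (bihMode c) (bihMode 0) (Ioo a b) := fun s hs => by
      rw [h hs]; simp [bihMode]
    rw [← modeLaplacian_bihMode ha hab c hr, modeLaplacian_congr 1 e hr,
      modeLaplacian_bihMode ha hab _ hr]
    simp
  have h3 : c 3 = 0 := by linarith [h1.1]
  have h4 : c 1 = 0 := by linarith [h1.2]
  have h2 := eq_zero_of_mul_add_div_eq_zero ha hab (c := c 0) (d := c 2) fun r hr => by
    have := h hr
    simpa [bihMode, h3, h4] using this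
  funext i
  fin_cases i
  · exact h2.1
  · exact h4
  · exact h2.2
  · exact h3

lemma boundaryMatrix_mulVec {a b α μ : ℝ} (ha : 0 < a) (hb : 0 < b) (hμ : 0 < μ)
    (c : Fin 4 → ℝ) :
    (boundaryMatrix a b α μ).mulVec c = ![a * bihMode c a, b * bihMode c b,
      b ^ 3 * (bihModeD2 c b + bihModeD1 c b / b),
      μ * a ^ 3 * (bihModeD2 c a - (1 / a - α / μ) * bihModeD1 c a)] := by
  funext i
  fin_cases i
  all_goals
    simp [boundaryMatrix, Matrix.mulVec, dotProduct, Fin.sum_univ_succ, bihMode, bihModeD1,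
      bihModeD2]
    field_simp
    ring

lemma boundaryMatrix_mulVec_eq_zero_iff {a b α μ : ℝ} (ha : 0 < a) (hb : 0 < b) (hμ : 0 < μ)
    (c : Fin 4 → ℝ) :
    (boundaryMatrix a b α μ).mulVec c = 0 ↔ bihMode c a = 0 ∧ bihMode c b = 0 ∧
      bihModeD2 c b + bihModeD1 c b / b = 0 ∧
      bihModeD2 c a - (1 / a - α / μ) * bihModeD1 c a = 0 := by
  rw [boundaryMatrix_mulVec ha hb hμ, funext_iff, Fin.forall_fin_succ, Fin.forall_fin_succ,
    Fin.forall_fin_succ, Fin.forall_fin_one]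
  simp [ha.ne', hb.ne', hμ.ne']

lemma D1_bihMode {a b : ℝ} (ha : 0 < a) (hab : a < b) (c : Fin 4 → ℝ) :
    EqOn (D1 a b (bihMode c)) (bihModeD1 c) (Icc a b) := fun _ hr =>
  D1_eq_of_hasDerivAt hab hr (hasDerivAt_bihMode c (ha.trans_le hr.1))

lemma D2_bihMode {a b : ℝ} (ha : 0 < a) (hab : a < b) (c : Fin 4 → ℝ) :
    EqOn (D2 a b (bihMode c)) (bihModeD2 c) (Icc a b) := fun r hr => by
  rw [D2, D1_congr_Icc (D1_bihMode ha hab c) hr]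
  exact D1_eq_of_hasDerivAt hab hr (hasDerivAt_bihModeD1 c (ha.trans_le hr.1))

/-- The equation reduces a solution to four coefficients, on which the boundary conditions act
through the matrix. Linear independence of the four functions makes a nonzero kernel vector the same
as a nontrivial solution. -/
theorem exists_isNontrivialSolution_iff {a b α μ : ℝ} (ha : 0 < a) (hab : a < b) (hμ : 0 < μ) :
    (∃ Ψ, IsNontrivialSolution a b α μ Ψ) ↔ (boundaryMatrix a b α μ).det = 0 := by
  have hb := ha.trans hab
  have hma : a ∈ Icc a b := left_mem_Icc.2 hab.le
  have hmb : b ∈ Icc a b := right_mem_Icc.2 hab.le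
  rw [← Matrix.exists_mulVec_eq_zero_iff]
  constructor
  · rintro ⟨Ψ, h⟩
    obtain ⟨c, hc⟩ := (biharmonic_mode_iff ha hab h.contDiffOn_open).1 h.ode
    have hcont : ContinuousOn (bihMode c) (Icc a b) := fun r hr =>
      (hasDerivAt_bihMode c (ha.trans_le hr.1)).continuousAt.continuousWithinAt
    -- Continuity extends the formula to the end points, so the one-sided derivatives in the
    -- boundary conditions are those of the explicit function.
    have hcl : EqOn Ψ (bihMode c) (Icc a b) :=
      hc.of_subset_closure h.contDiffOn_closed.continuousOn hcont Ioo_subset_Icc_self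
        (closure_Ioo hab.ne).ge
    refine ⟨c, fun h0 => ?_, (boundaryMatrix_mulVec_eq_zero_iff ha hb hμ c).2 ⟨?_, ?_, ?_, ?_⟩⟩
    · obtain ⟨r, hr, hne⟩ := h.nontrivial
      refine hne ?_
      rw [hcl hr, h0]
      simp [bihMode]
    · rw [← hcl hma, h.val_left]
    · rw [← hcl hmb, h.val_right]
    · rw [← D2_bihMode ha hab c hmb, ← D1_bihMode ha hab c hmb, ← D2_congr_Icc hcl hmb,
        ← D1_congr_Icc hcl hmb, h.free_right]
    · rw [← D2_bihMode ha hab c hma, ← D1_bihMode ha hab c hma, ← D2_congr_Icc hcl hma,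
        ← D1_congr_Icc hcl hma, h.slip_left]
  · rintro ⟨c, hc, h⟩
    obtain ⟨h1, h2, h3, h4⟩ := (boundaryMatrix_mulVec_eq_zero_iff ha hb hμ c).1 h
    refine ⟨bihMode c, ⟨(contDiffOn_bihMode c 2).mono fun r hr => ha.trans_le hr.1,
      (contDiffOn_bihMode c 4).mono fun r hr => ha.trans hr.1,
      fun r hr => modeLaplacian_modeLaplacian_bihMode ha hab c hr, h1, ?_, h2, ?_, ?_⟩⟩
    · rw [D2_bihMode ha hab c hma, D1_bihMode ha hab c hma, h4]
    · rw [D2_bihMode ha hab c hmb, D1_bihMode ha hab c hmb, h3]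
    · by_contra! h0
      exact hc (eq_zero_of_bihMode_eq_zero ha hab fun r hr => h0 r (Ioo_subset_Icc_self hr))



end

end AnnulusFlow

/-! ### The main theorem -/

theorem mainTheorem2 (a b α : ℝ) (ha : 0 < a) (hab : a < b) (hα : 0 < α) :
    -- the infima defining the constants are taken over nonempty sets bounded below
    ((AnnulusFlow.boundaryQuotients a b).Nonempty ∧
      BddBelow (AnnulusFlow.boundaryQuotients a b)) ∧
    (∀ n : ℕ, 1 ≤ n → (AnnulusFlow.modeQuotients a b n).Nonempty ∧
      BddBelow (AnnulusFlow.modeQuotients a b n)) ∧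
    (∀ μ : ℝ, 0 < μ → (AnnulusFlow.energyQuotients a b α μ).Nonempty ∧
      BddBelow (AnnulusFlow.energyQuotients a b α μ)) ∧
    -- monotonicity in the Fourier mode, and the first mode gives the variational constant
    (∀ n : ℕ, 1 ≤ n → AnnulusFlow.gammaMode a b n < AnnulusFlow.gammaMode a b (n + 1)) ∧
    a * AnnulusFlow.gammaInf a b = AnnulusFlow.gammaMode a b 1 + 1 ∧
    AnnulusFlow.muC a b α = a * α / (AnnulusFlow.gammaMode a b 1 + 2) ∧
    -- the general solution of the ordinary differential equation
    (∀ Ψ : ℝ → ℝ, ContDiffOn ℝ 4 Ψ (Set.Ioo a b) →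
      ((∀ r ∈ Set.Ioo a b,
          AnnulusFlow.modeLaplacian a b 1 (AnnulusFlow.modeLaplacian a b 1 Ψ) r = 0) ↔
        ∃ c₁ c₂ c₃ c₄ : ℝ, ∀ r ∈ Set.Ioo a b,
          Ψ r = c₁ * r + c₂ * (r * Real.log r) + c₃ / r + c₄ * r ^ 3)) ∧
    -- nontrivial solvability of the boundary value problem
    (∀ μ : ℝ, 0 < μ →
      ((∃ Ψ : ℝ → ℝ, AnnulusFlow.IsNontrivialSolution a b α μ Ψ) ↔
        (AnnulusFlow.boundaryMatrix a b α μ).det = 0)) ∧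
    (∀ μ : ℝ, 0 < μ →
      ((∃ Ψ : ℝ → ℝ, AnnulusFlow.IsNontrivialSolution a b α μ Ψ) ↔
        μ = AnnulusFlow.muC a b α)) ∧
    -- the closed formula
    0 < AnnulusFlow.muC a b α ∧
    AnnulusFlow.muC a b α =
      a * α * (1 + 3 * (b / a) ^ 4 - 4 * (b / a) ^ 2 - 4 * (b / a) ^ 4 * Real.log (b / a)) /
        (2 * ((b / a) ^ 4 - 1 - 4 * (b / a) ^ 4 * Real.log (b / a))) ∧
    -- the first eigenvalue vanishes exactly at the critical viscosity, where it is the largest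
    -- eigenvalue and has a negative derivative
    (∀ μ : ℝ, 0 < μ →
      (AnnulusFlow.lambda1 a b α μ = 0 ↔ μ = AnnulusFlow.muC a b α)) ∧
    IsGreatest {lam : ℝ | AnnulusFlow.IsStokesEigenvalue a b α (AnnulusFlow.muC a b α) lam}
      (AnnulusFlow.lambda1 a b α (AnnulusFlow.muC a b α)) ∧
    ∃ d : ℝ, d < 0 ∧
      HasDerivAt (fun μ : ℝ => AnnulusFlow.lambda1 a b α μ) d (AnnulusFlow.muC a b α) := by
  have hγ := AnnulusFlow.mul_gammaInf ha hab
  refine ⟨⟨⟨_, (AnnulusFlow.isLeast_boundaryQuotients ha hab).1⟩,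
      ⟨_, (AnnulusFlow.isLeast_boundaryQuotients ha hab).2⟩⟩,
    fun n hn => ⟨⟨_, (AnnulusFlow.isLeast_modeQuotients hn ha hab).1⟩,
      ⟨_, (AnnulusFlow.isLeast_modeQuotients hn ha hab).2⟩⟩,
    fun μ hμ => ⟨AnnulusFlow.energyQuotients_nonempty α μ ha hab,
      AnnulusFlow.bddBelow_energyQuotients ha hab hα hμ⟩,
    fun n hn => ?_, hγ, ?_, fun Ψ hΨ => ?_,
    fun μ hμ => AnnulusFlow.exists_isNontrivialSolution_iff ha hab hμ,
    fun μ hμ => (AnnulusFlow.exists_isNontrivialSolution_iff ha hab hμ).trans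
      (AnnulusFlow.det_boundaryMatrix_eq_zero_iff α μ ha hab),
    AnnulusFlow.muC_pos ha hab hα, AnnulusFlow.muC_eq α ha hab,
    fun μ hμ => AnnulusFlow.lambda1_eq_zero_iff ha hab hα hμ,
    AnnulusFlow.isGreatest_stokesEigenvalue ha hab hα,
    _, neg_neg_of_pos (AnnulusFlow.slipRate_pos ha hab),
    AnnulusFlow.hasDerivAt_lambda1 ha hab hα⟩
  · rw [AnnulusFlow.gammaMode_eq hn ha hab, AnnulusFlow.gammaMode_eq (by omega) ha hab]
    exact AnnulusFlow.gammaVal_lt hn ha hab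
  · rw [AnnulusFlow.muC, hγ, add_assoc]
    norm_num
  · refine (AnnulusFlow.biharmonic_mode_iff ha hab hΨ).trans ⟨?_, ?_⟩
    · rintro ⟨c, hc⟩
      exact ⟨c 0, c 1, c 2, c 3, hc⟩
    · rintro ⟨c₁, c₂, c₃, c₄, h⟩
      exact ⟨![c₁, c₂, c₃, c₄], h⟩
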